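/- **Setting.** Consider a sequence of designs indexed by $k\in\mathbb N$; all quantities below may depend on $k$, and limits are taken as $k\to\infty$. A design has $a$ groups. In group $i$ there are $n_i\ge 6$ independent observations $X_{i,1},\dots,X_{i,n_i}\sim\mathcal N_{d_i}(\mu_i,\Sigma_i)$ with $\Sigma_i$ positive definite, and observations of different groups are independent. Put $N=\sum_i n_i$, $D=\sum_i d_i$, $n_{\min}=\min_i n_i$. Let $T=(T_{ir})_{i,r\le a}\in\mathbb R^{D\times D}$ be a nonzero symmetric idempotent matrix, $V=\bigoplus_{i=1}^a\frac N{n_i}\Sigma_i$, let $\lambda_1\ge\dots\ge\lambda_D$ be the eigenvalues of $TVT$, and put $$\beta_1=\frac{\lambda_1}{\sqrt{\sum_{s=1}^D\lambda_s^2}},\qquad f_P=\frac{\operatorname{tr}^3((TV)^2)}{\operatorname{tr}^2((TV)^3)}.$$ Assume one of the following asymptotic frameworks: 1. $a$ is fixed and $\min(\max_i d_i,n_{\min})\to\infty$; 2. every $d_i$ is fixed (it does not depend on $k$) and $\min(a,n_{\min})\to\infty$; 3. $\min(a,\max_i d_i,n_{\min})\to\infty$. **Estimators.** Let $\ell=(\ell_{p,i})$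 assign to every group $i$ indices $\ell_{1,i},\dots,\ell_{m,i}\in\{1,\dots,n_i\}$, and let $Z_{pq}(\ell)\in\mathbb R^D$ be the vector with blocks $\sqrt{N/n_i}\,(X_{i,\ell_{p,i}}-X_{i,\ell_{q,i}})$, $i=1,\dots,a$. Put $$h_2(\ell)=\big[Z_{12}(\ell)^\top TZ_{34}(\ell)\big]^2,$$ $$h_3(\ell)=Z_{12}(\ell)^\top TZ_{34}(\ell)\cdot Z_{34}(\ell)^\top TZ_{56}(\ell)\cdot Z_{56}(\ell)^\top TZ_{12}(\ell).$$ Define $$A_2=\frac{\sum_\ell h_2(\ell)}{4\prod_i 6\binom{n_i}{4}},\qquad A_3=\frac{\sum_\ell h_3(\ell)}{8\prod_i \frac{n_i!}{(n_i-6)!}},$$ where the first sum runs over all $\ell$ such that in every group $\ell_{1,i},\dots,\ell_{4,i}$ are pairwise distinct, $\ell_{1,i}<\ell_{2,i}$ and $\ell_{3,i}<\ell_{4,i}$, and the second one over all $\ell$ such that in every group $\ell_{1,i},\dots,\ell_{6,i}$ are pairwise distinct. For $m\in\{4,6\}$ let $\sigma^{(m)}(1),\dots,\sigma^{(m)}(\Upsilon)$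 be random index choices: for every $\upsilon$ and $i$, $m$ indices of group $i$ are drawn uniformly without replacement from $\{1,\dots,n_i\}$, independently for different $(\upsilon,i)$ and independently of the data. Suppose that the number $\Upsilon$ of subsamples tends to $\infty$, and put $$A_2^\star(\Upsilon)=\frac1{4\Upsilon}\sum_{\upsilon=1}^\Upsilon h_2(\sigma^{(4)}(\upsilon)),\qquad A_3^\star(\Upsilon)=\frac1{8\Upsilon}\sum_{\upsilon=1}^\Upsilon h_3(\sigma^{(6)}(\upsilon)),$$ $$\hat f_P^A=\frac{A_2^3}{A_3^2},\qquad \hat f_P^{A\star}(\Upsilon)=\frac{A_2^\star(\Upsilon)^3}{A_3^\star(\Upsilon)^2}.$$ For $f>0$ let $K_f=(\chi^2_f-f)/\sqrt{2f}$, where $\chi_f^2$ has the chi-squared distribution with $f$ degrees of freedom. For a random $\hat f$, let $K_{\hat f}$ be a random variable whose conditional distribution given $\hat f=f$ is that of $K_f$. **Statement.** In each of the three frameworks the following holds. a) $\dfrac1{\hat f_P^A}-\dfrac1{f_P}\to0$ in probability. b) $\dfrac1{\hat f_P^{A\star}(\Upsilon)}-\dfrac1{f_P}\to0$ in probability. c)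 For each of the two estimators $\hat f\in\{\hat f_P^A,\hat f_P^{A\star}(\Upsilon)\}$: $K_{\hat f}$ converges in distribution to the standard normal distribution if and only if $\beta_1\to0$, and it converges in distribution to $(\chi_1^2-1)/\sqrt2$ if and only if $\beta_1\to1$. Both equivalences also hold if convergence in distribution of $K_{\hat f}$ is replaced by weak convergence, in probability, of the conditional distribution of $K_{\hat f}$ given $\hat f$. No condition relating $n_{\min}$ to $a$ is imposed beyond the frameworks; in particular the statement covers the case $n_{\min}=\mathcal O(a^p)$ for some $p>1$, as well as the case $a^p=\mathcal O(n_{\min})$ for some $p>1$. -/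

import Mathlib

open MeasureTheory ProbabilityTheory Filter Topology

noncomputable section

/-- The deterministic parameters of a split-plot design with `a` groups, where group `i` has
dimension `d i`, sample size `n i`, mean `mu i`, covariance matrix `Sigma i`, and where `T` is a
nonzero symmetric idempotent hypothesis matrix acting on the pooled space `ℝ ^ (∑ i, d i)`.
The bound `6 ≤ n i` is what makes the denominators of the trace estimators nonzero. -/
structure SplitPlot where
  a : ℕ
  d : Fin a → ℕ
  n : Fin a → ℕ
  six_le_n : ∀ i, 6 ≤ n i
  mu : ∀ i, EuclideanSpace ℝ (Fin (d i))
  Sigma : ∀ i, Matrix (Fin (d i)) (Fin (d i)) ℝ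
  Sigma_posDef : ∀ i, (Sigma i).PosDef
  T : Matrix ((i : Fin a) × Fin (d i)) ((i : Fin a) × Fin (d i)) ℝ
  T_symm : T.IsSymm
  T_idem : IsIdempotentElem T
  T_ne_zero : T ≠ 0

namespace SplitPlot

/-- Indices of the coordinates of the pooled space. -/
abbrev Idx (M : SplitPlot) : Type := (i : Fin M.a) × Fin (M.d i)

/-- A data set: `n i` observation vectors of dimension `d i` in every group `i`. -/
abbrev Data (M : SplitPlot) : Type :=
  ∀ i : Fin M.a, Fin (M.n i) → EuclideanSpace ℝ (Fin (M.d i))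

/-- The total sample size. -/
def N (M : SplitPlot) : ℕ := ∑ i, M.n i

/-- The smallest sample size. -/
def nMin (M : SplitPlot) : ℕ := ⨅ i, M.n i

/-- The largest dimension. -/
def dMax (M : SplitPlot) : ℕ := ⨆ i, M.d i

/-- The block diagonal matrix with blocks `(N / n i) • Sigma i`. -/
def V (M : SplitPlot) : Matrix M.Idx M.Idx ℝ :=
  Matrix.blockDiagonal' fun i => ((M.N : ℝ) / (M.n i : ℝ)) • M.Sigma i

/-- The Pearson degrees of freedom. -/
def fP (M : SplitPlot) : ℝ :=
  Matrix.trace ((M.T * M.V) ^ 2) ^ 3 / Matrix.trace ((M.T * M.V) ^ 3) ^ 2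

theorem V_isHermitian (M : SplitPlot) : M.V.IsHermitian := by
  unfold V Matrix.IsHermitian
  rw [Matrix.blockDiagonal'_conjTranspose]
  congr 1
  funext i
  rw [Matrix.conjTranspose_smul, (M.Sigma_posDef i).isHermitian.eq]
  simp

theorem TVT_isHermitian (M : SplitPlot) : (M.T * M.V * M.T).IsHermitian := by
  have h := Matrix.isHermitian_mul_mul_conjTranspose M.T M.V_isHermitian
  have hT : M.T.conjTranspose = M.T := by
    rw [Matrix.conjTranspose_eq_transpose_of_trivial]; exact M.T_symm
  rwa [hT] at h

/-- The eigenvalues of `T V T`, with multiplicity. -/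
def eig (M : SplitPlot) : M.Idx → ℝ := M.TVT_isHermitian.eigenvalues

/-- The largest eigenvalue of `T V T` divided by the Euclidean norm of all its eigenvalues. -/
def beta1 (M : SplitPlot) : ℝ := (⨆ s, M.eig s) / √(∑ s, M.eig s ^ 2)

/-- The bilinear form `uᵀ T v`. -/
def form (M : SplitPlot) (u v : M.Idx → ℝ) : ℝ := u ⬝ᵥ (M.T.mulVec v)

/-- The pooled vector of differences: if `l i 0, …, l i (m - 1)` are indices of observations in
group `i`, its block `i` is `√(N / n i) • (X i (l i p) - X i (l i q))`. -/
def Z (M : SplitPlot) (x : M.Data) {m : ℕ} (l : ∀ i, Fin m → Fin (M.n i)) (p q : Fin m) :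
    M.Idx → ℝ :=
  fun s => √((M.N : ℝ) / (M.n s.1 : ℝ)) * (x s.1 (l s.1 p) s.2 - x s.1 (l s.1 q) s.2)

/-- The summand of the estimator of `tr ((T V) ^ 2)`, without its factor `1 / 4`. -/
def kernel2 (M : SplitPlot) (x : M.Data) (l : ∀ i, Fin 4 → Fin (M.n i)) : ℝ :=
  M.form (M.Z x l 0 1) (M.Z x l 2 3) ^ 2

/-- The summand of the estimator of `tr ((T V) ^ 3)`, without its factor `1 / 8`. -/
def kernel3 (M : SplitPlot) (x : M.Data) (l : ∀ i, Fin 6 → Fin (M.n i)) : ℝ :=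
  M.form (M.Z x l 0 1) (M.Z x l 2 3) * M.form (M.Z x l 2 3) (M.Z x l 4 5) *
    M.form (M.Z x l 4 5) (M.Z x l 0 1)

open Classical in
/-- The estimator of `tr ((T V) ^ 2)`: in every group the sum runs over the pairwise distinct
indices `l i 0, …, l i 3` with `l i 0 < l i 1` and `l i 2 < l i 3`. -/
def A2 (M : SplitPlot) (x : M.Data) : ℝ :=
  (∑ l ∈ Fintype.piFinset fun i => Finset.univ.filter fun t : Fin 4 → Fin (M.n i) =>
      Function.Injective t ∧ t 0 < t 1 ∧ t 2 < t 3, M.kernel2 x l) /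
    (4 * ∏ i, (6 * ((M.n i).choose 4 : ℝ)))

open Classical in
/-- The estimator of `tr ((T V) ^ 3)`: in every group the sum runs over the pairwise distinct
indices `l i 0, …, l i 5`. -/
def A3 (M : SplitPlot) (x : M.Data) : ℝ :=
  (∑ l ∈ Fintype.piFinset fun i => Finset.univ.filter fun t : Fin 6 → Fin (M.n i) =>
      Function.Injective t, M.kernel3 x l) /
    (8 * ∏ i, (((M.n i).factorial : ℝ) / ((M.n i - 6).factorial : ℝ)))

/-- `U` subsamples; each of them consists of `m` indices in every group. -/
abbrev Subsamples (M : SplitPlot) (U m : ℕ) : Type := Fin U → ∀ i : Fin M.a, Fin m → Fin (M.n i)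

/-- The subsampling version of `A2` with `U` summands. -/
def A2star (M : SplitPlot) {U : ℕ} (x : M.Data) (s : M.Subsamples U 4) : ℝ :=
  (∑ u, M.kernel2 x (s u)) / (4 * (U : ℝ))

/-- The subsampling version of `A3` with `U` summands. -/
def A3star (M : SplitPlot) {U : ℕ} (x : M.Data) (s : M.Subsamples U 6) : ℝ :=
  (∑ u, M.kernel3 x (s u)) / (8 * (U : ℝ))

/-- The estimator of the Pearson degrees of freedom. -/
def fPhat (M : SplitPlot) (x : M.Data) : ℝ := M.A2 x ^ 3 / M.A3 x ^ 2

/-- The subsampling estimator of the Pearson degrees of freedom. -/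
def fPhatStar (M : SplitPlot) {U : ℕ} (x : M.Data) (s4 : M.Subsamples U 4)
    (s6 : M.Subsamples U 6) : ℝ :=
  M.A2star x s4 ^ 3 / M.A3star x s6 ^ 2

/-- The random data set `X` consists of independent vectors, those of group `i` having the normal
distribution with mean `mu i` and covariance matrix `Sigma i`. -/
structure IsSample (M : SplitPlot) {Ω : Type*} [MeasurableSpace Ω] (P : Measure Ω)
    (X : Ω → M.Data) : Prop where
  law : ∀ i j, HasLaw (fun ω => X ω i j) (multivariateGaussian (M.mu i) (M.Sigma i)) P
  indep : iIndepFun (fun (p : (i : Fin M.a) × Fin (M.n i)) ω => X ω p.1 p.2) P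

/-- The `m` indices in group `i` of the `u`-th subsample are drawn uniformly without replacement,
independently for different `(u, i)` and independently of the data. -/
structure IsSubsampling (M : SplitPlot) {Ω : Type*} [MeasurableSpace Ω] (P : Measure Ω)
    (X : Ω → M.Data) {U m : ℕ} (S : Ω → M.Subsamples U m) : Prop where
  law : ∀ u i, HasLaw (fun ω => S ω u i)
    (uniformOn {t : Fin m → Fin (M.n i) | Function.Injective t}) P
  indep : iIndepFun (fun (p : Fin U × Fin M.a) ω => S ω p.1 p.2) P
  indep_data : IndepFun X S P

end SplitPlot

/-- Fixed number of groups; largest dimension and all sample sizes tend to infinity. -/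
def Framework1 (M : ℕ → SplitPlot) : Prop :=
  (∃ a₀ : ℕ, ∀ k, (M k).a = a₀) ∧
    Tendsto (fun k => min (M k).dMax (M k).nMin) atTop atTop

/-- Fixed dimension in every group; number of groups and all sample sizes tend to infinity. -/
def Framework2 (M : ℕ → SplitPlot) : Prop :=
  (∃ δ : ℕ → ℕ, ∀ k (i : Fin (M k).a), (M k).d i = δ i) ∧
    Tendsto (fun k => min (M k).a (M k).nMin) atTop atTop

/-- Number of groups, largest dimension and all sample sizes tend to infinity. -/
def Framework3 (M : ℕ → SplitPlot) : Prop :=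
  Tendsto (fun k => min (M k).a (min (M k).dMax (M k).nMin)) atTop atTop

/-- Convergence to `0` in probability of random variables that may live on different spaces. -/
def TendstoZeroInProbability {Ω : ℕ → Type*} [∀ k, MeasurableSpace (Ω k)]
    (P : ∀ k, Measure (Ω k)) (Y : ∀ k, Ω k → ℝ) : Prop :=
  ∀ ε : ℝ, 0 < ε → Tendsto (fun k => P k {ω | ε ≤ |Y k ω|}) atTop (𝓝 0)

/-- The chi-squared distribution with `f > 0` (not necessarily integer) degrees of freedom. -/
def chiSquaredLaw (f : ℝ) : Measure ℝ := gammaMeasure (f / 2) (1 / 2)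

/-- The distribution of `K_f = (χ²_f - f) / √(2 f)`, for `f > 0`. -/
def KLaw (f : ℝ) : Measure ℝ := (chiSquaredLaw f).map fun x => (x - f) / √(2 * f)

/-- The distribution of `(χ²_1 - 1) / √2`. -/
def stdChiSquaredOne : Measure ℝ := (chiSquaredLaw 1).map fun x => (x - 1) / √2

/-- `K_F` converges in distribution to `ν`, where `F` are random degrees of freedom, and `K_F` is a
random variable whose conditional distribution given `F = f` is the distribution of `K_f`. -/
def KTendstoInDistribution {Ω : ℕ → Type*} [∀ k, MeasurableSpace (Ω k)]
    (P : ∀ k, Measure (Ω k)) (F : ∀ k, Ω k → ℝ) (ν : Measure ℝ) : Prop :=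
  ∀ g : BoundedContinuousFunction ℝ ℝ,
    Tendsto (fun k => ∫ ω, (∫ x, g x ∂(KLaw (F k ω))) ∂(P k)) atTop (𝓝 (∫ x, g x ∂ν))

/-- The conditional distribution of `K_F` given the random degrees of freedom `F` converges weakly
to `ν`, in probability. -/
def KTendstoConditionally {Ω : ℕ → Type*} [∀ k, MeasurableSpace (Ω k)]
    (P : ∀ k, Measure (Ω k)) (F : ∀ k, Ω k → ℝ) (ν : Measure ℝ) : Prop :=
  ∀ g : BoundedContinuousFunction ℝ ℝ,
    TendstoZeroInProbability P fun k ω => (∫ x, g x ∂(KLaw (F k ω))) - ∫ x, g x ∂ν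

end

/-! The estimators are unbiased for `t2` $=\operatorname{tr}((TV)^2)$ and `t3`
$=\operatorname{tr}((TV)^3)$ up to explicit factors, and their mean square errors relative to
$t_2^2$ and $t_2^3$ are bounded by a constant times $1/\Upsilon+1/n_{\min}$. The bound involves
neither the number of groups nor the dimensions, so no relation between $a$ and $n_{\min}$ is
needed.

Differences of observations kill the means, so each kernel is a product of forms $\xi^\top M\xi$ in
standard Gaussian noise $\xi$. The observations behind different contrasts are disjoint, so each
form is bilinear in independent blocks; its moments are traces (`integral_kernel2`,
`integral_kernel3`) and its sixth moment is controlled by the Frobenius norm of $M$. The variance of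
an average of kernels is bounded by an Efron-Stein inequality (`integral_sub_integral_sq_le`) over
single noise coordinates. Setting one coordinate to zero alters only the kernels that contain its
observation, a proportion of order $m/n_i$, and alters each of them by an amount governed by
`weight`, one diagonal entry of $W^2$, where $W$ has the nonzero spectrum of $TVT$. These entries
sum to $t_2$, and the squared proportions within one group sum to $O(1/n_i)$. For random subsamples
one first conditions on the index choices; the expected squared proportions contribute the
additional $1/\Upsilon$.

Put $\tau=t_3/t_2^{3/2}\in(0,1]$, so that $1/f_P=\tau^2$. The error bounds give $A_2/t_2\to1$ and
$A_3/t_2^{3/2}-\tau\to0$ in probability, hence a) and b). Moreover $\beta_1^3\le\tau\le\beta_1$, so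
$\beta_1$ tends to 0 or to 1 exactly when $\tau^2$ does.

For c), the law of $K_{1/c}$, extended by the standard normal law at $c=0$, is weakly continuous in
$c$ (`continuous_integral_kLimit`) and determines $c\ge0$ through the left end of its support
(`kLimit_injOn`). As $\tau^2$ stays in the compact interval $[0,1]$, weak convergence of these laws
is equivalent to convergence of $\tau^2$. Since $1/\hat f-\tau^2\to0$ in probability, uniform
continuity carries this over to $K_{\hat f}$, conditionally and, by bounded convergence,
unconditionally. -/

noncomputable section

/-! ### Polynomial functions of independent standard Gaussian variables -/

/-- The law of a family of independent standard Gaussian variables. -/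
abbrev stdGaussianPi (J : Type*) [Fintype J] : Measure (J → ℝ) :=
  Measure.pi fun _ => gaussianReal 0 1

/-- Functions on `J → ℝ` given by a polynomial in the coordinates. -/
def IsPolyFun {J : Type*} (f : (J → ℝ) → ℝ) : Prop :=
  ∃ p : MvPolynomial J ℝ, ∀ x, f x = MvPolynomial.eval x p

namespace IsPolyFun

variable {J : Type*} {f g : (J → ℝ) → ℝ}

theorem const (c : ℝ) : IsPolyFun fun _ : J → ℝ => c := ⟨MvPolynomial.C c, by simp⟩

theorem coord (e : J) : IsPolyFun fun x : J → ℝ => x e := ⟨MvPolynomial.X e, by simp⟩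

theorem add (hf : IsPolyFun f) (hg : IsPolyFun g) : IsPolyFun fun x => f x + g x := by
  obtain ⟨p, hp⟩ := hf
  obtain ⟨q, hq⟩ := hg
  exact ⟨p + q, by simp [hp, hq]⟩

theorem sub (hf : IsPolyFun f) (hg : IsPolyFun g) : IsPolyFun fun x => f x - g x := by
  obtain ⟨p, hp⟩ := hf
  obtain ⟨q, hq⟩ := hg
  exact ⟨p - q, by simp [hp, hq]⟩

theorem mul (hf : IsPolyFun f) (hg : IsPolyFun g) : IsPolyFun fun x => f x * g x := by
  obtain ⟨p, hp⟩ := hf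
  obtain ⟨q, hq⟩ := hg
  exact ⟨p * q, by simp [hp, hq]⟩

theorem pow (hf : IsPolyFun f) (n : ℕ) : IsPolyFun fun x => f x ^ n := by
  obtain ⟨p, hp⟩ := hf
  exact ⟨p ^ n, by simp [hp]⟩

theorem div_const (hf : IsPolyFun f) (c : ℝ) : IsPolyFun fun x => f x / c := by
  simpa [div_eq_mul_inv] using hf.mul (const c⁻¹)

theorem sum {ι : Type*} {s : Finset ι} {f : ι → (J → ℝ) → ℝ} (h : ∀ i ∈ s, IsPolyFun (f i)) :
    IsPolyFun fun x => ∑ i ∈ s, f i x := by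
  classical
  induction s using Finset.induction_on with
  | empty => simpa using const (J := J) 0
  | insert i s hi ih =>
    simp only [Finset.sum_insert hi]
    exact (h i (by simp)).add (ih fun j hj => h j (by simp [hj]))

theorem comp_polyFun {K : Type*} {f : (K → ℝ) → ℝ} (hf : IsPolyFun f) {φ : (J → ℝ) → K → ℝ}
    (hφ : ∀ k, IsPolyFun fun x => φ x k) : IsPolyFun fun x => f (φ x) := by
  obtain ⟨p, hp⟩ := hf
  choose q hq using hφ
  refine ⟨MvPolynomial.bind₁ q p, fun x => ?_⟩
  show f (φ x) = _
  rw [hp, show MvPolynomial.eval x (MvPolynomial.bind₁ q p) =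
    MvPolynomial.eval₂Hom (RingHom.id ℝ) x (MvPolynomial.bind₁ q p) from rfl,
    MvPolynomial.eval₂Hom_bind₁, show φ x = fun k => MvPolynomial.eval x (q k) from
      funext fun k => hq k x]
  rfl

theorem continuous (hf : IsPolyFun f) : Continuous f := by
  obtain ⟨p, hp⟩ := hf
  rw [show f = fun x => MvPolynomial.eval x p from funext hp]
  exact MvPolynomial.continuous_eval p

variable [Fintype J]

theorem integrable (hf : IsPolyFun f) : Integrable f (stdGaussianPi J) := by
  obtain ⟨p, hp⟩ := hf
  rw [show f = fun x => MvPolynomial.eval x p from funext hp]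
  simp_rw [MvPolynomial.eval_eq']
  refine integrable_finsetSum _ fun d _ => Integrable.const_mul ?_ _
  refine Integrable.fintype_prod (f := fun i (t : ℝ) => t ^ d i) fun i => ?_
  rcases Nat.eq_zero_or_pos (d i) with h | h
  · simp [h]
  · have := (memLp_id_gaussianReal (μ := 0) (v := 1) (d i : NNReal)).integrable_norm_rpow
      (by simpa using h.ne') (by simp)
    refine this.mono' (by fun_prop) (ae_of_all _ fun t => ?_)
    simp

theorem memLp_two (hf : IsPolyFun f) : MemLp f 2 (stdGaussianPi J) :=
  (memLp_two_iff_integrable_sq hf.continuous.aestronglyMeasurable).2 (hf.pow 2).integrable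

end IsPolyFun

/-- Regard `p` as a polynomial in one variable with coefficients in the others. By induction the
leading coefficient is almost surely nonzero, and then only finitely many values of the remaining
variable are roots; Fubini concludes. -/
theorem ae_mvPolynomial_eval_ne_zero_fin {n : ℕ} (p : MvPolynomial (Fin n) ℝ) (hp : p ≠ 0) :
    ∀ᵐ x ∂(stdGaussianPi (Fin n)), MvPolynomial.eval x p ≠ 0 := by
  induction n with
  | zero =>
    refine ae_of_all _ fun x hx => hp ?_
    rw [MvPolynomial.eq_C_of_isEmpty p] at hx ⊢
    simpa using hx
  | succ n ih =>
    set q := MvPolynomial.finSuccEquiv ℝ n p with hq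
    have hq0 : q ≠ 0 := by simpa [hq] using hp
    have hmp := measurePreserving_piFinSuccAbove
      (fun _ : Fin (n + 1) => gaussianReal 0 1) 0
    have hlead := ih q.leadingCoeff (by simpa using hq0)
    have hprod : ∀ᵐ z ∂((stdGaussianPi (Fin n)).prod (gaussianReal 0 1)),
        MvPolynomial.eval (Fin.cons z.2 z.1 : Fin (n + 1) → ℝ) p ≠ 0 := by
      rw [Measure.ae_prod_iff_ae_ae]
      · filter_upwards [hlead] with s hs
        have hne : Polynomial.map (MvPolynomial.eval s) q ≠ 0 := by
          intro h0
          apply hs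
          have := congrArg (fun r => r.coeff q.natDegree) h0
          simpa [Polynomial.coeff_map] using this
        have : (({t | (Polynomial.map (MvPolynomial.eval s) q).IsRoot t} : Set ℝ)).Finite :=
          Polynomial.finite_setOfPred_isRoot hne
        have hna := nullSingletonClass_gaussianReal (μ := 0) (v := 1) one_ne_zero
        have h0 := this.measure_zero (gaussianReal 0 1)
        rw [ae_iff]
        convert h0 using 3 with t
        ext t
        simp [Polynomial.IsRoot, hq, MvPolynomial.eval_eq_eval_mv_eval']
      · refine (MeasurableSet.compl (measurableSet_singleton (0 : ℝ))).preimage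
          (f := fun z : (Fin n → ℝ) × ℝ =>
            MvPolynomial.eval (Fin.cons z.2 z.1 : Fin (n + 1) → ℝ) p) ?_
        refine ((MvPolynomial.continuous_eval p).comp ?_).measurable
        refine continuous_pi fun i => ?_
        refine Fin.cases ?_ (fun j => ?_) i
        · simpa using continuous_snd
        · simp only [Fin.cons_succ]
          fun_prop
    have h2 := (Measure.measurePreserving_swap (μ := gaussianReal 0 1)
      (ν := stdGaussianPi (Fin n))).quasiMeasurePreserving.ae hprod
    have h3 := hmp.quasiMeasurePreserving.ae h2
    filter_upwards [h3] with x hx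
    convert hx using 3
    funext i
    refine Fin.cases ?_ (fun j => ?_) i <;>
      simp [MeasurableEquiv.piFinSuccAbove, Fin.insertNthEquiv, Fin.tail]

/-- A polynomial that does not vanish identically vanishes on a null set only. -/
theorem IsPolyFun.ae_ne_zero {J : Type*} [Fintype J] {f : (J → ℝ) → ℝ} (hf : IsPolyFun f)
    (x₀ : J → ℝ) (h : f x₀ ≠ 0) : ∀ᵐ x ∂(stdGaussianPi J), f x ≠ 0 := by
  obtain ⟨p, hp⟩ := hf
  set e := Fintype.equivFin J
  have hp0 : MvPolynomial.rename e p ≠ 0 := by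
    intro h0
    have : p = 0 := MvPolynomial.rename_injective e e.injective (by simpa using h0)
    exact h (by simp [hp, this])
  have := ae_mvPolynomial_eval_ne_zero_fin _ hp0
  have hmp := measurePreserving_piCongrLeft (fun _ : Fin (Fintype.card J) => gaussianReal 0 1) e
  filter_upwards [hmp.quasiMeasurePreserving.ae this] with x hx
  rw [hp]
  convert hx using 1
  rw [MvPolynomial.eval_rename]
  congr 2
  funext j
  simp [MeasurableEquiv.piCongrLeft, Equiv.piCongrLeft, Equiv.piCongrLeft']

/-! ### Exchanging coordinates of two independent copies -/

section Swap

variable {J : Type*} [Fintype J] [DecidableEq J]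

/-- Regrouped as a family of independent pairs, the map swaps the two i.i.d. entries of the pairs
with index in `s`. -/
theorem measurePreserving_piecewise_swap (s : Finset J) :
    MeasurePreserving (fun z : (J → ℝ) × (J → ℝ) => (s.piecewise z.2 z.1, s.piecewise z.1 z.2))
      ((stdGaussianPi J).prod (stdGaussianPi J)) ((stdGaussianPi J).prod (stdGaussianPi J)) := by
  have h1 := measurePreserving_arrowProdEquivProdArrow ℝ ℝ J (fun _ => gaussianReal 0 1)
    (fun _ => gaussianReal 0 1)
  have h2 : MeasurePreserving
      (fun (w : J → ℝ × ℝ) j => (if j ∈ s then Prod.swap else id : ℝ × ℝ → ℝ × ℝ) (w j))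
      (Measure.pi fun _ => (gaussianReal 0 1).prod (gaussianReal 0 1))
      (Measure.pi fun _ => (gaussianReal 0 1).prod (gaussianReal 0 1)) := by
    refine measurePreserving_pi _ _
      (f := fun j => (if j ∈ s then Prod.swap else id : ℝ × ℝ → ℝ × ℝ)) fun j => ?_
    by_cases h : j ∈ s
    · simpa [h] using Measure.measurePreserving_swap
    · simpa [h] using MeasurePreserving.id _
  have h3 := h1.comp (h2.comp (h1.symm _))
  convert h3 using 1
  funext z
  ext j
  · by_cases h : j ∈ s <;>
      simp [h, MeasurableEquiv.arrowProdEquivProdArrow, Equiv.arrowProdEquivProdArrow]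
  · by_cases h : j ∈ s <;>
      simp [h, MeasurableEquiv.arrowProdEquivProdArrow, Equiv.arrowProdEquivProdArrow]

theorem measurePreserving_piecewise (s : Finset J) :
    MeasurePreserving (fun z : (J → ℝ) × (J → ℝ) => s.piecewise z.2 z.1)
      ((stdGaussianPi J).prod (stdGaussianPi J)) (stdGaussianPi J) :=
  measurePreserving_fst.comp (measurePreserving_piecewise_swap s)

theorem measurePreserving_piecewise' (s : Finset J) :
    MeasurePreserving (fun z : (J → ℝ) × (J → ℝ) => s.piecewise z.1 z.2)
      ((stdGaussianPi J).prod (stdGaussianPi J)) (stdGaussianPi J) :=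
  measurePreserving_snd.comp (measurePreserving_piecewise_swap s)

end Swap

end

noncomputable section

/-! ### A variance inequality of Efron-Stein type -/

theorem MeasureTheory.MeasurePreserving.integral_comp_of_aestronglyMeasurable {α β : Type*}
    [MeasurableSpace α] [MeasurableSpace β] {μ : Measure α} {ν : Measure β} {φ : α → β}
    (hφ : MeasurePreserving φ μ ν) {f : β → ℝ} (hf : AEStronglyMeasurable f ν) :
    ∫ x, f (φ x) ∂μ = ∫ y, f y ∂ν := by
  rw [← hφ.map_eq] at hf ⊢
  rw [integral_map hφ.measurable.aemeasurable hf]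

/-- The left side equals $\frac12\int(F-F\circ\sigma)(G-G\circ\sigma)$ because $\sigma$ is a measure
preserving involution. The invariant functions $P,Q$ may be inserted into both differences, and
$xy\le(x^2+y^2)/2$ together with $(x-y)^2\le2x^2+2y^2$ gives the bound. -/
theorem integral_mul_sub_integral_mul_comp_le {α : Type*} [MeasurableSpace α] {μ : Measure α}
    {σ : α → α} (hσ : MeasurePreserving σ μ μ) (hinv : ∀ z, σ (σ z) = z) {F G P Q : α → ℝ}
    (hF : MemLp F 2 μ) (hG : MemLp G 2 μ) (hP : MemLp P 2 μ) (hQ : MemLp Q 2 μ)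
    (hPσ : ∀ z, P (σ z) = P z) (hQσ : ∀ z, Q (σ z) = Q z) :
    ∫ z, F z * G z ∂μ - ∫ z, F z * G (σ z) ∂μ ≤
      ∫ z, (F z - P z) ^ 2 ∂μ + ∫ z, (G z - Q z) ^ 2 ∂μ := by
  have hFσ : MemLp (fun z => F (σ z)) 2 μ := hF.comp_measurePreserving hσ
  have hGσ : MemLp (fun z => G (σ z)) 2 μ := hG.comp_measurePreserving hσ
  have i1 : Integrable (fun z => F z * G z) μ := hF.integrable_mul hG
  have i2 : Integrable (fun z => F z * G (σ z)) μ := hF.integrable_mul hGσ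
  have i3 : Integrable (fun z => F (σ z) * G z) μ := hFσ.integrable_mul hG
  have i4 : Integrable (fun z => F (σ z) * G (σ z)) μ := hFσ.integrable_mul hGσ
  have j1 : Integrable (fun z => (F z - P z) ^ 2) μ := (hF.sub hP).integrable_sq
  have j2 : Integrable (fun z => (G z - Q z) ^ 2) μ := (hG.sub hQ).integrable_sq
  have j3 : Integrable (fun z => (F (σ z) - P z) ^ 2) μ := (hFσ.sub hP).integrable_sq
  have j4 : Integrable (fun z => (G (σ z) - Q z) ^ 2) μ := (hGσ.sub hQ).integrable_sq
  have e1 : ∫ z, F (σ z) * G (σ z) ∂μ = ∫ z, F z * G z ∂μ :=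
    hσ.integral_comp_of_aestronglyMeasurable i1.aestronglyMeasurable
  have e2 : ∫ z, F (σ z) * G z ∂μ = ∫ z, F z * G (σ z) ∂μ := by
    rw [← hσ.integral_comp_of_aestronglyMeasurable i2.aestronglyMeasurable]
    simp only [hinv]
  have e3 : ∫ z, (F (σ z) - P z) ^ 2 ∂μ = ∫ z, (F z - P z) ^ 2 ∂μ := by
    rw [← hσ.integral_comp_of_aestronglyMeasurable j1.aestronglyMeasurable]
    simp only [hPσ]
  have e4 : ∫ z, (G (σ z) - Q z) ^ 2 ∂μ = ∫ z, (G z - Q z) ^ 2 ∂μ := by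
    rw [← hσ.integral_comp_of_aestronglyMeasurable j2.aestronglyMeasurable]
    simp only [hQσ]
  have key : ∫ z, (F z * G z + F (σ z) * G (σ z) - (F z * G (σ z) + F (σ z) * G z)) ∂μ ≤
      ∫ z, ((F z - P z) ^ 2 + (F (σ z) - P z) ^ 2 + ((G z - Q z) ^ 2 + (G (σ z) - Q z) ^ 2)) ∂μ := by
    refine integral_mono ((i1.add i4).sub (i2.add i3)) ((j1.add j3).add (j2.add j4)) fun z => ?_
    show F z * G z + F (σ z) * G (σ z) - (F z * G (σ z) + F (σ z) * G z) ≤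
      (F z - P z) ^ 2 + (F (σ z) - P z) ^ 2 + ((G z - Q z) ^ 2 + (G (σ z) - Q z) ^ 2)
    nlinarith [sq_nonneg (F z - F (σ z) - (G z - G (σ z))), sq_nonneg (F z - P z + (F (σ z) - P z)),
      sq_nonneg (G z - Q z + (G (σ z) - Q z))]
  have k1 : Integrable (fun z => F z * G z + F (σ z) * G (σ z)) μ := i1.add i4
  have k2 : Integrable (fun z => F z * G (σ z) + F (σ z) * G z) μ := i2.add i3
  have k3 : Integrable (fun z => (F z - P z) ^ 2 + (F (σ z) - P z) ^ 2) μ := j1.add j3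
  have k4 : Integrable (fun z => (G z - Q z) ^ 2 + (G (σ z) - Q z) ^ 2) μ := j2.add j4
  rw [integral_sub k1 k2, integral_add i1 i4, integral_add i2 i3,
    integral_add k3 k4, integral_add j1 j3, integral_add j2 j4,
    e1, e2, e3, e4] at key
  linarith

/-- The variance of `f` is controlled by its distances to functions `g e` that do not depend on
the coordinate `e`. -/
theorem integral_sub_integral_sq_le {J : Type*} [Fintype J] [DecidableEq J]
    {f : (J → ℝ) → ℝ} {g : J → (J → ℝ) → ℝ} (hf : IsPolyFun f) (hg : ∀ e, IsPolyFun (g e))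
    (hgi : ∀ e x t, g e (Function.update x e t) = g e x) :
    ∫ x, (f x - ∫ y, f y ∂stdGaussianPi J) ^ 2 ∂stdGaussianPi J ≤
      2 * ∑ e, ∫ x, (f x - g e x) ^ 2 ∂stdGaussianPi J := by
  set μ := stdGaussianPi J with hμ
  -- Correlation of `f` at a point with `f` after the coordinates in `s` have been resampled. It
  -- interpolates between $E f^2$ for the empty set and $(E f)^2$ for the full set. Adding `e` to
  -- `s` amounts to composing the second factor with the swap of coordinate `e` between the two
  -- copies, and `g e` is invariant under that swap; the increments telescope.
  set c : Finset J → ℝ := fun s => ∫ z, f z.1 * f (s.piecewise z.2 z.1) ∂(μ.prod μ) with hc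
  have hstep : ∀ (s : Finset J) (e : J), e ∉ s →
      c s - c (insert e s) ≤ 2 * ∫ x, (f x - g e x) ^ 2 ∂μ := by
    intro s e he
    have hσ := measurePreserving_piecewise_swap ({e} : Finset J)
    have h1 : MeasurePreserving (Prod.fst : (J → ℝ) × (J → ℝ) → _) (μ.prod μ) μ :=
      measurePreserving_fst
    have hs := measurePreserving_piecewise s
    have hpf : ∀ z : (J → ℝ) × (J → ℝ),
        ({e} : Finset J).piecewise z.2 z.1 = Function.update z.1 e (z.2 e) := fun z => by
      simp [Finset.piecewise_singleton]
    have hps : ∀ z : (J → ℝ) × (J → ℝ),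
        s.piecewise (({e} : Finset J).piecewise z.1 z.2) (({e} : Finset J).piecewise z.2 z.1) =
          Function.update (s.piecewise z.2 z.1) e (z.2 e) := fun z => by
      funext j
      by_cases hj : j = e
      · subst hj; simp [he]
      · by_cases hjs : j ∈ s <;> simp [hj, hjs]
    have hins : ∀ z : (J → ℝ) × (J → ℝ), (insert e s).piecewise z.2 z.1 =
        Function.update (s.piecewise z.2 z.1) e (z.2 e) := fun z => by
      simp [Finset.piecewise_insert]
    have := integral_mul_sub_integral_mul_comp_le hσ
      (fun z => by
        ext j <;> by_cases hj : j = e <;> simp [hj])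
      (F := fun z => f z.1) (G := fun z => f (s.piecewise z.2 z.1))
      (P := fun z => g e z.1) (Q := fun z => g e (s.piecewise z.2 z.1))
      (hf.memLp_two.comp_measurePreserving h1) (hf.memLp_two.comp_measurePreserving hs)
      ((hg e).memLp_two.comp_measurePreserving h1) ((hg e).memLp_two.comp_measurePreserving hs)
      (fun z => by simp only [hpf, hgi]) (fun z => by simp only [hps, hgi])
    have hd : IsPolyFun fun x => (f x - g e x) ^ 2 := (hf.sub (hg e)).pow 2
    have e1 : ∫ z, (f z.1 - g e z.1) ^ 2 ∂(μ.prod μ) = ∫ x, (f x - g e x) ^ 2 ∂μ :=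
      h1.integral_comp_of_aestronglyMeasurable (f := fun x => (f x - g e x) ^ 2)
        hd.integrable.aestronglyMeasurable
    have e2 : ∫ z, (f (s.piecewise z.2 z.1) - g e (s.piecewise z.2 z.1)) ^ 2 ∂(μ.prod μ) =
        ∫ x, (f x - g e x) ^ 2 ∂μ :=
      hs.integral_comp_of_aestronglyMeasurable (f := fun x => (f x - g e x) ^ 2)
        hd.integrable.aestronglyMeasurable
    rw [e1, e2] at this
    simp only [hps] at this
    simp only [hc, hins]
    linarith
  have hsum : ∀ s : Finset J, c ∅ - c s ≤ 2 * ∑ e ∈ s, ∫ x, (f x - g e x) ^ 2 ∂μ := by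
    intro s
    induction s using Finset.induction_on with
    | empty => simp
    | insert e s he ih =>
      rw [Finset.sum_insert he]
      linarith [hstep s e he]
  have h0 : c ∅ = ∫ x, f x ^ 2 ∂μ := by
    simp only [hc, Finset.piecewise_empty, ← sq]
    exact measurePreserving_fst.integral_comp_of_aestronglyMeasurable (f := fun x => f x ^ 2)
        (hf.pow 2).integrable.aestronglyMeasurable
  have h1 : c Finset.univ = (∫ x, f x ∂μ) ^ 2 := by
    simp only [hc, Finset.piecewise_univ]
    rw [integral_prod_mul, sq]
  have h2 : ∫ x, (f x - ∫ y, f y ∂μ) ^ 2 ∂μ = ∫ x, f x ^ 2 ∂μ - (∫ x, f x ∂μ) ^ 2 := by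
    set m := ∫ y, f y ∂μ with hm
    have : ∀ x, (f x - m) ^ 2 = f x ^ 2 - (2 * m * f x - m ^ 2) := fun x => by ring
    simp only [this]
    rw [integral_sub (hf.pow 2).integrable, integral_sub, integral_const_mul, ← hm]
    · simp; ring
    · exact hf.integrable.const_mul _
    · exact integrable_const _
    · exact (hf.integrable.const_mul _).sub (integrable_const _)
  have := hsum Finset.univ
  rw [h0, h1] at this
  rw [h2]
  exact this

/-! ### Moments of linear and bilinear forms -/

section Moments

variable {J : Type*} [Fintype J]

theorem isPolyFun_dotProduct_const (a : J → ℝ) : IsPolyFun fun x : J → ℝ => x ⬝ᵥ a :=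
  IsPolyFun.sum fun e _ => (IsPolyFun.coord e).mul (IsPolyFun.const _)

theorem isPolyFun_dotProduct_mulVec (M : Matrix J J ℝ) :
    IsPolyFun fun x : J → ℝ => x ⬝ᵥ M.mulVec x :=
  IsPolyFun.sum fun e _ => (IsPolyFun.coord e).mul
    (IsPolyFun.sum fun f _ => (IsPolyFun.const _).mul (IsPolyFun.coord f))

theorem map_dotProduct_stdGaussianPi (a : J → ℝ) :
    (stdGaussianPi J).map (fun x => x ⬝ᵥ a) = gaussianReal 0 (∑ e, a e ^ 2).toNNReal := by
  set L : StrongDual ℝ (EuclideanSpace ℝ J) := innerSL ℝ (WithLp.toLp 2 a) with hL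
  have h1 : (fun x : J → ℝ => x ⬝ᵥ a) = L ∘ WithLp.toLp 2 := by
    funext x
    simp [hL, PiLp.inner_apply, dotProduct]
  rw [h1, ← Measure.map_map (by fun_prop) (by fun_prop), map_pi_eq_stdGaussian,
    IsGaussian.map_eq_gaussianReal, variance_dual_stdGaussian, integral_strongDual_stdGaussian]
  congr 2
  rw [hL, innerSL_apply_norm, EuclideanSpace.real_norm_sq_eq]

/-- The sixth moment of the standard normal distribution. -/
def gaussianSixthMoment : ℝ := ∫ t, t ^ 6 ∂gaussianReal 0 1

theorem gaussianSixthMoment_nonneg : 0 ≤ gaussianSixthMoment :=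
  integral_nonneg fun t => by positivity

theorem integral_pow_gaussianReal (v : NNReal) (n : ℕ) :
    ∫ t, t ^ (2 * n) ∂gaussianReal 0 v = (v : ℝ) ^ n * ∫ t, t ^ (2 * n) ∂gaussianReal 0 1 := by
  have h := gaussianReal_map_const_mul (μ := 0) (v := 1) (√(v : ℝ))
  have h2 : gaussianReal (√(v : ℝ) * 0) (NNReal.mk (√(v : ℝ) ^ 2) (sq_nonneg _) * 1) =
      gaussianReal 0 v := by
    congr 1
    · simp
    · ext; simp
  rw [← h2, ← h, integral_map (by fun_prop) (by fun_prop), ← integral_const_mul]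
  refine integral_congr_ae (ae_of_all _ fun t => ?_)
  simp only [mul_pow]
  rw [pow_mul (√(v : ℝ)), Real.sq_sqrt v.coe_nonneg]

theorem integral_dotProduct_pow (a : J → ℝ) (n : ℕ) :
    ∫ x, (x ⬝ᵥ a) ^ (2 * n) ∂stdGaussianPi J =
      (∑ e, a e ^ 2) ^ n * ∫ t, t ^ (2 * n) ∂gaussianReal 0 1 := by
  have hm : Measurable fun x : J → ℝ => x ⬝ᵥ a :=
    (isPolyFun_dotProduct_const a).continuous.measurable
  rw [← integral_map (f := fun t : ℝ => t ^ (2 * n)) hm.aemeasurable (by fun_prop),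
    map_dotProduct_stdGaussianPi, integral_pow_gaussianReal,
    Real.coe_toNNReal _ (Finset.sum_nonneg fun _ _ => sq_nonneg _)]

theorem integral_dotProduct_sq (a : J → ℝ) :
    ∫ x, (x ⬝ᵥ a) ^ 2 ∂stdGaussianPi J = ∑ e, a e ^ 2 := by
  have h := integral_dotProduct_pow a 1
  have h2 : ∫ t, t ^ 2 ∂gaussianReal 0 1 = 1 := by
    have := variance_id_gaussianReal (μ := 0) (v := 1)
    rw [variance_eq_integral aemeasurable_id] at this
    simpa using this
  simpa [h2] using h

theorem integral_dotProduct_mul (a b : J → ℝ) :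
    ∫ x, (x ⬝ᵥ a) * (x ⬝ᵥ b) ∂stdGaussianPi J = a ⬝ᵥ b := by
  have h : ∀ x : J → ℝ, (x ⬝ᵥ a) * (x ⬝ᵥ b) =
      ((x ⬝ᵥ (a + b)) ^ 2 - (x ⬝ᵥ (a - b)) ^ 2) / 4 := fun x => by
    rw [dotProduct_add, dotProduct_sub]; ring
  simp only [h]
  rw [integral_div, integral_sub ((isPolyFun_dotProduct_const _).pow 2).integrable
    ((isPolyFun_dotProduct_const _).pow 2).integrable, integral_dotProduct_sq,
    integral_dotProduct_sq, ← Finset.sum_sub_distrib, Finset.sum_div, dotProduct]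
  refine Finset.sum_congr rfl fun e _ => ?_
  simp only [Pi.add_apply, Pi.sub_apply]
  ring

theorem integral_dotProduct_mulVec [DecidableEq J] (A : Matrix J J ℝ) :
    ∫ x, x ⬝ᵥ A.mulVec x ∂stdGaussianPi J = A.trace := by
  have h : ∀ x : J → ℝ, x ⬝ᵥ A.mulVec x =
      ∑ e, (x ⬝ᵥ Pi.single e 1) * (x ⬝ᵥ A e) := fun x => by
    simp only [dotProduct_single_one]
    refine Finset.sum_congr rfl fun e _ => ?_
    rw [Matrix.mulVec, dotProduct_comm (A e)]
  simp only [h]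
  rw [integral_finsetSum]
  · simp only [integral_dotProduct_mul, single_dotProduct, one_mul]
    rfl
  · intro e _
    exact ((isPolyFun_dotProduct_const _).mul (isPolyFun_dotProduct_const _)).integrable

/-- The coordinates in `S` are independent of the remaining ones, so the two sets of coordinates may
be read off two independent copies and integrated one after the other. -/
theorem IsPolyFun.integral_decouple [DecidableEq J] {f : (J → ℝ) → ℝ} (hf : IsPolyFun f)
    (S : Finset J) :
    ∫ x, f x ∂stdGaussianPi J =
      ∫ y, ∫ x, f (S.piecewise x y) ∂stdGaussianPi J ∂stdGaussianPi J := by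
  have h := measurePreserving_piecewise' S
  rw [← h.integral_comp_of_aestronglyMeasurable hf.integrable.aestronglyMeasurable]
  exact integral_prod_symm _ (h.integrable_comp_of_integrable hf.integrable)

/-- A Hölder inequality for sixth moments. -/
theorem integral_sq_mul_sq_mul_sq_le {α : Type*} [MeasurableSpace α] {μ : Measure α}
    {x y z : α → ℝ} {a b c C : ℝ} (ha : 0 ≤ a) (hb : 0 ≤ b) (hc : 0 ≤ c)
    (hx : Integrable (fun t => x t ^ 6) μ) (hy : Integrable (fun t => y t ^ 6) μ)
    (hz : Integrable (fun t => z t ^ 6) μ)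
    (hxa : ∫ t, x t ^ 6 ∂μ ≤ C * a ^ 3) (hyb : ∫ t, y t ^ 6 ∂μ ≤ C * b ^ 3)
    (hzc : ∫ t, z t ^ 6 ∂μ ≤ C * c ^ 3) (hC : 0 ≤ C) :
    ∫ t, x t ^ 2 * y t ^ 2 * z t ^ 2 ∂μ ≤ C * (a * b * c) := by
  -- The scales may vanish, so they are enlarged by ε before dividing by them. The Hölder bound then
  -- follows from the pointwise inequality of arithmetic and geometric means, and ε tends to 0.
  have key : ∀ ε : ℝ, 0 < ε →
      ∫ t, x t ^ 2 * y t ^ 2 * z t ^ 2 ∂μ ≤ C * ((a + ε) * (b + ε) * (c + ε)) := by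
    intro ε hε
    have pa : 0 < a + ε := by positivity
    have pb : 0 < b + ε := by positivity
    have pc : 0 < c + ε := by positivity
    have ha' : ∫ t, x t ^ 6 ∂μ ≤ C * (a + ε) ^ 3 :=
      hxa.trans (mul_le_mul_of_nonneg_left (pow_le_pow_left₀ ha (by linarith) 3) hC)
    have hb' : ∫ t, y t ^ 6 ∂μ ≤ C * (b + ε) ^ 3 :=
      hyb.trans (mul_le_mul_of_nonneg_left (pow_le_pow_left₀ hb (by linarith) 3) hC)
    have hc' : ∫ t, z t ^ 6 ∂μ ≤ C * (c + ε) ^ 3 :=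
      hzc.trans (mul_le_mul_of_nonneg_left (pow_le_pow_left₀ hc (by linarith) 3) hC)
    set a' := a + ε
    set b' := b + ε
    set c' := c + ε
    have amgm : ∀ u v w : ℝ, 0 ≤ u → 0 ≤ v → 0 ≤ w → u * v * w ≤ (u ^ 3 + v ^ 3 + w ^ 3) / 3 := by
      intro u v w hu hv hw
      nlinarith [mul_nonneg (add_nonneg (add_nonneg hu hv) hw)
        (add_nonneg (add_nonneg (sq_nonneg (u - v)) (sq_nonneg (v - w))) (sq_nonneg (u - w)))]
    have hint : Integrable (fun t => (a' * b' * c' / 3) *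
        (x t ^ 6 / a' ^ 3 + y t ^ 6 / b' ^ 3 + z t ^ 6 / c' ^ 3)) μ :=
      (((hx.div_const _).add (hy.div_const _)).add (hz.div_const _)).const_mul _
    calc ∫ t, x t ^ 2 * y t ^ 2 * z t ^ 2 ∂μ
        ≤ ∫ t, (a' * b' * c' / 3) * (x t ^ 6 / a' ^ 3 + y t ^ 6 / b' ^ 3 + z t ^ 6 / c' ^ 3) ∂μ := by
          refine integral_mono_of_nonneg (ae_of_all _ fun t => by positivity) hint
            (ae_of_all _ fun t => ?_)
          have := amgm (x t ^ 2 / a') (y t ^ 2 / b') (z t ^ 2 / c') (by positivity) (by positivity)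
            (by positivity)
          calc x t ^ 2 * y t ^ 2 * z t ^ 2
              = a' * b' * c' * (x t ^ 2 / a' * (y t ^ 2 / b') * (z t ^ 2 / c')) := by
                field_simp
            _ ≤ a' * b' * c' * (((x t ^ 2 / a') ^ 3 + (y t ^ 2 / b') ^ 3 + (z t ^ 2 / c') ^ 3) / 3) :=
                mul_le_mul_of_nonneg_left this (by positivity)
            _ = _ := by simp only [div_pow, ← pow_mul]; ring
      _ = (a' * b' * c' / 3) * ((∫ t, x t ^ 6 ∂μ) / a' ^ 3 + (∫ t, y t ^ 6 ∂μ) / b' ^ 3 +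
            (∫ t, z t ^ 6 ∂μ) / c' ^ 3) := by
          have hxy : Integrable (fun t => x t ^ 6 / a' ^ 3 + y t ^ 6 / b' ^ 3) μ :=
            (hx.div_const _).add (hy.div_const _)
          rw [integral_const_mul, integral_add hxy (hz.div_const _), integral_add (hx.div_const _) (hy.div_const _), integral_div,
            integral_div, integral_div]
      _ ≤ (a' * b' * c' / 3) * (C + C + C) := by
          refine mul_le_mul_of_nonneg_left ?_ (by positivity)
          gcongr
          · rwa [div_le_iff₀ (by positivity)]
          · rwa [div_le_iff₀ (by positivity)]
          · rwa [div_le_iff₀ (by positivity)]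
      _ = C * (a' * b' * c') := by ring
  have hlim : Tendsto (fun ε : ℝ => C * ((a + ε) * (b + ε) * (c + ε))) (𝓝[>] 0)
      (𝓝 (C * (a * b * c))) := by
    have : Continuous fun ε : ℝ => C * ((a + ε) * (b + ε) * (c + ε)) := by fun_prop
    simpa using (this.tendsto 0).mono_left nhdsWithin_le_nhds
  exact ge_of_tendsto hlim (eventually_mem_nhdsWithin.mono fun ε hε => key ε hε)

end Moments

end

noncomputable section

/-! ### Decoupled bilinear forms in Gaussian variables -/

section Bilinear

variable {J : Type*}

/-- Every nonzero entry of `M` has its row in `S` and its column in `S'`. -/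
def Matrix.SupportedOn (M : Matrix J J ℝ) (S S' : Finset J) : Prop :=
  ∀ e f, M e f ≠ 0 → e ∈ S ∧ f ∈ S'

/-- The entries of `M` in the row or the column with index `e`. -/
def Matrix.cross [DecidableEq J] (M : Matrix J J ℝ) (e : J) : Matrix J J ℝ :=
  Matrix.of fun a b => if a = e ∨ b = e then M a b else 0

theorem Matrix.SupportedOn.cross [DecidableEq J] {M : Matrix J J ℝ} {S S' : Finset J} (h : M.SupportedOn S S')
    (e : J) : (M.cross e).SupportedOn S S' := by
  intro a b hab
  apply h a b
  intro h0
  simp [Matrix.cross, h0] at hab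

variable [Fintype J]

/-- The squared Frobenius norm. -/
def Matrix.frobSq (M : Matrix J J ℝ) : ℝ := ∑ e, ∑ f, M e f ^ 2

theorem Matrix.frobSq_nonneg (M : Matrix J J ℝ) : 0 ≤ M.frobSq :=
  Finset.sum_nonneg fun _ _ => Finset.sum_nonneg fun _ _ => sq_nonneg _

theorem Matrix.frobSq_eq_trace (M : Matrix J J ℝ) : M.frobSq = (M * M.transpose).trace := by
  simp [Matrix.frobSq, Matrix.trace, Matrix.mul_apply, sq]

/-- The cube expands into a triple sum over rows. Hölder bounds each term by the product of the
three squared row norms, and the sum of these products is again a cube. -/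
theorem integral_sum_sq_pow_three_le (M : Matrix J J ℝ) :
    ∫ y, (∑ e, (M.mulVec y e) ^ 2) ^ 3 ∂stdGaussianPi J ≤ gaussianSixthMoment * M.frobSq ^ 3 := by
  have hp : ∀ e, IsPolyFun fun y : J → ℝ => M.mulVec y e := fun e => by
    simp only [Matrix.mulVec, dotProduct_comm (M e)]
    exact isPolyFun_dotProduct_const (M e)
  have h6 : ∀ e, ∫ y, M.mulVec y e ^ 6 ∂stdGaussianPi J ≤
      gaussianSixthMoment * (∑ f, M e f ^ 2) ^ 3 := fun e => by
    have := integral_dotProduct_pow (M e) 3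
    simp only [Matrix.mulVec, dotProduct_comm (M e)]
    rw [this, mul_comm]
    rfl
  have expand : ∀ u : J → ℝ, (∑ e, u e) ^ 3 = ∑ e, ∑ f, ∑ g, u e * u f * u g := fun u => by
    rw [pow_succ, sq, Finset.sum_mul_sum, Finset.sum_mul_sum]
    refine Finset.sum_congr rfl fun e _ => ?_
    rw [Finset.sum_comm]
    simp only [Finset.sum_mul]
  simp only [expand, Matrix.frobSq]
  have hp2 : ∀ e f g, IsPolyFun fun y : J → ℝ =>
      M.mulVec y e ^ 2 * M.mulVec y f ^ 2 * M.mulVec y g ^ 2 := fun e f g =>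
    (((hp e).pow 2).mul ((hp f).pow 2)).mul ((hp g).pow 2)
  rw [integral_finsetSum _ fun e _ => (IsPolyFun.sum fun f _ => IsPolyFun.sum fun g _ =>
    hp2 e f g).integrable, Finset.mul_sum]
  refine Finset.sum_le_sum fun e _ => ?_
  rw [integral_finsetSum _ fun f _ => (IsPolyFun.sum fun g _ => hp2 e f g).integrable,
    Finset.mul_sum]
  refine Finset.sum_le_sum fun f _ => ?_
  rw [integral_finsetSum _ fun g _ => (hp2 e f g).integrable, Finset.mul_sum]
  refine Finset.sum_le_sum fun g _ => ?_
  have hs : ∀ e, 0 ≤ ∑ f, M e f ^ 2 := fun e => Finset.sum_nonneg fun _ _ => sq_nonneg _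
  exact integral_sq_mul_sq_mul_sq_le (hs e) (hs f) (hs g) ((hp e).pow 6).integrable
    ((hp f).pow 6).integrable ((hp g).pow 6).integrable (h6 e) (h6 f) (h6 g)
    gaussianSixthMoment_nonneg

variable [DecidableEq J]

theorem Matrix.frobSq_cross_le_add (M : Matrix J J ℝ) (e : J) :
    (M.cross e).frobSq ≤ (M * M.transpose) e e + (M.transpose * M) e e := by
  have h : ∀ a b, (M.cross e) a b ^ 2 ≤
      (if a = e then M e b ^ 2 else 0) + (if b = e then M a e ^ 2 else 0) := by
    intro a b
    by_cases h1 : a = e <;> by_cases h2 : b = e <;>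
      simp [Matrix.cross, h1, h2, sq_nonneg]
  calc (M.cross e).frobSq ≤ ∑ a, ∑ b,
        ((if a = e then M e b ^ 2 else 0) + (if b = e then M a e ^ 2 else 0)) :=
        Finset.sum_le_sum fun a _ => Finset.sum_le_sum fun b _ => h a b
    _ = _ := by
        simp only [Finset.sum_add_distrib, Finset.sum_ite_eq', Finset.mem_univ, if_true]
        rw [Finset.sum_comm]
        simp [Matrix.mul_apply, sq]

theorem dotProduct_mulVec_update_zero (M : Matrix J J ℝ) (e : J) (x : J → ℝ) :
    (Function.update x e 0) ⬝ᵥ M.mulVec (Function.update x e 0) =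
      x ⬝ᵥ M.mulVec x - x ⬝ᵥ (M.cross e).mulVec x := by
  simp only [dotProduct, Matrix.mulVec, Finset.mul_sum, ← Finset.sum_sub_distrib]
  refine Finset.sum_congr rfl fun a _ => Finset.sum_congr rfl fun b _ => ?_
  by_cases h1 : a = e <;> by_cases h2 : b = e <;> simp [Matrix.cross, h1, h2]

theorem Matrix.SupportedOn.dotProduct_mulVec_piecewise {M : Matrix J J ℝ} {S S' : Finset J}
    (h : M.SupportedOn S S') (hd : Disjoint S S') (x y : J → ℝ) :
    (S.piecewise x y) ⬝ᵥ M.mulVec (S.piecewise x y) = x ⬝ᵥ M.mulVec y := by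
  simp only [dotProduct, Matrix.mulVec, Finset.mul_sum]
  refine Finset.sum_congr rfl fun a _ => Finset.sum_congr rfl fun b _ => ?_
  by_cases h0 : M a b = 0
  · simp [h0]
  · obtain ⟨ha, hb⟩ := h a b h0
    simp [ha, Finset.disjoint_right.1 hd hb]

theorem Matrix.SupportedOn.dotProduct_mulVec_piecewise' {M : Matrix J J ℝ} {S S' : Finset J}
    (h : M.SupportedOn S' S) (hd : Disjoint S S') (x y : J → ℝ) :
    (S.piecewise x y) ⬝ᵥ M.mulVec (S.piecewise x y) = x ⬝ᵥ M.transpose.mulVec y := by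
  rw [Matrix.mulVec_transpose, dotProduct_comm x, ← Matrix.dotProduct_mulVec]
  simp only [dotProduct, Matrix.mulVec, Finset.mul_sum]
  refine Finset.sum_congr rfl fun a _ => Finset.sum_congr rfl fun b _ => ?_
  by_cases h0 : M a b = 0
  · simp [h0]
  · obtain ⟨ha, hb⟩ := h a b h0
    simp [hb, Finset.disjoint_right.1 hd ha]

theorem Matrix.SupportedOn.dotProduct_mulVec_piecewise_off {M : Matrix J J ℝ} {S S' S'' : Finset J}
    (h : M.SupportedOn S' S'') (hd : Disjoint S S') (hd' : Disjoint S S'') (x y : J → ℝ) :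
    (S.piecewise x y) ⬝ᵥ M.mulVec (S.piecewise x y) = y ⬝ᵥ M.mulVec y := by
  simp only [dotProduct, Matrix.mulVec, Finset.mul_sum]
  refine Finset.sum_congr rfl fun a _ => Finset.sum_congr rfl fun b _ => ?_
  by_cases h0 : M a b = 0
  · simp [h0]
  · obtain ⟨ha, hb⟩ := h a b h0
    simp [Finset.disjoint_right.1 hd ha, Finset.disjoint_right.1 hd' hb]

/-- The constant in the bound for the sixth moment of decoupled bilinear forms. -/
def chaosConst : ℝ := gaussianSixthMoment ^ 2 + 1

theorem chaosConst_pos : 0 < chaosConst := by unfold chaosConst; positivity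

/-- Given the coordinates outside `S`, the form is a centred Gaussian with variance $|My|^2$, so its
conditional sixth moment is a multiple of $|My|^6$, whose mean is bounded by
`integral_sum_sq_pow_three_le`. -/
theorem Matrix.SupportedOn.integral_pow_six_le {M : Matrix J J ℝ} {S S' : Finset J}
    (h : M.SupportedOn S S') (hd : Disjoint S S') {q : ℝ} (hq : M.frobSq ≤ q) :
    ∫ x, (x ⬝ᵥ M.mulVec x) ^ 6 ∂stdGaussianPi J ≤ chaosConst * q ^ 3 := by
  rw [((isPolyFun_dotProduct_mulVec M).pow 6).integral_decouple S]
  simp only [h.dotProduct_mulVec_piecewise hd]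
  have h1 : ∀ y, ∫ x, (x ⬝ᵥ M.mulVec y) ^ 6 ∂stdGaussianPi J =
      (∑ e, M.mulVec y e ^ 2) ^ 3 * gaussianSixthMoment := fun y =>
    integral_dotProduct_pow (M.mulVec y) 3
  simp only [h1]
  rw [integral_mul_const]
  have h2 : M.frobSq ^ 3 ≤ q ^ 3 := pow_le_pow_left₀ M.frobSq_nonneg hq 3
  have h3 : 0 ≤ M.frobSq ^ 3 := pow_nonneg M.frobSq_nonneg 3
  calc _ ≤ gaussianSixthMoment * M.frobSq ^ 3 * gaussianSixthMoment :=
        mul_le_mul_of_nonneg_right (integral_sum_sq_pow_three_le M) gaussianSixthMoment_nonneg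
    _ = gaussianSixthMoment ^ 2 * M.frobSq ^ 3 := by ring
    _ ≤ gaussianSixthMoment ^ 2 * q ^ 3 := mul_le_mul_of_nonneg_left h2 (sq_nonneg _)
    _ ≤ chaosConst * q ^ 3 := by unfold chaosConst; nlinarith

theorem Matrix.SupportedOn.integral_mul_eq_trace {M N : Matrix J J ℝ} {S S' : Finset J}
    (hM : M.SupportedOn S S') (hN : N.SupportedOn S' S) (hd : Disjoint S S') :
    ∫ x, (x ⬝ᵥ M.mulVec x) * (x ⬝ᵥ N.mulVec x) ∂stdGaussianPi J = (M * N).trace := by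
  rw [((isPolyFun_dotProduct_mulVec M).mul (isPolyFun_dotProduct_mulVec N)).integral_decouple S]
  simp only [hM.dotProduct_mulVec_piecewise hd, hN.dotProduct_mulVec_piecewise' hd,
    integral_dotProduct_mul]
  have : ∀ y, M.mulVec y ⬝ᵥ N.transpose.mulVec y = y ⬝ᵥ (N * M).mulVec y := fun y => by
    rw [Matrix.mulVec_transpose, dotProduct_comm, ← Matrix.dotProduct_mulVec, Matrix.mulVec_mulVec]
  simp only [this]
  rw [integral_dotProduct_mulVec, Matrix.trace_mul_comm]

theorem Matrix.SupportedOn.integral_sq_eq_frobSq {M : Matrix J J ℝ} {S S' : Finset J}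
    (hM : M.SupportedOn S S') (hd : Disjoint S S') :
    ∫ x, (x ⬝ᵥ M.mulVec x) ^ 2 ∂stdGaussianPi J = M.frobSq := by
  have hN : M.transpose.SupportedOn S' S := fun e f h => (hM f e h).symm
  rw [Matrix.frobSq_eq_trace, ← hM.integral_mul_eq_trace hN hd]
  refine integral_congr_ae (ae_of_all _ fun x => ?_)
  simp only [Matrix.mulVec_transpose]
  rw [dotProduct_comm x (Matrix.vecMul x M), ← Matrix.dotProduct_mulVec, sq]

/-- Integrating over the block `S₁`, which enters only the first and the third form, merges these
two into the form of `M₃ * M₁`. What remains is the mean of a product of two decoupled forms. -/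
theorem integral_mul_mul_eq_trace {M₁ M₂ M₃ : Matrix J J ℝ} {S₁ S₂ S₃ : Finset J}
    (h₁ : M₁.SupportedOn S₁ S₂) (h₂ : M₂.SupportedOn S₂ S₃) (h₃ : M₃.SupportedOn S₃ S₁)
    (d₁₂ : Disjoint S₁ S₂) (d₂₃ : Disjoint S₂ S₃) (d₁₃ : Disjoint S₁ S₃) :
    ∫ x, (x ⬝ᵥ M₁.mulVec x) * (x ⬝ᵥ M₂.mulVec x) * (x ⬝ᵥ M₃.mulVec x) ∂stdGaussianPi J =
      (M₁ * M₂ * M₃).trace := by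
  rw [(((isPolyFun_dotProduct_mulVec M₁).mul (isPolyFun_dotProduct_mulVec M₂)).mul
    (isPolyFun_dotProduct_mulVec M₃)).integral_decouple S₁]
  simp only [h₁.dotProduct_mulVec_piecewise d₁₂, h₃.dotProduct_mulVec_piecewise' d₁₃,
    h₂.dotProduct_mulVec_piecewise_off d₁₂ d₁₃]
  have h : ∀ y, ∫ x, (x ⬝ᵥ M₁.mulVec y) * (y ⬝ᵥ M₂.mulVec y) * (x ⬝ᵥ M₃.transpose.mulVec y)
      ∂stdGaussianPi J = (y ⬝ᵥ (M₃ * M₁).mulVec y) * (y ⬝ᵥ M₂.mulVec y) := fun y => by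
    have : ∀ x : J → ℝ, (x ⬝ᵥ M₁.mulVec y) * (y ⬝ᵥ M₂.mulVec y) * (x ⬝ᵥ M₃.transpose.mulVec y) =
      (x ⬝ᵥ M₁.mulVec y) * (x ⬝ᵥ M₃.transpose.mulVec y) * (y ⬝ᵥ M₂.mulVec y) := fun x => by ring
    simp only [this]
    rw [integral_mul_const, integral_dotProduct_mul, Matrix.mulVec_transpose, dotProduct_comm,
      ← Matrix.dotProduct_mulVec, Matrix.mulVec_mulVec]
  simp only [h]
  have h31 : (M₃ * M₁).SupportedOn S₃ S₂ := by
    intro e f hef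
    obtain ⟨g, -, hg⟩ := Finset.exists_ne_zero_of_sum_ne_zero (by
      simpa only [Matrix.mul_apply] using hef)
    exact ⟨(h₃ e g (left_ne_zero_of_mul hg)).1, (h₁ g f (right_ne_zero_of_mul hg)).2⟩
  rw [h31.integral_mul_eq_trace h₂ d₂₃.symm, Matrix.mul_assoc M₃, Matrix.trace_mul_comm]

/-- Zeroing coordinate `e` replaces the form $B$ by $B-b$, where $b$ is the form of `M.cross e`. The
difference of squares is $2Bb-b^2$, whose square is at most $8B^2b^2+2b^4$. -/
theorem integral_sq_sub_sq_update_le {M : Matrix J J ℝ} {S S' : Finset J}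
    (h : M.SupportedOn S S') (hd : Disjoint S S') (e : J) {q r : ℝ} (hq : M.frobSq ≤ q)
    (hr : (M.cross e).frobSq ≤ r) (hrq : r ≤ q) :
    ∫ x, ((x ⬝ᵥ M.mulVec x) ^ 2 -
      ((Function.update x e 0) ⬝ᵥ M.mulVec (Function.update x e 0)) ^ 2) ^ 2 ∂stdGaussianPi J ≤
      10 * chaosConst * (q * r) := by
  simp only [dotProduct_mulVec_update_zero]
  set B : (J → ℝ) → ℝ := fun x => x ⬝ᵥ M.mulVec x with hB
  set b : (J → ℝ) → ℝ := fun x => x ⬝ᵥ (M.cross e).mulVec x with hb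
  have pB : IsPolyFun B := isPolyFun_dotProduct_mulVec M
  have pb : IsPolyFun b := isPolyFun_dotProduct_mulVec (M.cross e)
  have r0 : 0 ≤ r := (Matrix.frobSq_nonneg _).trans hr
  have q0 : 0 ≤ q := r0.trans hrq
  have EB := h.integral_pow_six_le hd hq
  have Eb := (h.cross e).integral_pow_six_le hd hr
  -- The summand 1 in `chaosConst` makes the constant function 1 admissible as a third factor in the
  -- Hölder bound.
  have E1 : ∫ _ : J → ℝ, (1 : ℝ) ^ 6 ∂stdGaussianPi J ≤ chaosConst * 1 ^ 3 := by
    simp [chaosConst]; positivity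
  have i1 := integral_sq_mul_sq_mul_sq_le q0 r0 zero_le_one (pB.pow 6).integrable
    (pb.pow 6).integrable ((IsPolyFun.const 1).pow 6).integrable EB Eb E1 chaosConst_pos.le
  have i2 := integral_sq_mul_sq_mul_sq_le r0 r0 zero_le_one (pb.pow 6).integrable
    (pb.pow 6).integrable ((IsPolyFun.const 1).pow 6).integrable Eb Eb E1 chaosConst_pos.le
  have p1 : IsPolyFun fun x => B x ^ 2 * b x ^ 2 * 1 ^ 2 :=
    ((pB.pow 2).mul (pb.pow 2)).mul ((IsPolyFun.const 1).pow 2)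
  have p2 : IsPolyFun fun x => b x ^ 2 * b x ^ 2 * 1 ^ 2 :=
    ((pb.pow 2).mul (pb.pow 2)).mul ((IsPolyFun.const 1).pow 2)
  calc ∫ x, (B x ^ 2 - (B x - b x) ^ 2) ^ 2 ∂stdGaussianPi J
      ≤ ∫ x, (8 * (B x ^ 2 * b x ^ 2 * 1 ^ 2) + 2 * (b x ^ 2 * b x ^ 2 * 1 ^ 2))
          ∂stdGaussianPi J := by
        refine integral_mono (((pB.pow 2).sub ((pB.sub pb).pow 2)).pow 2).integrable
          ((p1.integrable.const_mul 8).add (p2.integrable.const_mul 2)) fun x => ?_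
        show (B x ^ 2 - (B x - b x) ^ 2) ^ 2 ≤
          8 * (B x ^ 2 * b x ^ 2 * 1 ^ 2) + 2 * (b x ^ 2 * b x ^ 2 * 1 ^ 2)
        nlinarith [sq_nonneg (2 * B x * b x + b x ^ 2)]
    _ = 8 * ∫ x, B x ^ 2 * b x ^ 2 * 1 ^ 2 ∂stdGaussianPi J +
          2 * ∫ x, b x ^ 2 * b x ^ 2 * 1 ^ 2 ∂stdGaussianPi J := by
        rw [integral_add (p1.integrable.const_mul 8) (p2.integrable.const_mul 2),
          integral_const_mul, integral_const_mul]
    _ ≤ 8 * (chaosConst * (q * r * 1)) + 2 * (chaosConst * (r * r * 1)) := by linarith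
    _ ≤ 10 * chaosConst * (q * r) := by
        have : chaosConst * (r * r) ≤ chaosConst * (q * r) :=
          mul_le_mul_of_nonneg_left (mul_le_mul_of_nonneg_right hrq r0) chaosConst_pos.le
        linarith

/-- The difference of the two products has seven terms, each containing at least one increment
$b_i$. Cauchy-Schwarz costs a factor 7, and each of the seven squared terms has mean at most
`chaosConst * (q ^ 2 * r)`; hence the 49. -/
theorem integral_mul_sub_mul_update_le {M : Fin 3 → Matrix J J ℝ} {S S' : Fin 3 → Finset J}
    (h : ∀ i, (M i).SupportedOn (S i) (S' i)) (hd : ∀ i, Disjoint (S i) (S' i)) (e : J) {q r : ℝ}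
    (hq : ∀ i, (M i).frobSq ≤ q) (hr : ∀ i, ((M i).cross e).frobSq ≤ r) (hrq : r ≤ q) :
    ∫ x, ((x ⬝ᵥ (M 0).mulVec x) * (x ⬝ᵥ (M 1).mulVec x) * (x ⬝ᵥ (M 2).mulVec x) -
      ((Function.update x e 0) ⬝ᵥ (M 0).mulVec (Function.update x e 0)) *
      ((Function.update x e 0) ⬝ᵥ (M 1).mulVec (Function.update x e 0)) *
      ((Function.update x e 0) ⬝ᵥ (M 2).mulVec (Function.update x e 0))) ^ 2 ∂stdGaussianPi J ≤
      49 * chaosConst * (q ^ 2 * r) := by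
  simp only [dotProduct_mulVec_update_zero]
  set B : Fin 3 → (J → ℝ) → ℝ := fun i x => x ⬝ᵥ (M i).mulVec x with hB
  set b : Fin 3 → (J → ℝ) → ℝ := fun i x => x ⬝ᵥ ((M i).cross e).mulVec x with hb
  have pB : ∀ i, IsPolyFun (B i) := fun i => isPolyFun_dotProduct_mulVec _
  have pb : ∀ i, IsPolyFun (b i) := fun i => isPolyFun_dotProduct_mulVec _
  have r0 : 0 ≤ r := (Matrix.frobSq_nonneg _).trans (hr 0)
  have q0 : 0 ≤ q := r0.trans hrq
  have EB : ∀ i, ∫ x, B i x ^ 6 ∂stdGaussianPi J ≤ chaosConst * q ^ 3 := fun i =>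
    (h i).integral_pow_six_le (hd i) (hq i)
  have Eb : ∀ i, ∫ x, b i x ^ 6 ∂stdGaussianPi J ≤ chaosConst * r ^ 3 := fun i =>
    ((h i).cross e).integral_pow_six_le (hd i) (hr i)
  -- In terms with several increments only one of them has to contribute the small factor `r`; the
  -- others are bounded by `q`.
  have Eb' : ∀ i, ∫ x, b i x ^ 6 ∂stdGaussianPi J ≤ chaosConst * q ^ 3 := fun i =>
    ((h i).cross e).integral_pow_six_le (hd i) ((hr i).trans hrq)
  have bound : ∀ {u v w : (J → ℝ) → ℝ}, IsPolyFun u → IsPolyFun v → IsPolyFun w →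
      ∫ x, u x ^ 6 ∂stdGaussianPi J ≤ chaosConst * q ^ 3 →
      ∫ x, v x ^ 6 ∂stdGaussianPi J ≤ chaosConst * q ^ 3 →
      ∫ x, w x ^ 6 ∂stdGaussianPi J ≤ chaosConst * r ^ 3 →
      Integrable (fun x => u x ^ 2 * v x ^ 2 * w x ^ 2) (stdGaussianPi J) ∧
      ∫ x, u x ^ 2 * v x ^ 2 * w x ^ 2 ∂stdGaussianPi J ≤ chaosConst * (q * q * r) :=
    fun pu pv pw eu ev ew => ⟨(((pu.pow 2).mul (pv.pow 2)).mul (pw.pow 2)).integrable,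
      integral_sq_mul_sq_mul_sq_le q0 q0 r0 (pu.pow 6).integrable
      (pv.pow 6).integrable (pw.pow 6).integrable eu ev ew chaosConst_pos.le⟩
  obtain ⟨i1, e1⟩ := bound (pB 1) (pB 2) (pb 0) (EB 1) (EB 2) (Eb 0)
  obtain ⟨i2, e2⟩ := bound (pB 0) (pB 2) (pb 1) (EB 0) (EB 2) (Eb 1)
  obtain ⟨i3, e3⟩ := bound (pB 0) (pB 1) (pb 2) (EB 0) (EB 1) (Eb 2)
  obtain ⟨i4, e4⟩ := bound (pB 0) (pb 1) (pb 2) (EB 0) (Eb' 1) (Eb 2)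
  obtain ⟨i5, e5⟩ := bound (pB 1) (pb 0) (pb 2) (EB 1) (Eb' 0) (Eb 2)
  obtain ⟨i6, e6⟩ := bound (pB 2) (pb 0) (pb 1) (EB 2) (Eb' 0) (Eb 1)
  obtain ⟨i7, e7⟩ := bound (pb 0) (pb 1) (pb 2) (Eb' 0) (Eb' 1) (Eb 2)
  have pD : IsPolyFun fun x => (B 0 x * B 1 x * B 2 x -
      (B 0 x - b 0 x) * (B 1 x - b 1 x) * (B 2 x - b 2 x)) ^ 2 :=
    ((((pB 0).mul (pB 1)).mul (pB 2)).sub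
      ((((pB 0).sub (pb 0)).mul ((pB 1).sub (pb 1))).mul ((pB 2).sub (pb 2)))).pow 2
  have hpt : ∀ x, (B 0 x * B 1 x * B 2 x -
      (B 0 x - b 0 x) * (B 1 x - b 1 x) * (B 2 x - b 2 x)) ^ 2 ≤
      7 * (B 1 x ^ 2 * B 2 x ^ 2 * b 0 x ^ 2) + 7 * (B 0 x ^ 2 * B 2 x ^ 2 * b 1 x ^ 2) +
      7 * (B 0 x ^ 2 * B 1 x ^ 2 * b 2 x ^ 2) + 7 * (B 0 x ^ 2 * b 1 x ^ 2 * b 2 x ^ 2) +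
      7 * (B 1 x ^ 2 * b 0 x ^ 2 * b 2 x ^ 2) + 7 * (B 2 x ^ 2 * b 0 x ^ 2 * b 1 x ^ 2) +
      7 * (b 0 x ^ 2 * b 1 x ^ 2 * b 2 x ^ 2) := by
    intro x
    have := sq_sum_le_card_mul_sum_sq (s := (Finset.univ : Finset (Fin 7)))
      (f := ![B 1 x * B 2 x * b 0 x, B 0 x * B 2 x * b 1 x, B 0 x * B 1 x * b 2 x,
        -(B 0 x * b 1 x * b 2 x), -(B 1 x * b 0 x * b 2 x), -(B 2 x * b 0 x * b 1 x),
        b 0 x * b 1 x * b 2 x])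
    simp only [Fin.sum_univ_succ, Matrix.cons_val_zero, Matrix.cons_val_succ, Finset.univ_eq_empty,
      Finset.sum_empty, Finset.card_univ, Fintype.card_fin] at this
    push_cast at this
    refine (le_of_eq ?_).trans (this.trans (le_of_eq ?_)) <;> ring
  refine (integral_mono pD.integrable ?_ hpt).trans ?_
  · exact ((((((i1.const_mul 7).add (i2.const_mul 7)).add (i3.const_mul 7)).add
      (i4.const_mul 7)).add (i5.const_mul 7)).add (i6.const_mul 7)).add (i7.const_mul 7)
  · have s2 := (i1.const_mul 7).add (i2.const_mul 7)
    have s3 := s2.add (i3.const_mul 7)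
    have s4 := s3.add (i4.const_mul 7)
    have s5 := s4.add (i5.const_mul 7)
    have s6 := s5.add (i6.const_mul 7)
    rw [integral_add (by exact s6) (i7.const_mul 7), integral_add (by exact s5) (i6.const_mul 7),
      integral_add (by exact s4) (i5.const_mul 7), integral_add (by exact s3) (i4.const_mul 7),
      integral_add (by exact s2) (i3.const_mul 7), integral_add (i1.const_mul 7) (i2.const_mul 7)]
    simp only [integral_const_mul]
    linarith

end Bilinear

end

noncomputable section

/-! ### Averages of polynomials that depend on few coordinates each -/

theorem IsPolyFun.update_zero {J : Type*} [DecidableEq J] {f : (J → ℝ) → ℝ} (hf : IsPolyFun f)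
    (e : J) : IsPolyFun fun x => f (Function.update x e 0) := by
  refine hf.comp_polyFun fun k => ?_
  by_cases h : k = e
  · subst h; simpa using IsPolyFun.const 0
  · simpa [h] using IsPolyFun.coord k

/-- The Efron-Stein bound is applied with the average at `x` with coordinate `e` set to 0 as
comparison function. Only the summands touching `e` change. Cauchy-Schwarz over these alone produces
the square of their proportion, whatever the dependence between the summands. -/
theorem integral_average_sub_sq_le {J κ : Type*} [Fintype J] [DecidableEq J] (K : Finset κ)
    (hK : K.Nonempty) {f : κ → (J → ℝ) → ℝ} (touches : κ → J → Prop)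
    [∀ u e, Decidable (touches u e)] {m : ℝ} {c : J → ℝ}
    (hf : ∀ u ∈ K, IsPolyFun (f u)) (hm : ∀ u ∈ K, ∫ x, f u x ∂stdGaussianPi J = m)
    (hno : ∀ u ∈ K, ∀ e x, ¬ touches u e → f u (Function.update x e 0) = f u x)
    (hc : ∀ u ∈ K, ∀ e,
      ∫ x, (f u x - f u (Function.update x e 0)) ^ 2 ∂stdGaussianPi J ≤ c e) :
    ∫ x, ((∑ u ∈ K, f u x) / (K.card : ℝ) - m) ^ 2 ∂stdGaussianPi J ≤
      2 * ∑ e, c e * (((K.filter fun u => touches u e).card : ℝ) / (K.card : ℝ)) ^ 2 := by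
  have hcard : (0 : ℝ) < K.card := by exact_mod_cast hK.card_pos
  have pF : IsPolyFun fun x => (∑ u ∈ K, f u x) / (K.card : ℝ) :=
    (IsPolyFun.sum hf).div_const _
  have hmean : ∫ x, (∑ u ∈ K, f u x) / (K.card : ℝ) ∂stdGaussianPi J = m := by
    rw [integral_div, integral_finsetSum _ fun u hu => (hf u hu).integrable,
      Finset.sum_congr rfl hm, Finset.sum_const, nsmul_eq_mul]
    field_simp
  have hES := integral_sub_integral_sq_le pF (fun e => pF.update_zero e) (fun e x t => by simp)
  rw [hmean] at hES
  refine hES.trans (mul_le_mul_of_nonneg_left (Finset.sum_le_sum fun e _ => ?_) (by norm_num))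
  set Ke := K.filter fun u => touches u e with hKe
  have hpD : ∀ u ∈ Ke, IsPolyFun fun x => (f u x - f u (Function.update x e 0)) ^ 2 := fun u hu =>
    have hu' := hf u (Finset.mem_filter.1 hu).1
    (hu'.sub (hu'.update_zero e)).pow 2
  have hpt : ∀ x, ((∑ u ∈ K, f u x) / (K.card : ℝ) -
      (∑ u ∈ K, f u (Function.update x e 0)) / (K.card : ℝ)) ^ 2 ≤
      (Ke.card : ℝ) / (K.card : ℝ) ^ 2 *
        ∑ u ∈ Ke, (f u x - f u (Function.update x e 0)) ^ 2 := by
    intro x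
    rw [← sub_div, ← Finset.sum_sub_distrib, div_pow, div_mul_eq_mul_div]
    refine div_le_div_of_nonneg_right ?_ (by positivity)
    have : ∑ u ∈ K, (f u x - f u (Function.update x e 0)) =
        ∑ u ∈ Ke, (f u x - f u (Function.update x e 0)) := by
      rw [hKe, Finset.sum_filter]
      refine Finset.sum_congr rfl fun u hu => ?_
      split_ifs with h
      · rfl
      · rw [hno u hu e x h, sub_self]
    rw [this]
    exact sq_sum_le_card_mul_sum_sq
  calc _ ≤ ∫ x, (Ke.card : ℝ) / (K.card : ℝ) ^ 2 *
        ∑ u ∈ Ke, (f u x - f u (Function.update x e 0)) ^ 2 ∂stdGaussianPi J :=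
        integral_mono ((pF.sub (pF.update_zero e)).pow 2).integrable
          ((IsPolyFun.sum hpD).integrable.const_mul _) hpt
    _ = (Ke.card : ℝ) / (K.card : ℝ) ^ 2 *
        ∑ u ∈ Ke, ∫ x, (f u x - f u (Function.update x e 0)) ^ 2 ∂stdGaussianPi J := by
        rw [integral_const_mul, integral_finsetSum _ fun u hu => (hpD u hu).integrable]
    _ ≤ (Ke.card : ℝ) / (K.card : ℝ) ^ 2 * ∑ u ∈ Ke, c e :=
        mul_le_mul_of_nonneg_left
          (Finset.sum_le_sum fun u hu => hc u (Finset.mem_filter.1 hu).1 e) (by positivity)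
    _ = c e * ((Ke.card : ℝ) / (K.card : ℝ)) ^ 2 := by
        rw [Finset.sum_const, nsmul_eq_mul]
        ring

namespace SplitPlot

variable (M : SplitPlot)

/-! ### The data as an affine image of standard Gaussian noise -/

/-- Indices of the noise variables. -/
abbrev NoiseIdx : Type := (p : (i : Fin M.a) × Fin (M.n i)) × Fin (M.d p.1)

/-- The coordinate of the pooled space to which a noise variable belongs. -/
def proj (e : M.NoiseIdx) : M.Idx := ⟨e.1.1, e.2⟩

open scoped MatrixOrder in
/-- The square root of a covariance matrix. -/
def rootSigma (i : Fin M.a) : Matrix (Fin (M.d i)) (Fin (M.d i)) ℝ := CFC.sqrt (M.Sigma i)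

open scoped MatrixOrder in
theorem rootSigma_transpose (i : Fin M.a) : (M.rootSigma i).transpose = M.rootSigma i := by
  have := (CFC.sqrt_nonneg (M.Sigma i)).isSelfAdjoint
  rw [← Matrix.conjTranspose_eq_transpose_of_trivial]
  exact this

open scoped MatrixOrder in
theorem rootSigma_mul_self (i : Fin M.a) : M.rootSigma i * M.rootSigma i = M.Sigma i :=
  CFC.sqrt_mul_sqrt_self _ (M.Sigma_posDef i).posSemidef.nonneg

/-- The data set obtained from a noise vector. -/
def ofNoise (ξ : M.NoiseIdx → ℝ) : M.Data := fun i j =>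
  M.mu i + Matrix.toEuclideanCLM (𝕜 := ℝ) (M.rootSigma i)
    (WithLp.toLp 2 fun s => ξ ⟨⟨i, j⟩, s⟩)

/-- A square root of `V`. -/
def rootV : Matrix M.Idx M.Idx ℝ :=
  Matrix.blockDiagonal' fun i => √((M.N : ℝ) / (M.n i : ℝ)) • M.rootSigma i

theorem rootV_mul_transpose : M.rootV * M.rootV.transpose = M.V := by
  unfold rootV V
  rw [Matrix.blockDiagonal'_transpose, ← Matrix.blockDiagonal'_mul]
  congr 1
  funext i
  rw [Matrix.transpose_smul, rootSigma_transpose, Matrix.smul_mul, Matrix.mul_smul, smul_smul,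
    Real.mul_self_sqrt (by positivity), rootSigma_mul_self]

/-- The symmetric matrix of the bilinear form `M.form` in terms of the noise. -/
def W : Matrix M.Idx M.Idx ℝ := M.rootV.transpose * M.T * M.rootV

theorem W_transpose : M.W.transpose = M.W := by
  have : M.T.transpose = M.T := M.T_symm
  simp [W, Matrix.transpose_mul, this, Matrix.mul_assoc]

/-- The contrast of the observations number `p` and `q` of a subsample. -/
def contrast {m : ℕ} (l : ∀ i, Fin m → Fin (M.n i)) (p q : Fin m) (e : M.NoiseIdx) : ℝ :=
  (if e.1.2 = l e.1.1 p then 1 else 0) - (if e.1.2 = l e.1.1 q then 1 else 0)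

/-- The matrix of the form in two contrasts. -/
def formMatrix (ε ε' : M.NoiseIdx → ℝ) : Matrix M.NoiseIdx M.NoiseIdx ℝ :=
  Matrix.of fun e f => ε e * M.W (M.proj e) (M.proj f) * ε' f

/-- The pooled vector of a contrast. -/
def pool (ε ξ : M.NoiseIdx → ℝ) : M.Idx → ℝ := fun s => ∑ j, ε ⟨⟨s.1, j⟩, s.2⟩ * ξ ⟨⟨s.1, j⟩, s.2⟩

theorem sum_noiseIdx (g : M.NoiseIdx → ℝ) : ∑ e, g e = ∑ s : M.Idx, ∑ j, g ⟨⟨s.1, j⟩, s.2⟩ := by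
  rw [Fintype.sum_sigma (fun e : M.NoiseIdx => g e),
    Fintype.sum_sigma (fun p : (i : Fin M.a) × Fin (M.n i) => ∑ s, g ⟨p, s⟩),
    Fintype.sum_sigma (fun s : M.Idx => ∑ j, g ⟨⟨s.1, j⟩, s.2⟩)]
  refine Finset.sum_congr rfl fun i _ => ?_
  exact Finset.sum_comm (s := Finset.univ) (t := Finset.univ)
    (f := fun (j : Fin (M.n i)) (s : Fin (M.d i)) => g ⟨⟨i, j⟩, s⟩)

/-- The group means cancel in the differences, which leaves a linear function of the noise. -/
theorem Z_ofNoise (ξ : M.NoiseIdx → ℝ) {m : ℕ} (l : ∀ i, Fin m → Fin (M.n i)) (p q : Fin m) :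
    M.Z (M.ofNoise ξ) l p q = M.rootV.mulVec (M.pool (M.contrast l p q) ξ) := by
  funext ⟨i, s⟩
  have hp : ∀ t, M.pool (M.contrast l p q) ξ ⟨i, t⟩ =
      ξ ⟨⟨i, l i p⟩, t⟩ - ξ ⟨⟨i, l i q⟩, t⟩ := fun t => by
    simp [pool, contrast, sub_mul, Finset.sum_sub_distrib]
  have hr : M.rootV.mulVec (M.pool (M.contrast l p q) ξ) ⟨i, s⟩ =
      ∑ t, √((M.N : ℝ) / (M.n i : ℝ)) * M.rootSigma i s t *
        M.pool (M.contrast l p q) ξ ⟨i, t⟩ := by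
    rw [Matrix.mulVec, dotProduct, Fintype.sum_sigma, Finset.sum_eq_single i]
    · simp [rootV, Matrix.blockDiagonal'_apply_eq]
    · intro i' _ hi
      refine Finset.sum_eq_zero fun t _ => ?_
      rw [rootV, Matrix.blockDiagonal'_apply_ne _ _ _ hi.symm, zero_mul]
    · simp
  rw [hr]
  simp only [hp, Z, ofNoise]
  simp [Matrix.mulVec, dotProduct, mul_sub, Finset.mul_sum, mul_assoc]

theorem form_rootV (u v : M.Idx → ℝ) :
    M.form (M.rootV.mulVec u) (M.rootV.mulVec v) = u ⬝ᵥ M.W.mulVec v := by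
  rw [form, W, Matrix.mul_assoc, ← Matrix.mulVec_mulVec, ← Matrix.mulVec_mulVec,
    Matrix.dotProduct_mulVec u, Matrix.vecMul_transpose]

theorem dotProduct_formMatrix_mulVec (ε ε' ξ : M.NoiseIdx → ℝ) :
    ξ ⬝ᵥ (M.formMatrix ε ε').mulVec ξ = M.pool ε ξ ⬝ᵥ M.W.mulVec (M.pool ε' ξ) := by
  simp only [dotProduct, Matrix.mulVec]
  rw [sum_noiseIdx]
  refine Finset.sum_congr rfl fun s _ => ?_
  simp only [pool, Finset.sum_mul]
  refine Finset.sum_congr rfl fun j _ => ?_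
  rw [sum_noiseIdx, Finset.mul_sum, Finset.mul_sum]
  refine Finset.sum_congr rfl fun t _ => ?_
  simp only [Finset.mul_sum]
  refine Finset.sum_congr rfl fun k _ => ?_
  simp only [formMatrix, Matrix.of_apply, proj]
  ring

theorem form_Z_ofNoise (ξ : M.NoiseIdx → ℝ) {m : ℕ} (l : ∀ i, Fin m → Fin (M.n i))
    (p q p' q' : Fin m) :
    M.form (M.Z (M.ofNoise ξ) l p q) (M.Z (M.ofNoise ξ) l p' q') =
      ξ ⬝ᵥ (M.formMatrix (M.contrast l p q) (M.contrast l p' q')).mulVec ξ := by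
  rw [Z_ofNoise, Z_ofNoise, form_rootV, dotProduct_formMatrix_mulVec]

/-! ### Traces -/

/-- The trace of `(T V) ^ 2`. -/
def t2 : ℝ := Matrix.trace ((M.T * M.V) ^ 2)

/-- The trace of `(T V) ^ 3`. -/
def t3 : ℝ := Matrix.trace ((M.T * M.V) ^ 3)

theorem trace_W_mul_W : (M.W * M.W).trace = M.t2 := by
  have h : M.W * M.W = M.rootV.transpose * (M.T * M.V * M.T * M.rootV) := by
    rw [← rootV_mul_transpose]; simp only [W, Matrix.mul_assoc]
  rw [h, Matrix.trace_mul_comm, t2, sq, ← rootV_mul_transpose]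
  simp only [Matrix.mul_assoc]

theorem trace_W_mul_W_mul_W : (M.W * M.W * M.W).trace = M.t3 := by
  have h : M.W * M.W * M.W = M.rootV.transpose * (M.T * M.V * M.T * M.V * M.T * M.rootV) := by
    rw [← rootV_mul_transpose]; simp only [W, Matrix.mul_assoc]
  rw [h, Matrix.trace_mul_comm, t3, pow_succ, sq, ← rootV_mul_transpose]
  simp only [Matrix.mul_assoc]

/-- The contribution of a coordinate to the trace of `W ^ 2`. -/
def weight (s : M.Idx) : ℝ := (M.W * M.W) s s

theorem weight_eq (s : M.Idx) : M.weight s = ∑ t, M.W s t ^ 2 := by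
  rw [weight, Matrix.mul_apply]
  refine Finset.sum_congr rfl fun t _ => ?_
  have : M.W t s = M.W s t := congrFun (congrFun M.W_transpose s) t
  rw [this, sq]

theorem weight_nonneg (s : M.Idx) : 0 ≤ M.weight s := by
  rw [weight_eq]; positivity

theorem sum_weight : ∑ s, M.weight s = M.t2 := M.trace_W_mul_W

theorem t2_nonneg : 0 ≤ M.t2 := by
  rw [← sum_weight]; exact Finset.sum_nonneg fun s _ => M.weight_nonneg s

theorem weight_le_t2 (s : M.Idx) : M.weight s ≤ M.t2 := by
  rw [← sum_weight]
  exact Finset.single_le_sum (f := M.weight) (fun s _ => M.weight_nonneg s) (Finset.mem_univ s)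

/-! ### Contrasts and the matrices of their bilinear forms -/

section Contrast

variable {M} {m : ℕ} {l : ∀ i, Fin m → Fin (M.n i)}

/-- In each group a contrast takes the values 1 and -1 once each. This 2 is the source of the
normalizing factors 4 and 8 of the estimators. -/
theorem sum_contrast_sq (hl : ∀ i, Function.Injective (l i)) {p q : Fin m} (hpq : p ≠ q)
    (s : M.Idx) : ∑ j, M.contrast l p q ⟨⟨s.1, j⟩, s.2⟩ ^ 2 = 2 := by
  have h : ∀ j, M.contrast l p q ⟨⟨s.1, j⟩, s.2⟩ ^ 2 =
      (if j = l s.1 p then 1 else 0) + (if j = l s.1 q then 1 else 0) := fun j => by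
    have hne : l s.1 p ≠ l s.1 q := fun h => hpq (hl _ h)
    by_cases h1 : j = l s.1 p
    · simp [contrast, h1, hne]
    · by_cases h2 : j = l s.1 q
      · simp [contrast, h2, hne.symm]
      · simp [contrast, h1, h2]
  simp only [h, Finset.sum_add_distrib]
  norm_num

theorem contrast_sq_le_one (p q : Fin m) (e : M.NoiseIdx) : M.contrast l p q e ^ 2 ≤ 1 := by
  unfold contrast
  split_ifs <;> norm_num

/-- The noise variables entering a contrast. -/
def contrastSupport (l : ∀ i, Fin m → Fin (M.n i)) (p q : Fin m) : Finset M.NoiseIdx :=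
  Finset.univ.filter fun e => e.1.2 = l e.1.1 p ∨ e.1.2 = l e.1.1 q

theorem mem_contrastSupport {p q : Fin m} {e : M.NoiseIdx} (h : M.contrast l p q e ≠ 0) :
    e ∈ contrastSupport l p q := by
  rw [contrastSupport, Finset.mem_filter]
  refine ⟨Finset.mem_univ _, ?_⟩
  by_contra hc
  push Not at hc
  simp [contrast, hc.1, hc.2] at h

theorem disjoint_contrastSupport (hl : ∀ i, Function.Injective (l i)) {p q p' q' : Fin m}
    (h1 : p ≠ p') (h2 : p ≠ q') (h3 : q ≠ p') (h4 : q ≠ q') :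
    Disjoint (contrastSupport l p q) (contrastSupport l p' q') := by
  rw [Finset.disjoint_left]
  intro e he he'
  simp only [contrastSupport, Finset.mem_filter, Finset.mem_univ, true_and] at he he'
  rcases he with h | h <;> rcases he' with h' | h'
  · exact h1 (hl _ (h.symm.trans h'))
  · exact h2 (hl _ (h.symm.trans h'))
  · exact h3 (hl _ (h.symm.trans h'))
  · exact h4 (hl _ (h.symm.trans h'))

theorem formMatrix_supportedOn (p q p' q' : Fin m) :
    (M.formMatrix (M.contrast l p q) (M.contrast l p' q')).SupportedOn
      (contrastSupport l p q) (contrastSupport l p' q') := fun e f h => by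
  rw [formMatrix, Matrix.of_apply] at h
  exact ⟨mem_contrastSupport (left_ne_zero_of_mul (left_ne_zero_of_mul h)),
    mem_contrastSupport (right_ne_zero_of_mul h)⟩

theorem formMatrix_transpose (ε ε' : M.NoiseIdx → ℝ) :
    (M.formMatrix ε ε').transpose = M.formMatrix ε' ε := by
  ext e f
  have : M.W (M.proj f) (M.proj e) = M.W (M.proj e) (M.proj f) :=
    congrFun (congrFun M.W_transpose _) _
  simp only [Matrix.transpose_apply, formMatrix, Matrix.of_apply, this]
  ring

/-- The matrix of a form in two contrasts, with `W` replaced by an arbitrary matrix. -/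
def liftMatrix (B : Matrix M.Idx M.Idx ℝ) (ε ε' : M.NoiseIdx → ℝ) :
    Matrix M.NoiseIdx M.NoiseIdx ℝ :=
  Matrix.of fun e f => ε e * B (M.proj e) (M.proj f) * ε' f

/-- The inner summation over noise indices splits into pooled coordinates, which give the matrix
product, and observations, which give the squared norm 2 of the middle contrast. Products and traces
of form matrices thereby reduce to those of $W$. -/
theorem liftMatrix_mul (A B : Matrix M.Idx M.Idx ℝ) (ε ε'' : M.NoiseIdx → ℝ)
    (hl : ∀ i, Function.Injective (l i)) {p q : Fin m} (hpq : p ≠ q) :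
    liftMatrix A ε (M.contrast l p q) * liftMatrix B (M.contrast l p q) ε'' =
      (2 : ℝ) • liftMatrix (A * B) ε ε'' := by
  ext e f
  simp only [Matrix.mul_apply, liftMatrix, Matrix.of_apply, Matrix.smul_apply, smul_eq_mul]
  rw [sum_noiseIdx, Finset.mul_sum, Finset.sum_mul, Finset.mul_sum]
  refine Finset.sum_congr rfl fun s _ => ?_
  rw [← sum_contrast_sq hl hpq s, Finset.sum_mul]
  refine Finset.sum_congr rfl fun j _ => ?_
  simp only [proj]
  ring

theorem trace_liftMatrix (B : Matrix M.Idx M.Idx ℝ) (hl : ∀ i, Function.Injective (l i))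
    {p q : Fin m} (hpq : p ≠ q) :
    (liftMatrix B (M.contrast l p q) (M.contrast l p q)).trace = 2 * B.trace := by
  rw [Matrix.trace, sum_noiseIdx, Matrix.trace, Finset.mul_sum]
  refine Finset.sum_congr rfl fun s _ => ?_
  rw [← sum_contrast_sq hl hpq s, Finset.sum_mul]
  refine Finset.sum_congr rfl fun j _ => ?_
  simp only [liftMatrix, proj, Matrix.diag_apply, Matrix.of_apply]
  ring

theorem frobSq_formMatrix (hl : ∀ i, Function.Injective (l i)) {p q p' q' : Fin m}
    (hpq : p ≠ q) (hpq' : p' ≠ q') :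
    (M.formMatrix (M.contrast l p q) (M.contrast l p' q')).frobSq = 4 * M.t2 := by
  rw [Matrix.frobSq_eq_trace, formMatrix_transpose]
  have := liftMatrix_mul M.W M.W (M.contrast l p q) (M.contrast l p q) hl hpq'
  rw [show (M.formMatrix (M.contrast l p q) (M.contrast l p' q')) *
    (M.formMatrix (M.contrast l p' q') (M.contrast l p q)) = _ from this, Matrix.trace_smul,
    trace_liftMatrix _ hl hpq, trace_W_mul_W, smul_eq_mul]
  ring

theorem trace_formMatrix_mul_mul (hl : ∀ i, Function.Injective (l i)) {p₁ q₁ p₂ q₂ p₃ q₃ : Fin m}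
    (h₁ : p₁ ≠ q₁) (h₂ : p₂ ≠ q₂) (h₃ : p₃ ≠ q₃) :
    (M.formMatrix (M.contrast l p₁ q₁) (M.contrast l p₂ q₂) *
      M.formMatrix (M.contrast l p₂ q₂) (M.contrast l p₃ q₃) *
      M.formMatrix (M.contrast l p₃ q₃) (M.contrast l p₁ q₁)).trace = 8 * M.t3 := by
  have a := liftMatrix_mul M.W M.W (M.contrast l p₁ q₁) (M.contrast l p₃ q₃) hl h₂
  have b := liftMatrix_mul (M.W * M.W) M.W (M.contrast l p₁ q₁) (M.contrast l p₁ q₁) hl h₃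
  rw [show (M.formMatrix (M.contrast l p₁ q₁) (M.contrast l p₂ q₂)) *
    (M.formMatrix (M.contrast l p₂ q₂) (M.contrast l p₃ q₃)) = _ from a, Matrix.smul_mul,
    show liftMatrix (M.W * M.W) (M.contrast l p₁ q₁) (M.contrast l p₃ q₃) *
      M.formMatrix (M.contrast l p₃ q₃) (M.contrast l p₁ q₁) = _ from b,
    Matrix.trace_smul, Matrix.trace_smul, trace_liftMatrix _ hl h₁, trace_W_mul_W_mul_W,
    smul_eq_mul, smul_eq_mul]
  ring

/-- The squared norms of row and column `e` are diagonal entries of $MM^\top$ and $M^\top M$. By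
`liftMatrix_mul` each of them is twice the weight times a squared contrast value, which is at most
1. -/
theorem frobSq_cross_formMatrix_le (hl : ∀ i, Function.Injective (l i)) {p q p' q' : Fin m}
    (hpq : p ≠ q) (hpq' : p' ≠ q') (e : M.NoiseIdx) :
    ((M.formMatrix (M.contrast l p q) (M.contrast l p' q')).cross e).frobSq ≤
      4 * M.weight (M.proj e) := by
  refine (Matrix.frobSq_cross_le_add _ e).trans ?_
  rw [formMatrix_transpose]
  have a := liftMatrix_mul M.W M.W (M.contrast l p q) (M.contrast l p q) hl hpq'
  have b := liftMatrix_mul M.W M.W (M.contrast l p' q') (M.contrast l p' q') hl hpq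
  rw [show (M.formMatrix (M.contrast l p q) (M.contrast l p' q')) *
    (M.formMatrix (M.contrast l p' q') (M.contrast l p q)) = _ from a,
    show (M.formMatrix (M.contrast l p' q') (M.contrast l p q)) *
    (M.formMatrix (M.contrast l p q) (M.contrast l p' q')) = _ from b]
  simp only [Matrix.smul_apply, liftMatrix, Matrix.of_apply, smul_eq_mul]
  have h0 := M.weight_nonneg (M.proj e)
  have h1 := mul_le_mul_of_nonneg_right (contrast_sq_le_one (l := l) p q e) h0
  have h2 := mul_le_mul_of_nonneg_right (contrast_sq_le_one (l := l) p' q' e) h0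
  rw [weight] at *
  nlinarith

end Contrast

end SplitPlot

end

noncomputable section

namespace SplitPlot

variable (M : SplitPlot)

/-! ### Mean square errors of averages of the kernels -/

/-- The proportion of the subsamples that contain the observation `j` of group `i`. -/
def freq {κ : Type*} {m : ℕ} (K : Finset κ) (l : κ → ∀ i : Fin M.a, Fin m → Fin (M.n i))
    (i : Fin M.a) (j : Fin (M.n i)) : ℝ :=
  ((K.filter fun u => ∃ p, l u i p = j).card : ℝ) / (K.card : ℝ)

/-- A weighted sum of the squared inclusion proportions. -/
def spread {κ : Type*} {m : ℕ} (K : Finset κ) (l : κ → ∀ i : Fin M.a, Fin m → Fin (M.n i)) : ℝ :=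
  ∑ s : M.Idx, M.weight s * ∑ j, M.freq K l s.1 j ^ 2

section Kernels

variable {M}

theorem kernel2_ofNoise (ξ : M.NoiseIdx → ℝ) (l : ∀ i, Fin 4 → Fin (M.n i)) :
    M.kernel2 (M.ofNoise ξ) l =
      (ξ ⬝ᵥ (M.formMatrix (M.contrast l 0 1) (M.contrast l 2 3)).mulVec ξ) ^ 2 := by
  rw [kernel2, form_Z_ofNoise]

/-- The three matrices whose forms make up the kernel of the estimator of `t3`. -/
def kernelMatrix (l : ∀ i, Fin 6 → Fin (M.n i)) : Fin 3 → Matrix M.NoiseIdx M.NoiseIdx ℝ :=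
  ![M.formMatrix (M.contrast l 0 1) (M.contrast l 2 3),
    M.formMatrix (M.contrast l 2 3) (M.contrast l 4 5),
    M.formMatrix (M.contrast l 4 5) (M.contrast l 0 1)]

theorem kernel3_ofNoise (ξ : M.NoiseIdx → ℝ) (l : ∀ i, Fin 6 → Fin (M.n i)) :
    M.kernel3 (M.ofNoise ξ) l = (ξ ⬝ᵥ (kernelMatrix l 0).mulVec ξ) *
      (ξ ⬝ᵥ (kernelMatrix l 1).mulVec ξ) * (ξ ⬝ᵥ (kernelMatrix l 2).mulVec ξ) := by
  rw [kernel3, form_Z_ofNoise, form_Z_ofNoise, form_Z_ofNoise]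
  rfl

theorem isPolyFun_kernel2 (l : ∀ i, Fin 4 → Fin (M.n i)) :
    IsPolyFun fun ξ => M.kernel2 (M.ofNoise ξ) l := by
  simp only [kernel2_ofNoise]
  exact (isPolyFun_dotProduct_mulVec _).pow 2

theorem isPolyFun_kernel3 (l : ∀ i, Fin 6 → Fin (M.n i)) :
    IsPolyFun fun ξ => M.kernel3 (M.ofNoise ξ) l := by
  simp only [kernel3_ofNoise]
  exact ((isPolyFun_dotProduct_mulVec _).mul (isPolyFun_dotProduct_mulVec _)).mul
    (isPolyFun_dotProduct_mulVec _)

/-- Every contrast vanishes at a noise variable whose observation is not selected. -/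
theorem Z_ofNoise_update {m : ℕ} (l : ∀ i, Fin m → Fin (M.n i)) (p q : Fin m)
    (ξ : M.NoiseIdx → ℝ) (e : M.NoiseIdx) (h : ¬ ∃ p, l e.1.1 p = e.1.2) (t : ℝ) :
    M.Z (M.ofNoise (Function.update ξ e t)) l p q = M.Z (M.ofNoise ξ) l p q := by
  have hc : ∀ p q, M.contrast l p q e = 0 := fun p q => by
    have hne : ∀ p, e.1.2 ≠ l e.1.1 p := fun p hp => h ⟨p, hp.symm⟩
    simp [contrast, hne]
  rw [Z_ofNoise, Z_ofNoise]
  congr 1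
  funext s
  refine Finset.sum_congr rfl fun j _ => ?_
  by_cases he : (⟨⟨s.1, j⟩, s.2⟩ : M.NoiseIdx) = e
  · rw [he, hc, zero_mul, zero_mul]
  · rw [Function.update_of_ne he]

theorem integral_kernel2 {l : ∀ i, Fin 4 → Fin (M.n i)} (hl : ∀ i, Function.Injective (l i)) :
    ∫ ξ, M.kernel2 (M.ofNoise ξ) l ∂stdGaussianPi M.NoiseIdx = 4 * M.t2 := by
  simp only [kernel2_ofNoise]
  rw [(formMatrix_supportedOn 0 1 2 3).integral_sq_eq_frobSq
    (disjoint_contrastSupport hl (by decide) (by decide) (by decide) (by decide)),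
    frobSq_formMatrix hl (by decide) (by decide)]

theorem integral_kernel3 {l : ∀ i, Fin 6 → Fin (M.n i)} (hl : ∀ i, Function.Injective (l i)) :
    ∫ ξ, M.kernel3 (M.ofNoise ξ) l ∂stdGaussianPi M.NoiseIdx = 8 * M.t3 := by
  simp only [kernel3_ofNoise]
  simp only [kernelMatrix, Matrix.cons_val]
  rw [integral_mul_mul_eq_trace (formMatrix_supportedOn 0 1 2 3) (formMatrix_supportedOn 2 3 4 5)
    (formMatrix_supportedOn 4 5 0 1)
    (disjoint_contrastSupport hl (by decide) (by decide) (by decide) (by decide))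
    (disjoint_contrastSupport hl (by decide) (by decide) (by decide) (by decide))
    (disjoint_contrastSupport hl (by decide) (by decide) (by decide) (by decide))]
  exact trace_formMatrix_mul_mul hl (by decide) (by decide) (by decide)

theorem integral_kernel2_sub_update_le {l : ∀ i, Fin 4 → Fin (M.n i)}
    (hl : ∀ i, Function.Injective (l i)) (e : M.NoiseIdx) :
    ∫ ξ, (M.kernel2 (M.ofNoise ξ) l - M.kernel2 (M.ofNoise (Function.update ξ e 0)) l) ^ 2
      ∂stdGaussianPi M.NoiseIdx ≤ 160 * chaosConst * (M.t2 * M.weight (M.proj e)) := by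
  simp only [kernel2_ofNoise]
  refine (integral_sq_sub_sq_update_le (formMatrix_supportedOn 0 1 2 3)
    (disjoint_contrastSupport hl (by decide) (by decide) (by decide) (by decide)) e
    (frobSq_formMatrix hl (by decide) (by decide)).le
    (frobSq_cross_formMatrix_le hl (by decide) (by decide) e)
    (by linarith [M.weight_le_t2 (M.proj e)])).trans (le_of_eq (by ring))

theorem integral_kernel3_sub_update_le {l : ∀ i, Fin 6 → Fin (M.n i)}
    (hl : ∀ i, Function.Injective (l i)) (e : M.NoiseIdx) :
    ∫ ξ, (M.kernel3 (M.ofNoise ξ) l - M.kernel3 (M.ofNoise (Function.update ξ e 0)) l) ^ 2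
      ∂stdGaussianPi M.NoiseIdx ≤ 3136 * chaosConst * (M.t2 ^ 2 * M.weight (M.proj e)) := by
  simp only [kernel3_ofNoise]
  refine (integral_mul_sub_mul_update_le (M := kernelMatrix l)
    (S := ![contrastSupport l 0 1, contrastSupport l 2 3, contrastSupport l 4 5])
    (S' := ![contrastSupport l 2 3, contrastSupport l 4 5, contrastSupport l 0 1])
    (q := 4 * M.t2) (r := 4 * M.weight (M.proj e)) ?_ ?_ e ?_ ?_
    (by linarith [M.weight_le_t2 (M.proj e)])).trans (le_of_eq (by ring))
  · intro i
    fin_cases i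
    · exact formMatrix_supportedOn 0 1 2 3
    · exact formMatrix_supportedOn 2 3 4 5
    · exact formMatrix_supportedOn 4 5 0 1
  · intro i
    fin_cases i <;>
      exact disjoint_contrastSupport hl (by decide) (by decide) (by decide) (by decide)
  · intro i
    fin_cases i <;> exact (frobSq_formMatrix hl (by decide) (by decide)).le
  · intro i
    fin_cases i <;> exact frobSq_cross_formMatrix_le hl (by decide) (by decide) e

variable {κ : Type*}

theorem sum_weight_mul_freq_sq {m : ℕ} (K : Finset κ)
    (l : κ → ∀ i : Fin M.a, Fin m → Fin (M.n i)) (c : ℝ) :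
    ∑ e : M.NoiseIdx, (c * M.weight (M.proj e)) * M.freq K l e.1.1 e.1.2 ^ 2 =
      c * M.spread K l := by
  rw [sum_noiseIdx, spread, Finset.mul_sum]
  refine Finset.sum_congr rfl fun s _ => ?_
  rw [Finset.mul_sum, Finset.mul_sum]
  refine Finset.sum_congr rfl fun j _ => ?_
  simp only [proj]
  ring

/-- The normalization by 4 divides the constant 160 of `integral_kernel2_sub_update_le` by 16, and
the Efron-Stein bound doubles the result. The error depends on the design only through `spread`. -/
theorem integral_average_kernel2_sub_sq_le {K : Finset κ} (hK : K.Nonempty)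
    {l : κ → ∀ i : Fin M.a, Fin 4 → Fin (M.n i)}
    (hl : ∀ u ∈ K, ∀ i, Function.Injective (l u i)) :
    ∫ ξ, ((∑ u ∈ K, M.kernel2 (M.ofNoise ξ) (l u)) / (4 * (K.card : ℝ)) - M.t2) ^ 2
      ∂stdGaussianPi M.NoiseIdx ≤ 20 * chaosConst * M.t2 * M.spread K l := by
  have h := integral_average_sub_sq_le K hK (f := fun u ξ => M.kernel2 (M.ofNoise ξ) (l u) / 4)
    (fun u e => ∃ p, l u e.1.1 p = e.1.2) (m := M.t2)
    (c := fun e => 10 * chaosConst * M.t2 * M.weight (M.proj e))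
    (fun u _ => (isPolyFun_kernel2 _).div_const _)
    (fun u hu => by rw [integral_div, integral_kernel2 (hl u hu)]; ring)
    (fun u _ e ξ ht => by
      simp only [kernel2, Z_ofNoise_update (l u) _ _ ξ e ht])
    (fun u hu e => by
      simp only [← sub_div, div_pow]
      rw [integral_div]
      have := integral_kernel2_sub_update_le (hl u hu) e
      linarith)
  have h2 := sum_weight_mul_freq_sq K l (10 * chaosConst * M.t2)
  simp only [freq] at h2
  rw [h2] at h
  simp only [← Finset.sum_div, div_div] at h
  linarith

theorem integral_average_kernel3_sub_sq_le {K : Finset κ} (hK : K.Nonempty)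
    {l : κ → ∀ i : Fin M.a, Fin 6 → Fin (M.n i)}
    (hl : ∀ u ∈ K, ∀ i, Function.Injective (l u i)) :
    ∫ ξ, ((∑ u ∈ K, M.kernel3 (M.ofNoise ξ) (l u)) / (8 * (K.card : ℝ)) - M.t3) ^ 2
      ∂stdGaussianPi M.NoiseIdx ≤ 98 * chaosConst * M.t2 ^ 2 * M.spread K l := by
  have h := integral_average_sub_sq_le K hK (f := fun u ξ => M.kernel3 (M.ofNoise ξ) (l u) / 8)
    (fun u e => ∃ p, l u e.1.1 p = e.1.2) (m := M.t3)
    (c := fun e => 49 * chaosConst * M.t2 ^ 2 * M.weight (M.proj e))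
    (fun u _ => (isPolyFun_kernel3 _).div_const _)
    (fun u hu => by rw [integral_div, integral_kernel3 (hl u hu)]; ring)
    (fun u _ e ξ ht => by
      simp only [kernel3, Z_ofNoise_update (l u) _ _ ξ e ht])
    (fun u hu e => by
      simp only [← sub_div, div_pow]
      rw [integral_div]
      have := integral_kernel3_sub_update_le (hl u hu) e
      linarith)
  have h2 := sum_weight_mul_freq_sq K l (49 * chaosConst * M.t2 ^ 2)
  simp only [freq] at h2
  rw [h2] at h
  simp only [← Finset.sum_div, div_div] at h
  linarith

/-- The estimators of `t3` vanish on a null set only. -/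
theorem ae_sum_kernel3_ne_zero (h3 : M.t3 ≠ 0) {K : Finset κ} (hK : K.Nonempty)
    {l : κ → ∀ i : Fin M.a, Fin 6 → Fin (M.n i)}
    (hl : ∀ u ∈ K, ∀ i, Function.Injective (l u i)) :
    ∀ᵐ ξ ∂stdGaussianPi M.NoiseIdx, ∑ u ∈ K, M.kernel3 (M.ofNoise ξ) (l u) ≠ 0 := by
  have hp : IsPolyFun fun ξ => ∑ u ∈ K, M.kernel3 (M.ofNoise ξ) (l u) :=
    IsPolyFun.sum fun u _ => isPolyFun_kernel3 (l u)
  -- The mean is $8t_3$ times the number of summands. Since it is nonzero, the polynomial does not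
  -- vanish identically.
  have hint : ∫ ξ, ∑ u ∈ K, M.kernel3 (M.ofNoise ξ) (l u) ∂stdGaussianPi M.NoiseIdx ≠ 0 := by
    rw [integral_finsetSum _ fun u _ => (isPolyFun_kernel3 (l u)).integrable,
      Finset.sum_congr rfl fun u hu => integral_kernel3 (hl u hu), Finset.sum_const, nsmul_eq_mul]
    have : (K.card : ℝ) ≠ 0 := by exact_mod_cast hK.card_pos.ne'
    positivity
  obtain ⟨ξ, hξ⟩ : ∃ ξ, ∑ u ∈ K, M.kernel3 (M.ofNoise ξ) (l u) ≠ 0 := by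
    by_contra hc
    push Not at hc
    simp [hc] at hint
  exact hp.ae_ne_zero ξ hξ

end Kernels

end SplitPlot

/-! ### Counting injective index choices -/

section Counting

/-- The choices of `m` distinct indices out of `n`. -/
def injChoices (m n : ℕ) : Finset (Fin m → Fin n) :=
  Finset.univ.filter fun t => Function.Injective t

variable {m n : ℕ}

/-- Exchanging the values `j` and `j'` is a bijection between the choices with value `j` and those
with value `j'` at position `p`, so all `n` fibres have equal size. -/
theorem card_filter_injChoices (p : Fin m) (j : Fin n) :
    n * ((injChoices m n).filter fun t => t p = j).card = (injChoices m n).card := by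
  have h1 : ∀ j', ((injChoices m n).filter fun t => t p = j').card =
      ((injChoices m n).filter fun t => t p = j).card := by
    intro j'
    refine Finset.card_bij' (fun t _ => Equiv.swap j j' ∘ t) (fun t _ => Equiv.swap j j' ∘ t)
      ?_ ?_ ?_ ?_
    · intro t ht
      simp only [injChoices, Finset.mem_filter, Finset.mem_univ, true_and] at ht ⊢
      exact ⟨(Equiv.injective _).comp ht.1, by simp [ht.2]⟩
    · intro t ht
      simp only [injChoices, Finset.mem_filter, Finset.mem_univ, true_and] at ht ⊢
      exact ⟨(Equiv.injective _).comp ht.1, by simp [ht.2]⟩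
    · intro t _; funext k; simp
    · intro t _; funext k; simp
  have h2 := Finset.card_eq_sum_card_fiberwise (s := injChoices m n) (t := Finset.univ)
    (f := fun t => t p) (fun _ _ => Finset.mem_coe.2 (Finset.mem_univ _))
  rw [h2, Finset.sum_congr rfl fun j' _ => h1 j']
  simp

theorem card_injChoices : (injChoices m n).card = n.descFactorial m := by
  have h := Fintype.card_embedding_eq (α := Fin m) (β := Fin n)
  rw [Fintype.card_fin, Fintype.card_fin] at h
  rw [← h, injChoices, ← Fintype.card_subtype]
  exact Fintype.card_congr (Equiv.subtypeInjectiveEquivEmbedding (Fin m) (Fin n))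

/-- Exchanging the positions `p` and `q` reverses the order of the two distinct values and preserves
`A`. -/
theorem card_filter_lt_and {p q : Fin m} (hpq : p ≠ q) (A : (Fin m → Fin n) → Prop)
    [DecidablePred A]
    (hA : ∀ t, A (t ∘ Equiv.swap p q) ↔ A t) :
    2 * ((injChoices m n).filter fun t => t p < t q ∧ A t).card =
      ((injChoices m n).filter A).card := by
  have h1 : ((injChoices m n).filter fun t => ¬ t p < t q ∧ A t).card =
      ((injChoices m n).filter fun t => t p < t q ∧ A t).card := by
    refine Finset.card_bij' (fun t _ => t ∘ Equiv.swap p q) (fun t _ => t ∘ Equiv.swap p q)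
      ?_ ?_ ?_ ?_
    · intro t ht
      simp only [injChoices, Finset.mem_filter, Finset.mem_univ, true_and] at ht ⊢
      refine ⟨ht.1.comp (Equiv.injective _), ?_, (hA t).2 ht.2.2⟩
      have hne : t q ≠ t p := fun h => hpq (ht.1 h).symm
      simpa using lt_of_le_of_ne (not_lt.1 ht.2.1) hne
    · intro t ht
      simp only [injChoices, Finset.mem_filter, Finset.mem_univ, true_and] at ht ⊢
      refine ⟨ht.1.comp (Equiv.injective _), ?_, (hA t).2 ht.2.2⟩
      simpa using ht.2.1.le
    · intro t _; funext k; simp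
    · intro t _; funext k; simp
  have h2 := Finset.card_filter_add_card_filter_not (s := (injChoices m n).filter A)
    (p := fun t => t p < t q)
  simp only [Finset.filter_filter] at h2
  simp only [and_comm] at h1 h2 ⊢
  omega

/-- The choices of four distinct indices entering the estimator of `tr ((T V) ^ 2)`. -/
def orderedChoices (n : ℕ) : Finset (Fin 4 → Fin n) :=
  Finset.univ.filter fun t => Function.Injective t ∧ t 0 < t 1 ∧ t 2 < t 3

theorem card_orderedChoices : 4 * (orderedChoices n).card = (injChoices 4 n).card := by
  have h1 := card_filter_lt_and (m := 4) (n := n) (p := 0) (q := 1) (by decide)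
    (fun t => t 2 < t 3) (fun t => by
      simp [Equiv.swap_apply_of_ne_of_ne])
  have h2 := card_filter_lt_and (m := 4) (n := n) (p := 2) (q := 3) (by decide)
    (fun t => True) (fun t => Iff.rfl)
  have h3 : orderedChoices n = (injChoices 4 n).filter fun t => t 0 < t 1 ∧ t 2 < t 3 := by
    rw [orderedChoices, injChoices, Finset.filter_filter]
  simp only [and_true, Finset.filter_true] at h2
  rw [h3]
  omega

theorem card_orderedChoices_eq : (orderedChoices n).card = 6 * n.choose 4 := by
  have h := card_orderedChoices (n := n)
  rw [card_injChoices, Nat.descFactorial_eq_factorial_mul_choose] at h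
  norm_num [Nat.factorial] at h
  omega

/-- Each inclusion proportion is at most $4m/n$ and the proportions sum to at most $m$; the sum of
squares is bounded by the maximum times the sum. The factor 4 is the price for counting in all
injective choices when `R` contains only a quarter of them, as happens for `orderedChoices`. -/
theorem sum_sq_card_filter_le {R : Finset (Fin m → Fin n)} (hR : R ⊆ injChoices m n)
    (h4 : (injChoices m n).card ≤ 4 * R.card) (hR0 : R.Nonempty) (hn : 0 < n) :
    ∑ j, (((R.filter fun t => ∃ p, t p = j).card : ℝ) / (R.card : ℝ)) ^ 2 ≤
      4 * (m : ℝ) ^ 2 / (n : ℝ) := by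
  have hRpos : (0 : ℝ) < R.card := by exact_mod_cast hR0.card_pos
  have hnpos : (0 : ℝ) < n := by exact_mod_cast hn
  have hsub : ∀ j, ((R.filter fun t => ∃ p, t p = j).card : ℝ) ≤
      ∑ p, ((R.filter fun t => t p = j).card : ℝ) := fun j => by
    have : (R.filter fun t => ∃ p, t p = j) ⊆
        Finset.univ.biUnion fun p => R.filter fun t => t p = j := by
      intro t ht
      obtain ⟨h1, p, h2⟩ := Finset.mem_filter.1 ht
      exact Finset.mem_biUnion.2 ⟨p, Finset.mem_univ _, Finset.mem_filter.2 ⟨h1, h2⟩⟩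
    exact_mod_cast (Finset.card_le_card this).trans Finset.card_biUnion_le
  have hone : ∀ j, ((R.filter fun t => ∃ p, t p = j).card : ℝ) / (R.card : ℝ) ≤ 4 * m / n := by
    intro j
    rw [div_le_div_iff₀ hRpos hnpos]
    have h1 : ∀ p : Fin m, (n : ℝ) * ((R.filter fun t => t p = j).card : ℝ) ≤ 4 * R.card := by
      intro p
      have a := card_filter_injChoices p j
      have b := Finset.card_le_card (Finset.filter_subset_filter (fun t => t p = j) hR)
      have c := Nat.mul_le_mul_left n b
      exact_mod_cast c.trans (a.le.trans h4)
    calc _ ≤ (∑ p, ((R.filter fun t => t p = j).card : ℝ)) * n :=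
          mul_le_mul_of_nonneg_right (hsub j) hnpos.le
      _ = ∑ p, (n : ℝ) * ((R.filter fun t => t p = j).card : ℝ) := by
          rw [Finset.sum_mul]; exact Finset.sum_congr rfl fun _ _ => mul_comm _ _
      _ ≤ ∑ _p : Fin m, (4 * R.card : ℝ) := Finset.sum_le_sum fun p _ => h1 p
      _ = _ := by simp; ring
  have hsum : ∑ j, ((R.filter fun t => ∃ p, t p = j).card : ℝ) / (R.card : ℝ) ≤ m := by
    rw [← Finset.sum_div, div_le_iff₀ hRpos]
    calc _ ≤ ∑ j, ∑ p, ((R.filter fun t => t p = j).card : ℝ) :=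
          Finset.sum_le_sum fun j _ => hsub j
      _ = ∑ p : Fin m, (R.card : ℝ) := by
          rw [Finset.sum_comm]
          refine Finset.sum_congr rfl fun p _ => ?_
          exact_mod_cast (Finset.card_eq_sum_card_fiberwise (s := R) (t := Finset.univ)
            (f := fun t => t p) (fun _ _ => Finset.mem_coe.2 (Finset.mem_univ _))).symm
      _ = _ := by simp
  calc _ ≤ ∑ j, (4 * m / n : ℝ) * (((R.filter fun t => ∃ p, t p = j).card : ℝ) / (R.card : ℝ)) :=
        Finset.sum_le_sum fun j _ => by
          rw [sq]; exact mul_le_mul_of_nonneg_right (hone j) (by positivity)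
    _ = (4 * m / n : ℝ) * ∑ j, ((R.filter fun t => ∃ p, t p = j).card : ℝ) / (R.card : ℝ) := by
        rw [Finset.mul_sum]
    _ ≤ (4 * m / n : ℝ) * m := mul_le_mul_of_nonneg_left hsum (by positivity)
    _ = _ := by ring

/-- The factors belonging to the other groups cancel. Hence inclusion proportions are those of a
single group, however many groups there are. -/
theorem card_filter_piFinset_div {a : ℕ} {β : Fin a → Type*} (R : ∀ i, Finset (β i))
    (hR : ∀ i, (R i).Nonempty) (i : Fin a) (A : β i → Prop)
    [DecidablePred A] :
    (((Fintype.piFinset R).filter fun l => A (l i)).card : ℝ) / ((Fintype.piFinset R).card : ℝ) =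
      (((R i).filter A).card : ℝ) / ((R i).card : ℝ) := by
  have h : ((Fintype.piFinset R).filter fun l => A (l i)) =
      Fintype.piFinset (Function.update R i ((R i).filter A)) := by
    ext l
    simp only [Finset.mem_filter, Fintype.mem_piFinset]
    constructor
    · rintro ⟨h1, h2⟩ k
      by_cases hk : k = i
      · subst hk; simpa using ⟨h1 k, h2⟩
      · simpa [hk] using h1 k
    · intro h1
      have hi := h1 i
      rw [Function.update_self, Finset.mem_filter] at hi
      refine ⟨fun k => ?_, hi.2⟩
      by_cases hk : k = i
      · subst hk; exact hi.1
      · simpa [hk] using h1 k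
  rw [h, Fintype.card_piFinset, Fintype.card_piFinset,
    ← Finset.mul_prod_erase Finset.univ (fun k => (R k).card) (Finset.mem_univ i),
    ← Finset.mul_prod_erase Finset.univ (fun k => (Function.update R i ((R i).filter A) k).card)
      (Finset.mem_univ i)]
  have : ∏ k ∈ Finset.univ.erase i, (Function.update R i ((R i).filter A) k).card =
      ∏ k ∈ Finset.univ.erase i, (R k).card :=
    Finset.prod_congr rfl fun k hk => by rw [Function.update_of_ne (Finset.ne_of_mem_erase hk)]
  rw [this, Function.update_self]
  push_cast
  rw [mul_div_mul_right]
  exact Finset.prod_ne_zero_iff.2 fun k _ => by exact_mod_cast (hR k).card_pos.ne'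

end Counting

/-! ### Inclusion proportions of the complete estimators -/

namespace SplitPlot

variable (M : SplitPlot)

theorem nMin_le (i : Fin M.a) : M.nMin ≤ M.n i := ciInf_le (OrderBot.bddBelow _) i

theorem spread_piFinset_le {m : ℕ} (R : ∀ i, Finset (Fin m → Fin (M.n i)))
    (hR : ∀ i, R i ⊆ injChoices m (M.n i))
    (h4 : ∀ i, (injChoices m (M.n i)).card ≤ 4 * (R i).card) (hR0 : ∀ i, (R i).Nonempty)
    (hn : 0 < M.nMin) :
    M.spread (Fintype.piFinset R) id ≤ M.t2 * (4 * (m : ℝ) ^ 2 / (M.nMin : ℝ)) := by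
  rw [spread, ← sum_weight, Finset.sum_mul]
  refine Finset.sum_le_sum fun s _ => mul_le_mul_of_nonneg_left ?_ (M.weight_nonneg s)
  have h := sum_sq_card_filter_le (hR s.1) (h4 s.1) (hR0 s.1) (hn.trans_le (M.nMin_le s.1))
  have h2 : ∀ j, M.freq (Fintype.piFinset R) id s.1 j =
      (((R s.1).filter fun t => ∃ p, t p = j).card : ℝ) / ((R s.1).card : ℝ) := fun j =>
    card_filter_piFinset_div R hR0 s.1 fun t => ∃ p, t p = j
  simp only [h2]
  refine h.trans (div_le_div_of_nonneg_left (by positivity) (by exact_mod_cast hn) ?_)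
  exact_mod_cast M.nMin_le s.1

end SplitPlot

end

noncomputable section

/-! ### The law of the data -/

theorem measurePreserving_sigmaUncurry {ι : Type*} [Fintype ι] {κ : ι → Type*}
    [∀ i, Fintype (κ i)] {X : (i : ι) → κ i → Type*} [∀ i k, MeasurableSpace (X i k)]
    (μ : ∀ i k, Measure (X i k)) [∀ i k, IsProbabilityMeasure (μ i k)] :
    MeasurePreserving (Sigma.uncurry : (∀ i k, X i k) → ∀ p : Sigma κ, X p.1 p.2)
      (Measure.pi fun i => Measure.pi fun k => μ i k)
      (Measure.pi fun p : Sigma κ => μ p.1 p.2) := by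
  refine ⟨measurable_sigmaUncurry, ?_⟩
  refine (Measure.pi_eq fun s hs => ?_).symm
  rw [Measure.map_apply measurable_sigmaUncurry (MeasurableSet.univ_pi hs)]
  have : (Sigma.uncurry : (∀ i k, X i k) → ∀ p : Sigma κ, X p.1 p.2) ⁻¹' (Set.univ.pi s) =
      Set.univ.pi fun i => Set.univ.pi fun k => s ⟨i, k⟩ := by
    ext x
    simp only [Set.mem_preimage, Set.mem_univ_pi]
    exact ⟨fun h i k => h ⟨i, k⟩, fun h p => h p.1 p.2⟩
  rw [this, Measure.pi_pi]
  simp only [Measure.pi_pi]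
  rw [Fintype.prod_sigma]

namespace SplitPlot

variable {M : SplitPlot}

theorem measurable_ofNoise : Measurable M.ofNoise := by
  refine measurable_pi_lambda _ fun i => measurable_pi_lambda _ fun j => ?_
  unfold ofNoise
  fun_prop

variable {Ω : Type*} [MeasurableSpace Ω] {P : Measure Ω} {X : Ω → M.Data}

theorem IsSample.aemeasurable (h : M.IsSample P X) : AEMeasurable X P :=
  aemeasurable_pi_lambda _ fun i => aemeasurable_pi_lambda _ fun j => (h.law i j).aemeasurable

/-- A multivariate Gaussian is by definition the image of standard Gaussian noise under
$\mu+\Sigma^{1/2}(\cdot)$. Independence turns the joint law into a product of such images, and the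
double index is then merged. -/
theorem IsSample.map_eq [IsProbabilityMeasure P] (h : M.IsSample P X) :
    P.map X = (stdGaussianPi M.NoiseIdx).map M.ofNoise := by
  have h1 : P.map (fun ω (p : (i : Fin M.a) × Fin (M.n i)) => X ω p.1 p.2) =
      Measure.pi fun p : (i : Fin M.a) × Fin (M.n i) =>
        multivariateGaussian (M.mu p.1) (M.Sigma p.1) := by
    rw [(iIndepFun_iff_map_fun_eq_pi_map fun p => (h.law p.1 p.2).aemeasurable).1 h.indep]
    congr 1
    funext p
    exact (h.law p.1 p.2).map_eq
  have h2 : MeasurePreserving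
      (fun (ξ : ∀ p : (i : Fin M.a) × Fin (M.n i), Fin (M.d p.1) → ℝ) p =>
        M.mu p.1 + Matrix.toEuclideanCLM (𝕜 := ℝ) (M.rootSigma p.1) (WithLp.toLp 2 (ξ p)))
      (Measure.pi fun p : (i : Fin M.a) × Fin (M.n i) => stdGaussianPi (Fin (M.d p.1)))
      (Measure.pi fun p : (i : Fin M.a) × Fin (M.n i) =>
        multivariateGaussian (M.mu p.1) (M.Sigma p.1)) := by
    refine measurePreserving_pi _ _
      (f := fun (p : (i : Fin M.a) × Fin (M.n i)) (ξ : Fin (M.d p.1) → ℝ) => M.mu p.1 +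
        Matrix.toEuclideanCLM (𝕜 := ℝ) (M.rootSigma p.1) (WithLp.toLp 2 ξ)) fun p => ?_
    refine ⟨by fun_prop, ?_⟩
    rw [multivariateGaussian, ← map_pi_eq_stdGaussian, Measure.map_map (by fun_prop) (by fun_prop)]
    rfl
  have h3 := measurePreserving_sigmaUncurry
    fun (p : (i : Fin M.a) × Fin (M.n i)) (_ : Fin (M.d p.1)) => gaussianReal 0 1
  have hc : Measurable fun (y : ∀ p : (i : Fin M.a) × Fin (M.n i),
      EuclideanSpace ℝ (Fin (M.d p.1))) => (fun i j => y ⟨i, j⟩ : M.Data) :=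
    measurable_pi_lambda _ fun i => measurable_pi_lambda _ fun j => measurable_pi_apply _
  have hX : P.map X = (P.map fun ω (p : (i : Fin M.a) × Fin (M.n i)) => X ω p.1 p.2).map
      fun y => (fun i j => y ⟨i, j⟩ : M.Data) := by
    rw [AEMeasurable.map_map_of_aemeasurable hc.aemeasurable
      (aemeasurable_pi_lambda _ fun p => (h.law p.1 p.2).aemeasurable)]
    rfl
  rw [hX, h1, ← h2.map_eq, show stdGaussianPi M.NoiseIdx = _ from h3.map_eq.symm,
    Measure.map_map hc h2.measurable, Measure.map_map measurable_ofNoise h3.measurable]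
  rfl

theorem measurable_kernel2 (l : ∀ i, Fin 4 → Fin (M.n i)) : Measurable fun x => M.kernel2 x l := by
  unfold kernel2 form Z dotProduct Matrix.mulVec dotProduct
  fun_prop

theorem measurable_kernel3 (l : ∀ i, Fin 6 → Fin (M.n i)) : Measurable fun x => M.kernel3 x l := by
  unfold kernel3 form Z dotProduct Matrix.mulVec dotProduct
  fun_prop

/-! ### Random subsamples -/

theorem injChoices_nonempty {m n : ℕ} (hmn : m ≤ n) : (injChoices m n).Nonempty := by
  rw [← Finset.card_pos, card_injChoices]
  exact Nat.descFactorial_pos.2 hmn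

theorem coe_injChoices {m n : ℕ} :
    (injChoices m n : Set (Fin m → Fin n)) = {t : Fin m → Fin n | Function.Injective t} := by
  ext t
  simp [injChoices]

theorem uniformOn_injective_le {m n : ℕ} (hmn : m ≤ n) (j : Fin n) :
    (uniformOn {t : Fin m → Fin n | Function.Injective t}).real {t | ∃ p, t p = j} ≤ m / n := by
  have hn : (0 : ℝ) < n := by exact_mod_cast j.pos
  have hc : (0 : ℝ) < (injChoices m n).card := by
    exact_mod_cast (injChoices_nonempty hmn).card_pos
  have h1 : ({t | ∃ p, t p = j} : Set (Fin m → Fin n)) =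
      ((Finset.univ.filter fun t : Fin m → Fin n => ∃ p, t p = j : Finset _) : Set _) := by
    ext t
    simp
  rw [← coe_injChoices, h1, measureReal_def, uniformOn_apply_finset, ENNReal.toReal_div,
    ENNReal.toReal_natCast, ENNReal.toReal_natCast, div_le_div_iff₀ hc hn]
  have h2 : injChoices m n ∩ (Finset.univ.filter fun t : Fin m → Fin n => ∃ p, t p = j) ⊆
      Finset.univ.biUnion fun p => (injChoices m n).filter fun t => t p = j := by
    intro t ht
    obtain ⟨h1, h2⟩ := Finset.mem_inter.1 ht
    obtain ⟨p, hp⟩ := (Finset.mem_filter.1 h2).2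
    exact Finset.mem_biUnion.2 ⟨p, Finset.mem_univ _, Finset.mem_filter.2 ⟨h1, hp⟩⟩
  have h3 := Nat.mul_le_mul_left n ((Finset.card_le_card h2).trans Finset.card_biUnion_le)
  rw [Finset.mul_sum, Finset.sum_congr rfl fun p _ => card_filter_injChoices p j,
    Finset.sum_const, Finset.card_univ, Fintype.card_fin, smul_eq_mul, mul_comm] at h3
  exact_mod_cast h3

section Subsampling

variable {U m : ℕ} {S : Ω → M.Subsamples U m}

theorem IsSubsampling.aemeasurable (h : M.IsSubsampling P X S) : AEMeasurable S P :=
  aemeasurable_pi_lambda _ fun u => aemeasurable_pi_lambda _ fun i => (h.law u i).aemeasurable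

theorem IsSubsampling.ae_injective (h : M.IsSubsampling P X S) :
    ∀ᵐ ω ∂P, ∀ u i, Function.Injective (S ω u i) := by
  refine ae_all_iff.2 fun u => ae_all_iff.2 fun i => ?_
  have h1 : ∀ᵐ t ∂(uniformOn {t : Fin m → Fin (M.n i) | Function.Injective t}),
      Function.Injective t := by
    rw [ae_iff]
    refine (uniformOn_eq_zero_iff (Set.toFinite _)).2 ?_
    ext t
    simp
  rw [← (h.law u i).map_eq] at h1
  exact ae_of_ae_map (h.law u i).aemeasurable h1

theorem freq_univ (s : M.Subsamples U m) (i : Fin M.a) (j : Fin (M.n i)) :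
    M.freq Finset.univ s i j =
      (∑ u, Set.indicator {t : Fin m → Fin (M.n i) | ∃ p, t p = j} (fun _ => (1 : ℝ)) (s u i)) /
        U := by
  simp [freq, Set.indicator_apply, Finset.sum_boole]

variable [IsProbabilityMeasure P]

/-- The squared proportion is an average over pairs of subsamples. With inclusion probability
$\pi\le m/n_i$, the pairs of distinct subsamples contribute at most $\pi^2$ by independence, and the
$\Upsilon$ diagonal pairs add at most $\pi/\Upsilon$. -/
theorem IsSubsampling.integral_freq_sq_le (h : M.IsSubsampling P X S) (hm : ∀ i, m ≤ M.n i)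
    (hU : 0 < U) (i : Fin M.a) (j : Fin (M.n i)) :
    ∫ ω, M.freq Finset.univ (S ω) i j ^ 2 ∂P ≤ (m / M.n i : ℝ) / U + (m / M.n i : ℝ) ^ 2 := by
  have hU' : (0 : ℝ) < U := by exact_mod_cast hU
  set B : Set (Fin m → Fin (M.n i)) := {t | ∃ p, t p = j} with hB
  set φ : (Fin m → Fin (M.n i)) → ℝ := B.indicator fun _ => 1 with hφ
  have hφm : Measurable φ := measurable_of_countable _
  have hφ1 : ∀ t, |φ t| ≤ 1 := fun t => by
    by_cases ht : t ∈ B <;> simp [hφ, ht]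
  set π : ℝ := (uniformOn {t : Fin m → Fin (M.n i) | Function.Injective t}).real B with hπ
  have hπle : π ≤ m / M.n i := uniformOn_injective_le (hm i) j
  have hπ0 : 0 ≤ π := measureReal_nonneg
  have hmean : ∀ u, ∫ ω, φ (S ω u i) ∂P = π := fun u => by
    have := (h.law u i).integral_comp (f := φ) hφm.aestronglyMeasurable
    rw [Function.comp_def] at this
    rw [this, hφ, integral_indicator (MeasurableSet.of_discrete)]
    simp [hπ]
  have hprod : ∀ u u', ∫ ω, φ (S ω u i) * φ (S ω u' i) ∂P ≤ (if u = u' then π else 0) + π ^ 2 := by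
    intro u u'
    by_cases huu : u = u'
    · subst huu
      have : ∀ t, φ t * φ t = φ t := fun t => by
        by_cases ht : t ∈ B <;> simp [hφ, ht]
      simp only [this, hmean, if_true]
      linarith [sq_nonneg π]
    · have hind : IndepFun (fun ω => S ω u i) (fun ω => S ω u' i) P :=
        h.indep.indepFun (i := (u, i)) (j := (u', i)) (by simpa using huu)
      rw [hind.integral_fun_comp_mul_comp (h.law u i).aemeasurable (h.law u' i).aemeasurable
        hφm.aestronglyMeasurable hφm.aestronglyMeasurable, hmean, hmean]
      simp [huu, sq]
  have hint : ∀ u u', Integrable (fun ω => φ (S ω u i) * φ (S ω u' i)) P := fun u u' => by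
    refine Integrable.of_bound (C := 1) ?_ (ae_of_all _ fun ω => ?_)
    · exact ((hφm.comp_aemeasurable (h.law u i).aemeasurable).mul
        (hφm.comp_aemeasurable (h.law u' i).aemeasurable)).aestronglyMeasurable
    · rw [Real.norm_eq_abs, abs_mul]
      exact mul_le_one₀ (hφ1 _) (abs_nonneg _) (hφ1 _)
  have hexp : ∀ ω, M.freq Finset.univ (S ω) i j ^ 2 =
      (∑ u, ∑ u', φ (S ω u i) * φ (S ω u' i)) / (U : ℝ) ^ 2 := fun ω => by
    rw [freq_univ, div_pow, sq (∑ u, _), Finset.sum_mul_sum]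
  simp only [hexp]
  rw [integral_div, integral_finsetSum _ fun u _ => integrable_finsetSum _ fun u' _ => hint u u']
  simp only [integral_finsetSum _ fun u' (_ : u' ∈ Finset.univ) => hint _ u']
  calc _ ≤ (∑ u : Fin U, ∑ u' : Fin U, ((if u = u' then π else 0) + π ^ 2)) / (U : ℝ) ^ 2 := by
        gcongr with u _ u' _
        exact hprod u u'
    _ = π / U + π ^ 2 := by
        simp only [Finset.sum_add_distrib, Finset.sum_ite_eq, Finset.mem_univ, if_true,
          Finset.sum_const, Finset.card_univ, Fintype.card_fin, nsmul_eq_mul]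
        field_simp
    _ ≤ _ := by gcongr

theorem IsSubsampling.integrable_freq_sq (h : M.IsSubsampling P X S) (i : Fin M.a)
    (j : Fin (M.n i)) : Integrable (fun ω => M.freq Finset.univ (S ω) i j ^ 2) P := by
  refine Integrable.of_bound (C := 1) ?_ (ae_of_all _ fun ω => ?_)
  · have : Measurable fun s : M.Subsamples U m => M.freq Finset.univ s i j ^ 2 :=
      measurable_of_countable _
    exact (this.comp_aemeasurable h.aemeasurable).aestronglyMeasurable
  · have h0 : 0 ≤ M.freq Finset.univ (S ω) i j := by unfold freq; positivity
    have h1 : M.freq Finset.univ (S ω) i j ≤ 1 := by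
      unfold freq
      refine div_le_one_of_le₀ ?_ (by positivity)
      exact_mod_cast Finset.card_filter_le _ _
    rw [Real.norm_eq_abs, abs_of_nonneg (sq_nonneg _)]
    exact pow_le_one₀ h0 h1

theorem spread_nonneg {κ : Type*} (K : Finset κ) (l : κ → ∀ i : Fin M.a, Fin m → Fin (M.n i)) :
    0 ≤ M.spread K l :=
  Finset.sum_nonneg fun s _ => mul_nonneg (M.weight_nonneg s)
    (Finset.sum_nonneg fun _ _ => sq_nonneg _)

theorem IsSubsampling.integrable_spread (h : M.IsSubsampling P X S) :
    Integrable (fun ω => M.spread Finset.univ (S ω)) P :=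
  integrable_finsetSum _ fun s _ => (integrable_finsetSum _ fun j _ =>
    h.integrable_freq_sq s.1 j).const_mul _

theorem IsSubsampling.integral_spread_le (h : M.IsSubsampling P X S) (hm : ∀ i, m ≤ M.n i)
    (hU : 0 < U) (hn : 0 < M.nMin) :
    ∫ ω, M.spread Finset.univ (S ω) ∂P ≤ M.t2 * ((m : ℝ) / U + (m : ℝ) ^ 2 / M.nMin) := by
  have hn' : (0 : ℝ) < M.nMin := by exact_mod_cast hn
  simp only [spread]
  rw [integral_finsetSum _ fun s _ => (integrable_finsetSum _ fun j _ =>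
    h.integrable_freq_sq s.1 j).const_mul _, ← sum_weight, Finset.sum_mul]
  refine Finset.sum_le_sum fun s _ => ?_
  rw [integral_const_mul]
  refine mul_le_mul_of_nonneg_left ?_ (M.weight_nonneg s)
  rw [integral_finsetSum _ fun j _ => h.integrable_freq_sq s.1 j]
  have hle : (M.nMin : ℝ) ≤ M.n s.1 := by exact_mod_cast M.nMin_le s.1
  have hns : (0 : ℝ) < M.n s.1 := hn'.trans_le hle
  calc _ ≤ ∑ j : Fin (M.n s.1), ((m / M.n s.1 : ℝ) / U + (m / M.n s.1 : ℝ) ^ 2) :=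
        Finset.sum_le_sum fun j _ => h.integral_freq_sq_le hm hU s.1 j
    _ = (m : ℝ) / U + (m : ℝ) ^ 2 / M.n s.1 := by
        simp only [Finset.sum_const, Finset.card_univ, Fintype.card_fin, nsmul_eq_mul]
        field_simp
    _ ≤ _ := by gcongr

/-- Since index choices and data are independent, their joint law is a product. The bound for fixed
index choices is integrated over the choices, which enter only through `spread`; almost surely all
choices are injective. -/
theorem IsSubsampling.lintegral_sq_le (hX : AEMeasurable X P) (h : M.IsSubsampling P X S)
    (hm : ∀ i, m ≤ M.n i) (hU : 0 < U) (hn : 0 < M.nMin) {F : M.Data → M.Subsamples U m → ℝ}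
    (hF : ∀ s, Measurable fun x => F x s) {c : ℝ} (hc : 0 ≤ c)
    (hb : ∀ s : M.Subsamples U m, (∀ u i, Function.Injective (s u i)) →
      ∫⁻ x, ENNReal.ofReal (F x s ^ 2) ∂(P.map X) ≤
        ENNReal.ofReal (c * M.spread Finset.univ s)) :
    ∫⁻ ω, ENNReal.ofReal (F (X ω) (S ω) ^ 2) ∂P ≤
      ENNReal.ofReal (c * (M.t2 * ((m : ℝ) / U + (m : ℝ) ^ 2 / M.nMin))) := by
  have hprod := (indepFun_iff_map_prod_eq_prod_map_map hX h.aemeasurable).1 h.indep_data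
  have hG : Measurable fun z : M.Data × M.Subsamples U m => ENNReal.ofReal (F z.1 z.2 ^ 2) :=
    measurable_from_prod_countable_left fun s => ((hF s).pow_const 2).ennreal_ofReal
  have hXS := hX.prodMk h.aemeasurable
  have := Measure.isProbabilityMeasure_map (μ := P) hX
  have := Measure.isProbabilityMeasure_map (μ := P) h.aemeasurable
  rw [← lintegral_map' (f := fun z : M.Data × M.Subsamples U m => ENNReal.ofReal (F z.1 z.2 ^ 2))
    hG.aemeasurable hXS, hprod, lintegral_prod_symm _ hG.aemeasurable,
    lintegral_map' (measurable_of_countable _).aemeasurable h.aemeasurable]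
  calc _ ≤ ∫⁻ ω, ENNReal.ofReal (c * M.spread Finset.univ (S ω)) ∂P :=
        lintegral_mono_ae ((h.ae_injective).mono fun ω hω => hb _ hω)
    _ = ENNReal.ofReal (∫ ω, c * M.spread Finset.univ (S ω) ∂P) :=
        (ofReal_integral_eq_lintegral_ofReal (h.integrable_spread.const_mul c)
          (ae_of_all _ fun ω => mul_nonneg hc (spread_nonneg _ _))).symm
    _ ≤ _ := by
        refine ENNReal.ofReal_le_ofReal ?_
        rw [integral_const_mul]
        exact mul_le_mul_of_nonneg_left (h.integral_spread_le hm hU hn) hc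

end Subsampling

end SplitPlot

end

noncomputable section

namespace SplitPlot

variable {M : SplitPlot} {Ω : Type*} [MeasurableSpace Ω] {P : Measure Ω} [IsProbabilityMeasure P]
  {X : Ω → M.Data}

/-! ### Mean square errors of the trace estimators -/

theorem IsSample.lintegral_sq_map (h : M.IsSample P X) {Y : M.Data → ℝ} (hY : Measurable Y)
    (hp : IsPolyFun fun ξ => Y (M.ofNoise ξ)) :
    ∫⁻ x, ENNReal.ofReal (Y x ^ 2) ∂(P.map X) =
      ENNReal.ofReal (∫ ξ, Y (M.ofNoise ξ) ^ 2 ∂stdGaussianPi M.NoiseIdx) := by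
  rw [h.map_eq, lintegral_map (hY.pow_const 2).ennreal_ofReal measurable_ofNoise,
    ofReal_integral_eq_lintegral_ofReal (hp.pow 2).integrable (ae_of_all _ fun _ => sq_nonneg _)]

theorem A2_eq (x : M.Data) : M.A2 x =
    (∑ l ∈ Fintype.piFinset fun i => orderedChoices (M.n i), M.kernel2 x l) /
      (4 * ((Fintype.piFinset fun i => orderedChoices (M.n i)).card : ℝ)) := by
  have h : ∏ i, (6 * ((M.n i).choose 4 : ℝ)) =
      ((Fintype.piFinset fun i => orderedChoices (M.n i)).card : ℝ) := by
    rw [Fintype.card_piFinset]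
    push_cast [card_orderedChoices_eq]
    rfl
  rw [A2, h]
  congr 1

theorem A3_eq (x : M.Data) : M.A3 x =
    (∑ l ∈ Fintype.piFinset fun i => injChoices 6 (M.n i), M.kernel3 x l) /
      (8 * ((Fintype.piFinset fun i => injChoices 6 (M.n i)).card : ℝ)) := by
  have h : ∏ i, (((M.n i).factorial : ℝ) / ((M.n i - 6).factorial : ℝ)) =
      ((Fintype.piFinset fun i => injChoices 6 (M.n i)).card : ℝ) := by
    rw [Fintype.card_piFinset]
    push_cast
    refine Finset.prod_congr rfl fun i _ => ?_
    rw [card_injChoices, div_eq_iff (by positivity), mul_comm]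
    exact_mod_cast (Nat.factorial_mul_descFactorial (M.six_le_n i)).symm
  rw [A3, h]
  congr 1

theorem orderedChoices_subset (n : ℕ) : orderedChoices n ⊆ injChoices 4 n := by
  intro t ht
  simp only [orderedChoices, injChoices, Finset.mem_filter, Finset.mem_univ, true_and] at ht ⊢
  exact ht.1

theorem orderedChoices_nonempty (i : Fin M.a) : (orderedChoices (M.n i)).Nonempty := by
  rw [← Finset.card_pos, card_orderedChoices_eq]
  have := Nat.choose_pos (n := M.n i) (k := 4) (by have := M.six_le_n i; omega)
  omega

theorem injective_of_mem_piFinset {m : ℕ} {R : ∀ i, Finset (Fin m → Fin (M.n i))}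
    (hR : ∀ i, R i ⊆ injChoices m (M.n i)) {l : ∀ i, Fin m → Fin (M.n i)}
    (hl : l ∈ Fintype.piFinset R) (i : Fin M.a) : Function.Injective (l i) := by
  have := hR i (Fintype.mem_piFinset.1 hl i)
  simpa [injChoices] using this

variable (M) in
/-- The rate of the relative mean square errors of all estimators. -/
def rate (U : ℕ) : ℝ := 14112 * chaosConst * (1 / (U : ℝ) + 1 / (M.nMin : ℝ))

theorem IsSample.lintegral_A2_le (h : M.IsSample P X) (hn : 0 < M.nMin) (U : ℕ) :
    ∫⁻ ω, ENNReal.ofReal ((M.A2 (X ω) - M.t2) ^ 2) ∂P ≤ ENNReal.ofReal (M.t2 ^ 2 * M.rate U) := by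
  have hm : Measurable fun x => M.A2 x - M.t2 := by
    simp only [A2_eq]
    exact ((Finset.measurable_sum _ fun l _ => measurable_kernel2 l).div_const _).sub_const _
  have hp : IsPolyFun fun ξ => M.A2 (M.ofNoise ξ) - M.t2 := by
    simp only [A2_eq]
    exact ((IsPolyFun.sum fun l _ => isPolyFun_kernel2 l).div_const _).sub (IsPolyFun.const _)
  rw [← lintegral_map' (f := fun x => ENNReal.ofReal ((M.A2 x - M.t2) ^ 2))
    (hm.pow_const 2).ennreal_ofReal.aemeasurable h.aemeasurable, h.lintegral_sq_map hm hp]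
  refine ENNReal.ofReal_le_ofReal ?_
  simp only [A2_eq]
  have hne : (Fintype.piFinset fun i => orderedChoices (M.n i)).Nonempty :=
    Fintype.piFinset_nonempty.2 orderedChoices_nonempty
  have h1 := integral_average_kernel2_sub_sq_le hne (l := id) fun l hl i =>
    injective_of_mem_piFinset (fun i => orderedChoices_subset (M.n i)) hl i
  have h2 := M.spread_piFinset_le (fun i => orderedChoices (M.n i))
    (fun i => orderedChoices_subset _) (fun i => card_orderedChoices.ge) orderedChoices_nonempty hn
  have hC := chaosConst_pos
  have ht := M.t2_nonneg
  refine h1.trans ((mul_le_mul_of_nonneg_left h2 (by positivity)).trans ?_)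
  have hn' : (0 : ℝ) < M.nMin := by exact_mod_cast hn
  have hU : 0 ≤ 1 / (U : ℝ) := by positivity
  have : M.t2 ^ 2 * M.rate U - 20 * chaosConst * M.t2 * (M.t2 * (4 * ((4 : ℕ) : ℝ) ^ 2 / M.nMin)) =
      M.t2 ^ 2 * chaosConst * (14112 * (1 / (U : ℝ)) + 12832 * (1 / (M.nMin : ℝ))) := by
    unfold rate; push_cast; ring
  have h0 : 0 ≤ M.t2 ^ 2 * chaosConst * (14112 * (1 / (U : ℝ)) + 12832 * (1 / (M.nMin : ℝ))) := by
    positivity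
  linarith

theorem IsSample.lintegral_A3_le (h : M.IsSample P X) (hn : 0 < M.nMin) (U : ℕ) :
    ∫⁻ ω, ENNReal.ofReal ((M.A3 (X ω) - M.t3) ^ 2) ∂P ≤ ENNReal.ofReal (M.t2 ^ 3 * M.rate U) := by
  have hm : Measurable fun x => M.A3 x - M.t3 := by
    simp only [A3_eq]
    exact ((Finset.measurable_sum _ fun l _ => measurable_kernel3 l).div_const _).sub_const _
  have hp : IsPolyFun fun ξ => M.A3 (M.ofNoise ξ) - M.t3 := by
    simp only [A3_eq]
    exact ((IsPolyFun.sum fun l _ => isPolyFun_kernel3 l).div_const _).sub (IsPolyFun.const _)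
  rw [← lintegral_map' (f := fun x => ENNReal.ofReal ((M.A3 x - M.t3) ^ 2))
    (hm.pow_const 2).ennreal_ofReal.aemeasurable h.aemeasurable, h.lintegral_sq_map hm hp]
  refine ENNReal.ofReal_le_ofReal ?_
  simp only [A3_eq]
  have hR : ∀ i, (injChoices 6 (M.n i)).Nonempty := fun i => injChoices_nonempty (M.six_le_n i)
  have h1 := integral_average_kernel3_sub_sq_le (Fintype.piFinset_nonempty.2 hR) (l := id)
    fun l hl i => injective_of_mem_piFinset (fun i => subset_rfl) hl i
  have h2 := M.spread_piFinset_le (fun i => injChoices 6 (M.n i))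
    (fun i => subset_rfl) (fun i => by omega) hR hn
  have hC := chaosConst_pos
  have ht := M.t2_nonneg
  refine h1.trans ((mul_le_mul_of_nonneg_left h2 (by positivity)).trans ?_)
  have hn' : (0 : ℝ) < M.nMin := by exact_mod_cast hn
  have hU : 0 ≤ 1 / (U : ℝ) := by positivity
  -- The constant in `rate` is $98\cdot4\cdot6^2=14112$, the largest one that occurs, so here the
  -- $1/n_{\min}$ terms cancel exactly. The term with `U` is slack that lets one rate serve all four
  -- estimators.
  have : M.t2 ^ 3 * M.rate U -
      98 * chaosConst * M.t2 ^ 2 * (M.t2 * (4 * ((6 : ℕ) : ℝ) ^ 2 / M.nMin)) =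
      M.t2 ^ 3 * chaosConst * (14112 * (1 / (U : ℝ))) := by
    unfold rate; push_cast; ring
  have h0 : 0 ≤ M.t2 ^ 3 * chaosConst * (14112 * (1 / (U : ℝ))) := by positivity
  linarith

theorem IsSample.ae_A3_ne_zero (h : M.IsSample P X) (h3 : M.t3 ≠ 0) :
    ∀ᵐ ω ∂P, M.A3 (X ω) ≠ 0 := by
  have hR : ∀ i, (injChoices 6 (M.n i)).Nonempty := fun i => injChoices_nonempty (M.six_le_n i)
  have hne := Fintype.piFinset_nonempty.2 hR
  have h1 := ae_sum_kernel3_ne_zero h3 hne (l := id)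
    fun l hl i => injective_of_mem_piFinset (fun i => subset_rfl) hl i
  have h2 : ∀ᵐ x ∂(P.map X), M.A3 x ≠ 0 := by
    rw [h.map_eq, ae_map_iff measurable_ofNoise.aemeasurable]
    · filter_upwards [h1] with ξ hξ
      rw [A3_eq]
      have : ((Fintype.piFinset fun i => injChoices 6 (M.n i)).card : ℝ) ≠ 0 := by
        exact_mod_cast hne.card_pos.ne'
      exact div_ne_zero hξ (mul_ne_zero (by norm_num) this)
    · have hm : Measurable fun x => M.A3 x := by
        simp only [A3_eq]
        exact (Finset.measurable_sum _ fun l _ => measurable_kernel3 l).div_const _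
      exact hm (MeasurableSet.singleton 0).compl
  exact ae_of_ae_map h.aemeasurable h2

section Star

variable {U : ℕ}

theorem measurable_A2star (s : M.Subsamples U 4) : Measurable fun x => M.A2star x s :=
  (Finset.measurable_sum _ fun u _ => measurable_kernel2 (s u)).div_const _

theorem measurable_A3star (s : M.Subsamples U 6) : Measurable fun x => M.A3star x s :=
  (Finset.measurable_sum _ fun u _ => measurable_kernel3 (s u)).div_const _

theorem IsSample.lintegral_A2star_le (h : M.IsSample P X) {S : Ω → M.Subsamples U 4}
    (hS : M.IsSubsampling P X S) (hU : 0 < U) (hn : 0 < M.nMin) :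
    ∫⁻ ω, ENNReal.ofReal ((M.A2star (X ω) (S ω) - M.t2) ^ 2) ∂P ≤
      ENNReal.ofReal (M.t2 ^ 2 * M.rate U) := by
  have hC := chaosConst_pos
  have ht := M.t2_nonneg
  have : Nonempty (Fin U) := ⟨⟨0, hU⟩⟩
  refine (hS.lintegral_sq_le (F := fun x s => M.A2star x s - M.t2) (c := 20 * chaosConst * M.t2)
    h.aemeasurable (fun i => by have := M.six_le_n i; omega) hU hn
    (fun s => (measurable_A2star s).sub_const _) (by positivity) fun s hs => ?_).trans ?_
  · rw [h.lintegral_sq_map ((measurable_A2star s).sub_const _)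
      (((IsPolyFun.sum fun u _ => isPolyFun_kernel2 (s u)).div_const _).sub (IsPolyFun.const _))]
    refine ENNReal.ofReal_le_ofReal ?_
    have h1 := integral_average_kernel2_sub_sq_le (Finset.univ_nonempty (α := Fin U)) (l := s)
      fun u _ i => hs u i
    simpa [A2star] using h1
  · refine ENNReal.ofReal_le_ofReal ?_
    have : M.t2 ^ 2 * M.rate U - 20 * chaosConst * M.t2 *
        (M.t2 * (((4 : ℕ) : ℝ) / U + ((4 : ℕ) : ℝ) ^ 2 / M.nMin)) =
        M.t2 ^ 2 * chaosConst * (14032 * (1 / (U : ℝ)) + 13792 * (1 / (M.nMin : ℝ))) := by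
      unfold rate; push_cast; ring
    have h0 : 0 ≤ M.t2 ^ 2 * chaosConst * (14032 * (1 / (U : ℝ)) + 13792 * (1 / (M.nMin : ℝ))) := by
      positivity
    linarith

theorem IsSample.lintegral_A3star_le (h : M.IsSample P X) {S : Ω → M.Subsamples U 6}
    (hS : M.IsSubsampling P X S) (hU : 0 < U) (hn : 0 < M.nMin) :
    ∫⁻ ω, ENNReal.ofReal ((M.A3star (X ω) (S ω) - M.t3) ^ 2) ∂P ≤
      ENNReal.ofReal (M.t2 ^ 3 * M.rate U) := by
  have hC := chaosConst_pos
  have ht := M.t2_nonneg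
  have : Nonempty (Fin U) := ⟨⟨0, hU⟩⟩
  refine (hS.lintegral_sq_le (F := fun x s => M.A3star x s - M.t3)
    (c := 98 * chaosConst * M.t2 ^ 2) h.aemeasurable M.six_le_n hU hn
    (fun s => (measurable_A3star s).sub_const _) (by positivity) fun s hs => ?_).trans ?_
  · rw [h.lintegral_sq_map ((measurable_A3star s).sub_const _)
      (((IsPolyFun.sum fun u _ => isPolyFun_kernel3 (s u)).div_const _).sub (IsPolyFun.const _))]
    refine ENNReal.ofReal_le_ofReal ?_
    have h1 := integral_average_kernel3_sub_sq_le (Finset.univ_nonempty (α := Fin U)) (l := s)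
      fun u _ i => hs u i
    simpa [A3star] using h1
  · refine ENNReal.ofReal_le_ofReal ?_
    have : M.t2 ^ 3 * M.rate U - 98 * chaosConst * M.t2 ^ 2 *
        (M.t2 * (((6 : ℕ) : ℝ) / U + ((6 : ℕ) : ℝ) ^ 2 / M.nMin)) =
        M.t2 ^ 3 * chaosConst * (13524 * (1 / (U : ℝ)) + 10584 * (1 / (M.nMin : ℝ))) := by
      unfold rate; push_cast; ring
    have h0 : 0 ≤ M.t2 ^ 3 * chaosConst * (13524 * (1 / (U : ℝ)) + 10584 * (1 / (M.nMin : ℝ))) := by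
      positivity
    linarith

/-- There are finitely many index choices, so outside one null set the estimator is nonzero for all
injective choices simultaneously, in particular for the random one. -/
theorem IsSample.ae_A3star_ne_zero (h : M.IsSample P X) (h3 : M.t3 ≠ 0) {S : Ω → M.Subsamples U 6}
    (hS : M.IsSubsampling P X S) (hU : 0 < U) : ∀ᵐ ω ∂P, M.A3star (X ω) (S ω) ≠ 0 := by
  have : Nonempty (Fin U) := ⟨⟨0, hU⟩⟩
  have hU' : (U : ℝ) ≠ 0 := by exact_mod_cast hU.ne'
  have h1 : ∀ s : M.Subsamples U 6, (∀ u i, Function.Injective (s u i)) →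
      ∀ᵐ ω ∂P, M.A3star (X ω) s ≠ 0 := fun s hs => by
    have h2 : ∀ᵐ x ∂(P.map X), M.A3star x s ≠ 0 := by
      rw [h.map_eq, ae_map_iff (p := fun x => M.A3star x s ≠ 0) measurable_ofNoise.aemeasurable
        (measurable_A3star s (MeasurableSet.singleton 0).compl)]
      filter_upwards [ae_sum_kernel3_ne_zero h3 (Finset.univ_nonempty (α := Fin U)) (l := s)
        fun u _ i => hs u i] with ξ hξ
      exact div_ne_zero hξ (mul_ne_zero (by norm_num) hU')
    exact ae_of_ae_map h.aemeasurable h2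
  have h2 : ∀ᵐ ω ∂P, ∀ s : M.Subsamples U 6, (∀ u i, Function.Injective (s u i)) →
      M.A3star (X ω) s ≠ 0 :=
    ae_all_iff.2 fun s => by
      by_cases hs : ∀ u i, Function.Injective (s u i)
      · filter_upwards [h1 s hs] with ω hω _ using hω
      · exact ae_of_all _ fun ω hs' => absurd hs' hs
  filter_upwards [h2, hS.ae_injective] with ω hω hs using hω _ hs

end Star

end SplitPlot

end

noncomputable section

/-! ### Eigenvalues -/

theorem Matrix.IsHermitian.trace_pow_eq_sum {n : Type*} [Fintype n] [DecidableEq n]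
    {A : Matrix n n ℝ} (hA : A.IsHermitian) (k : ℕ) :
    (A ^ k).trace = ∑ i, hA.eigenvalues i ^ k := by
  conv_lhs => rw [hA.spectral_theorem, ← map_pow, Unitary.conjStarAlgAut_apply,
    Matrix.trace_mul_cycle, Unitary.coe_star_mul_self, one_mul, Matrix.diagonal_pow,
    Matrix.trace_diagonal]
  simp

namespace SplitPlot

variable (M : SplitPlot)

theorem TVT_eq : M.T * M.V * M.T = (M.T * M.rootV) * (M.T * M.rootV).conjTranspose := by
  have hT : M.T.transpose = M.T := M.T_symm
  rw [Matrix.conjTranspose_eq_transpose_of_trivial, Matrix.transpose_mul, hT,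
    ← rootV_mul_transpose]
  simp only [Matrix.mul_assoc]

theorem eig_nonneg (s : M.Idx) : 0 ≤ M.eig s := by
  have : (M.T * M.V * M.T).PosSemidef := by
    rw [TVT_eq]; exact Matrix.posSemidef_self_mul_conjTranspose _
  exact this.eigenvalues_nonneg s

theorem trace_TVT_pow (k : ℕ) :
    ((M.T * M.V * M.T) ^ (k + 1)).trace = ((M.T * M.V) ^ (k + 1)).trace := by
  have h : M.T * M.T = M.T := M.T_idem
  have h2 : ∀ k : ℕ, (M.T * M.V * M.T) ^ (k + 1) = (M.T * M.V) ^ (k + 1) * M.T := by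
    intro k
    induction k with
    | zero => simp
    | succ k ih =>
      rw [pow_succ, ih, pow_succ (M.T * M.V) (k + 1)]
      simp only [Matrix.mul_assoc]
      rw [← Matrix.mul_assoc M.T M.T, h]
  rw [h2, Matrix.trace_mul_comm, pow_succ', ← Matrix.mul_assoc, ← Matrix.mul_assoc, h]

theorem t2_eq_sum : M.t2 = ∑ s, M.eig s ^ 2 := by
  rw [t2, ← M.trace_TVT_pow 1, M.TVT_isHermitian.trace_pow_eq_sum]
  rfl

theorem t3_eq_sum : M.t3 = ∑ s, M.eig s ^ 3 := by
  rw [t3, ← M.trace_TVT_pow 2, M.TVT_isHermitian.trace_pow_eq_sum]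
  rfl

theorem nonempty_idx : Nonempty M.Idx := by
  by_contra h
  rw [not_nonempty_iff] at h
  exact M.T_ne_zero (Matrix.ext fun i => h.elim i)

/-- If all eigenvalues vanished, the Gram matrix $TVT$ would be zero, hence so would $T$ times the
root of $V$ and then $TV$. As $V$ is invertible, $T$ would be zero. -/
theorem exists_eig_ne_zero : ∃ s, M.eig s ≠ 0 := by
  by_contra hc
  push Not at hc
  have h0 : M.T * M.V * M.T = 0 := M.TVT_isHermitian.eigenvalues_eq_zero_iff.1 (funext hc)
  rw [TVT_eq, Matrix.self_mul_conjTranspose_eq_zero] at h0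
  have hTV : M.T * M.V = 0 := by
    rw [← rootV_mul_transpose, ← Matrix.mul_assoc, h0, Matrix.zero_mul]
  set Vi : Matrix M.Idx M.Idx ℝ :=
    Matrix.blockDiagonal' fun i => ((M.n i : ℝ) / (M.N : ℝ)) • (M.Sigma i)⁻¹
  have hVV : M.V * Vi = 1 := by
    rw [V, ← Matrix.blockDiagonal'_mul, ← Matrix.blockDiagonal'_one]
    congr 1
    funext i
    have hn : (M.n i : ℝ) ≠ 0 := by
      have := M.six_le_n i
      exact_mod_cast (by omega : M.n i ≠ 0)
    have hN : (M.N : ℝ) ≠ 0 := by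
      have h1 := M.six_le_n i
      have h2 : M.n i ≤ M.N := Finset.single_le_sum (f := M.n) (fun _ _ => Nat.zero_le _)
        (Finset.mem_univ i)
      exact_mod_cast (by omega : M.N ≠ 0)
    have hdet : IsUnit (M.Sigma i).det := (M.Sigma_posDef i).det_pos.ne'.isUnit
    rw [Matrix.smul_mul, Matrix.mul_smul, smul_smul, Matrix.mul_nonsing_inv _ hdet]
    rw [show (M.N : ℝ) / M.n i * (M.n i / M.N) = 1 by field_simp, one_smul]
    rfl
  apply M.T_ne_zero
  rw [← Matrix.mul_one M.T, ← hVV, ← Matrix.mul_assoc, hTV, Matrix.zero_mul]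

theorem t2_pos : 0 < M.t2 := by
  obtain ⟨s, hs⟩ := M.exists_eig_ne_zero
  rw [t2_eq_sum]
  exact Finset.sum_pos' (fun s _ => sq_nonneg _) ⟨s, Finset.mem_univ s, by positivity⟩

theorem t3_pos : 0 < M.t3 := by
  obtain ⟨s, hs⟩ := M.exists_eig_ne_zero
  have := lt_of_le_of_ne (M.eig_nonneg s) hs.symm
  rw [t3_eq_sum]
  exact Finset.sum_pos' (fun s _ => pow_nonneg (M.eig_nonneg s) 3)
    ⟨s, Finset.mem_univ s, by positivity⟩

/-- The square root of the reciprocal of the Pearson degrees of freedom. -/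
def tau : ℝ := M.t3 / √M.t2 ^ 3

theorem one_div_fP : 1 / M.fP = M.tau ^ 2 := by
  have h : √M.t2 ^ 2 = M.t2 := Real.sq_sqrt M.t2_nonneg
  rw [tau, fP, one_div_div, div_pow, ← pow_mul, mul_comm 3 2, pow_mul, h]
  rfl

theorem exists_eig_eq_iSup : ∃ s, M.eig s = ⨆ s, M.eig s :=
  have := M.nonempty_idx
  exists_eq_ciSup_of_finite

theorem tau_pos : 0 < M.tau := by
  have := M.t2_pos
  have := M.t3_pos
  unfold tau
  positivity

theorem beta1_nonneg : 0 ≤ M.beta1 := by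
  obtain ⟨s, hs⟩ := M.exists_eig_eq_iSup
  rw [beta1, ← hs]
  exact div_nonneg (M.eig_nonneg s) (Real.sqrt_nonneg _)

theorem beta1_le_one : M.beta1 ≤ 1 := by
  obtain ⟨s, hs⟩ := M.exists_eig_eq_iSup
  rw [beta1, ← hs, ← t2_eq_sum]
  refine div_le_one_of_le₀ ?_ (Real.sqrt_nonneg _)
  rw [t2_eq_sum]
  refine Real.le_sqrt_of_sq_le ?_
  exact Finset.single_le_sum (f := fun s => M.eig s ^ 2) (fun _ _ => sq_nonneg _)
    (Finset.mem_univ s)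

theorem tau_le_beta1 : M.tau ≤ M.beta1 := by
  have h : √M.t2 ^ 2 = M.t2 := Real.sq_sqrt M.t2_nonneg
  have hp : 0 < √M.t2 := Real.sqrt_pos.2 M.t2_pos
  rw [tau, beta1, ← t2_eq_sum, div_le_div_iff₀ (by positivity) hp]
  have : M.t3 ≤ (⨆ s, M.eig s) * M.t2 := by
    rw [t3_eq_sum, t2_eq_sum, Finset.mul_sum]
    refine Finset.sum_le_sum fun s _ => ?_
    rw [pow_succ' _ 2]
    exact mul_le_mul_of_nonneg_right (le_ciSup (Set.finite_range M.eig).bddAbove s) (sq_nonneg _)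
  calc M.t3 * √M.t2 ≤ (⨆ s, M.eig s) * M.t2 * √M.t2 := mul_le_mul_of_nonneg_right this hp.le
    _ = (⨆ s, M.eig s) * √M.t2 ^ 3 := by rw [pow_succ, h]; ring

theorem beta1_pow_le_tau : M.beta1 ^ 3 ≤ M.tau := by
  have hp : 0 < √M.t2 := Real.sqrt_pos.2 M.t2_pos
  obtain ⟨s, hs⟩ := M.exists_eig_eq_iSup
  rw [tau, beta1, ← t2_eq_sum, div_pow, ← hs]
  refine div_le_div_of_nonneg_right ?_ (by positivity)
  rw [t3_eq_sum]
  exact Finset.single_le_sum (f := fun s => M.eig s ^ 3)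
    (fun s _ => pow_nonneg (M.eig_nonneg s) 3) (Finset.mem_univ s)

theorem tau_le_one : M.tau ≤ 1 := M.tau_le_beta1.trans M.beta1_le_one

end SplitPlot

/-- Squeezing in $\beta_1^6\le\tau^2\le\beta_1^2$. -/
theorem tendsto_beta1_zero_iff (M : ℕ → SplitPlot) :
    Tendsto (fun k => (M k).beta1) atTop (𝓝 0) ↔
      Tendsto (fun k => (M k).tau ^ 2) atTop (𝓝 0) := by
  constructor
  · intro h
    have : Tendsto (fun k => (M k).beta1 ^ 2) atTop (𝓝 0) := by simpa using h.pow 2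
    exact squeeze_zero (fun k => sq_nonneg _)
      (fun k => pow_le_pow_left₀ (M k).tau_pos.le (M k).tau_le_beta1 2) this
  · intro h
    have h6 : Tendsto (fun k => (M k).beta1 ^ 6) atTop (𝓝 0) := by
      refine squeeze_zero (fun k => by positivity) (fun k => ?_) h
      have := pow_le_pow_left₀ (pow_nonneg (M k).beta1_nonneg 3) (M k).beta1_pow_le_tau 2
      rwa [← pow_mul] at this
    have := h6.rpow_const (p := 1 / 6) (Or.inr (by norm_num))
    rw [Real.zero_rpow (by norm_num)] at this
    refine this.congr fun k => ?_
    rw [← Real.rpow_natCast, ← Real.rpow_mul (M k).beta1_nonneg]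
    norm_num

/-- Squeezing in $\beta_1^6\le\tau^2\le1$ and $\tau^2\le\tau\le\beta_1\le1$. -/
theorem tendsto_beta1_one_iff (M : ℕ → SplitPlot) :
    Tendsto (fun k => (M k).beta1) atTop (𝓝 1) ↔
      Tendsto (fun k => (M k).tau ^ 2) atTop (𝓝 1) := by
  constructor
  · intro h
    have h6 : Tendsto (fun k => (M k).beta1 ^ 6) atTop (𝓝 1) := by simpa using h.pow 6
    refine tendsto_of_tendsto_of_tendsto_of_le_of_le h6 tendsto_const_nhds (fun k => ?_)
      fun k => pow_le_one₀ (M k).tau_pos.le (M k).tau_le_one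
    have := pow_le_pow_left₀ (pow_nonneg (M k).beta1_nonneg 3) (M k).beta1_pow_le_tau 2
    rwa [← pow_mul] at this
  · intro h
    refine tendsto_of_tendsto_of_tendsto_of_le_of_le h tendsto_const_nhds (fun k => ?_)
      fun k => (M k).beta1_le_one
    have h1 := (M k).tau_le_one
    have h2 := (M k).tau_pos
    have h3 := (M k).tau_le_beta1
    show (M k).tau ^ 2 ≤ (M k).beta1
    nlinarith

end

noncomputable section

/-! ### The laws of standardized chi-squared variables -/

open BoundedContinuousFunction

/-- The chi-squared density, up to a normalizing factor. -/
def chiWeight (f x : ℝ) : ℝ := if 0 ≤ x then x ^ (f / 2 - 1) * Real.exp (-(1 / 2 * x)) else 0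

theorem chiWeight_nonneg (f x : ℝ) : 0 ≤ chiWeight f x := by
  unfold chiWeight
  split_ifs with h
  · positivity
  · rfl

theorem measurable_chiWeight (f : ℝ) : Measurable (chiWeight f) :=
  Measurable.ite measurableSet_Ici
    ((measurable_id'.pow_const _).mul (measurable_id'.const_mul _).neg.exp) measurable_const

theorem isProbabilityMeasure_chiSquaredLaw {f : ℝ} (hf : 0 < f) :
    IsProbabilityMeasure (chiSquaredLaw f) :=
  isProbabilityMeasure_gammaMeasure (by positivity) (by norm_num)

theorem isProbabilityMeasure_KLaw {f : ℝ} (hf : 0 < f) : IsProbabilityMeasure (KLaw f) :=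
  have := isProbabilityMeasure_chiSquaredLaw hf
  Measure.isProbabilityMeasure_map (by fun_prop)

theorem integral_chiSquaredLaw {f : ℝ} (hf : 0 < f) (G : ℝ → ℝ) :
    ∫ x, G x ∂(chiSquaredLaw f) =
      (1 / 2 : ℝ) ^ (f / 2) / Real.Gamma (f / 2) * ∫ x, chiWeight f x * G x := by
  have hm : Measurable (gammaPDF (f / 2) (1 / 2)) := (measurable_gammaPDFReal _ _).ennreal_ofReal
  rw [chiSquaredLaw, gammaMeasure, integral_withDensity_eq_integral_toReal_smul hm
    (ae_of_all _ fun _ => ENNReal.ofReal_lt_top),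
    ← integral_const_mul]
  refine integral_congr_ae (ae_of_all _ fun x => ?_)
  simp only [gammaPDF, smul_eq_mul]
  rw [ENNReal.toReal_ofReal (gammaPDFReal_nonneg (by positivity) (by norm_num) x)]
  unfold gammaPDFReal chiWeight
  split_ifs
  · ring
  · ring

theorem chiWeight_normalization {f : ℝ} (hf : 0 < f) :
    (1 / 2 : ℝ) ^ (f / 2) / Real.Gamma (f / 2) * ∫ x, chiWeight f x = 1 := by
  have := isProbabilityMeasure_chiSquaredLaw hf
  have h := integral_chiSquaredLaw hf fun _ => 1
  simpa using h.symm

theorem integral_chiWeight_ne_zero {f : ℝ} (hf : 0 < f) : ∫ x, chiWeight f x ≠ 0 := by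
  intro h
  simpa [h] using chiWeight_normalization hf

/-- The Bochner integral of a non-integrable function is 0 by convention, which the normalization
excludes. -/
theorem integrable_chiWeight {f : ℝ} (hf : 0 < f) : Integrable (chiWeight f) := by
  by_contra h
  exact integral_chiWeight_ne_zero hf (integral_undef h)

theorem integral_KLaw {f : ℝ} (hf : 0 < f) (g : ℝ →ᵇ ℝ) :
    ∫ x, g x ∂(KLaw f) =
      (∫ x, chiWeight f x * g ((x - f) / √(2 * f))) / ∫ x, chiWeight f x := by
  rw [KLaw, integral_map (by fun_prop) g.continuous.aestronglyMeasurable,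
    integral_chiSquaredLaw hf, eq_div_iff (integral_chiWeight_ne_zero hf)]
  linear_combination (∫ x, chiWeight f x * g ((x - f) / √(2 * f))) * chiWeight_normalization hf

theorem stdChiSquaredOne_eq : stdChiSquaredOne = KLaw 1 := by
  simp [stdChiSquaredOne, KLaw]

/-- The smaller exponent dominates on $(0,1]$ and the larger one on $[1,\infty)$. The point 0 is
excluded because $0^0=1$ breaks the bound at $f=2$ when $f_1<2<f_2$. -/
theorem chiWeight_le_add {f₁ f f₂ : ℝ} (h₁ : f₁ ≤ f) (h₂ : f ≤ f₂) {x : ℝ} (hx : x ≠ 0) :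
    chiWeight f x ≤ chiWeight f₁ x + chiWeight f₂ x := by
  unfold chiWeight
  split_ifs with h
  · have hx' : 0 < x := lt_of_le_of_ne h hx.symm
    rw [← add_mul]
    refine mul_le_mul_of_nonneg_right ?_ (Real.exp_pos _).le
    rcases le_total x 1 with h1 | h1
    · have := Real.rpow_le_rpow_of_exponent_ge hx' h1 (by linarith : f₁ / 2 - 1 ≤ f / 2 - 1)
      have := Real.rpow_nonneg h (f₂ / 2 - 1)
      linarith
    · have := Real.rpow_le_rpow_of_exponent_le h1 (by linarith : f / 2 - 1 ≤ f₂ / 2 - 1)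
      have := Real.rpow_nonneg h (f₁ / 2 - 1)
      linarith
  · simp

theorem continuousAt_integral_chiWeight (g : ℝ →ᵇ ℝ) {f₀ : ℝ} (hf : 0 < f₀) :
    ContinuousAt (fun f => ∫ x, chiWeight f x * g ((x - f) / √(2 * f))) f₀ := by
  refine continuousAt_of_dominated
    (bound := fun x => (chiWeight (f₀ / 2) x + chiWeight (2 * f₀) x) * ‖g‖) ?_ ?_ ?_ ?_
  · refine Eventually.of_forall fun f => ?_
    refine (measurable_chiWeight f).aestronglyMeasurable.mul ?_
    exact (g.continuous.comp (by fun_prop)).aestronglyMeasurable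
  · filter_upwards [Ioo_mem_nhds (by linarith : f₀ / 2 < f₀) (by linarith : f₀ < 2 * f₀)] with f hf
    filter_upwards [Measure.ae_ne volume 0] with x hx
    rw [norm_mul, Real.norm_of_nonneg (chiWeight_nonneg f x)]
    exact mul_le_mul (chiWeight_le_add hf.1.le hf.2.le hx) (g.norm_coe_le_norm _) (norm_nonneg _)
      (add_nonneg (chiWeight_nonneg _ _) (chiWeight_nonneg _ _))
  · exact ((integrable_chiWeight (by positivity)).add
      (integrable_chiWeight (by positivity))).mul_const _
  · filter_upwards [Measure.ae_ne volume 0] with x hx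
    refine ContinuousAt.mul ?_ (g.continuous.continuousAt.comp ?_)
    · unfold chiWeight
      split_ifs
      · exact ((Real.continuousAt_const_rpow hx).comp (by fun_prop)).mul continuousAt_const
      · exact continuousAt_const
    · exact ContinuousAt.div (by fun_prop) (by fun_prop) (by positivity)

/-- Writing the expectation as a quotient of integrals of the unnormalized density reduces numerator
and denominator to the same dominated convergence argument, the latter with $g=1$. -/
theorem continuousAt_integral_KLaw (g : ℝ →ᵇ ℝ) {f₀ : ℝ} (hf : 0 < f₀) :
    ContinuousAt (fun f => ∫ x, g x ∂(KLaw f)) f₀ := by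
  have h1 := continuousAt_integral_chiWeight (BoundedContinuousFunction.const ℝ 1) hf
  simp only [BoundedContinuousFunction.const_apply, mul_one] at h1
  refine ((continuousAt_integral_chiWeight g hf).div h1
    (integral_chiWeight_ne_zero hf)).congr ?_
  filter_upwards [lt_mem_nhds hf] with f hf
  exact (integral_KLaw hf g).symm

/-! ### Large degrees of freedom -/

/-- This is $t\le\sinh t$ at $t=\log(1+u)$. -/
theorem log_one_add_le_of_nonneg {u : ℝ} (hu : 0 ≤ u) :
    Real.log (1 + u) ≤ u - u ^ 2 / (2 * (1 + u)) := by
  have h : 0 < 1 + u := by linarith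
  have := Real.self_le_sinh_iff.2 (Real.log_nonneg (by linarith : 1 ≤ 1 + u))
  rw [Real.sinh_log h] at this
  refine this.trans_eq ?_
  field_simp
  ring

theorem log_one_add_le_of_nonpos {u : ℝ} (hu : u ≤ 0) (h : 0 < 1 + u) :
    Real.log (1 + u) ≤ u - u ^ 2 / 2 := by
  -- The power series of $-\log(1-x)$ at $x=-u\ge0$ has nonnegative terms, so its first two terms
  -- bound it from below.
  have hs := Real.hasSum_pow_div_log_of_abs_lt_one (x := -u) (by rw [abs_lt]; constructor <;> linarith)
  have := sum_le_hasSum (Finset.range 2) (fun i _ => by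
    have : 0 ≤ -u := by linarith
    positivity) hs
  simp only [Finset.sum_range_succ, Finset.sum_range_zero] at this
  norm_num at this
  linarith

/-- The chi-squared density with `2 * s ^ 2 + 2` degrees of freedom, centred at its mode and
rescaled, up to a normalizing factor. -/
def modeWeight (s z : ℝ) : ℝ :=
  if 0 < 1 + z / s then Real.exp (s ^ 2 * (Real.log (1 + z / s) - z / s)) else 0

theorem measurable_modeWeight (s : ℝ) : Measurable (modeWeight s) := by
  refine Measurable.ite (measurableSet_lt (by fun_prop) (by fun_prop)) ?_ measurable_const
  fun_prop

theorem modeWeight_nonneg (s z : ℝ) : 0 ≤ modeWeight s z := by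
  unfold modeWeight
  split_ifs
  · positivity
  · rfl

/-- A majorant independent of $s$. For $z\ge0$ the exponent is at most $-z^2/(2(1+z/s))$, and
$s\ge1$ allows $z/s$ to be replaced by $z$; for $z\le0$ it is at most $-z^2/2$. -/
theorem modeWeight_le {s : ℝ} (hs : 1 ≤ s) (z : ℝ) :
    modeWeight s z ≤ Real.exp ((1 - |z|) / 2) := by
  unfold modeWeight
  have hs0 : 0 < s := by linarith
  split_ifs with h
  · refine Real.exp_le_exp.2 ?_
    have hz : z = s * (z / s) := by field_simp
    rcases le_total 0 z with h0 | h0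
    · have h1 := log_one_add_le_of_nonneg (div_nonneg h0 hs0.le)
      have h2 : z / s ≤ z := div_le_self h0 hs
      rw [abs_of_nonneg h0]
      calc s ^ 2 * (Real.log (1 + z / s) - z / s)
          ≤ s ^ 2 * (-((z / s) ^ 2 / (2 * (1 + z / s)))) := by gcongr; linarith
        _ = -(z ^ 2 / (2 * (1 + z / s))) := by rw [div_pow]; field_simp
        _ ≤ -(z ^ 2 / (2 * (1 + z))) := by gcongr
        _ ≤ (1 - z) / 2 := by
          rw [neg_le_iff_add_nonneg, div_add_div _ _ (by norm_num) (by positivity)]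
          refine div_nonneg ?_ (by positivity)
          nlinarith
    · have h1 := log_one_add_le_of_nonpos (div_nonpos_of_nonpos_of_nonneg h0 hs0.le) h
      rw [abs_of_nonpos h0]
      calc s ^ 2 * (Real.log (1 + z / s) - z / s)
          ≤ s ^ 2 * (-((z / s) ^ 2 / 2)) := by gcongr; linarith
        _ = -(z ^ 2 / 2) := by rw [div_pow]; field_simp
        _ ≤ (1 - -z) / 2 := by nlinarith [sq_nonneg (z + 1)]
  · positivity

theorem tendsto_modeWeight (z : ℝ) :
    Tendsto (fun s => modeWeight s z) atTop (𝓝 (Real.exp (-z ^ 2 / 2))) := by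
  have key : Tendsto (fun s => s ^ 2 * (Real.log (1 + z / s) - z / s)) atTop
      (𝓝 (-z ^ 2 / 2)) := by
    rw [← tendsto_sub_nhds_zero_iff]
    have hlim : Tendsto (fun s : ℝ => 2 * |z| ^ 3 / s) atTop (𝓝 0) :=
      tendsto_const_nhds.div_atTop tendsto_id
    refine squeeze_zero_norm' ?_ hlim
    filter_upwards [eventually_ge_atTop (2 * |z|), eventually_gt_atTop 0] with s hs h0
    have hu : |z / s| ≤ 1 / 2 := by
      rw [abs_div, abs_of_pos h0, div_le_iff₀ h0]; linarith
    -- Second order Taylor expansion of the logarithm at $z/s$: for $|z/s|\le1/2$ the remainder is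
    -- at most $2|z/s|^3$, which after multiplication by $s^2$ is still $O(1/s)$.
    have h1 := Real.abs_log_sub_add_sum_range_le (x := -(z / s)) (by rw [abs_neg]; linarith) 2
    simp only [Finset.sum_range_succ, Finset.sum_range_zero, abs_neg, sub_neg_eq_add] at h1
    have h2 : s ^ 2 * (Real.log (1 + z / s) - z / s) - -z ^ 2 / 2 =
        s ^ 2 * (0 + (-(z / s)) ^ (0 + 1) / ((0 : ℕ) + 1) + (-(z / s)) ^ (1 + 1) / ((1 : ℕ) + 1)
          + Real.log (1 + z / s)) := by
      have : z = s * (z / s) := by field_simp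
      push_cast
      field_simp
      ring
    rw [h2, norm_mul, Real.norm_of_nonneg (sq_nonneg s), Real.norm_eq_abs]
    calc _ ≤ s ^ 2 * (|z / s| ^ 3 / (1 / 2)) := by
          refine mul_le_mul_of_nonneg_left (h1.trans ?_) (sq_nonneg s)
          gcongr
          linarith
      _ = 2 * |z| ^ 3 / s := by
          rw [abs_div, abs_of_pos h0]
          field_simp
  refine ((Real.continuous_exp.tendsto _).comp key).congr' ?_
  have h1 : Tendsto (fun s : ℝ => 1 + z / s) atTop (𝓝 (1 + 0)) :=
    tendsto_const_nhds.add (tendsto_const_nhds.div_atTop tendsto_id)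
  filter_upwards [h1.eventually (lt_mem_nhds (by norm_num : (0 : ℝ) < 1 + 0))] with s hs
  simp [modeWeight, hs]

theorem integrable_exp_neg_abs_div_two : Integrable fun z : ℝ => Real.exp ((1 - |z|) / 2) := by
  rw [← integrableOn_univ, ← Set.Iic_union_Ioi (a := (0 : ℝ))]
  refine IntegrableOn.union ?_ ?_
  · refine IntegrableOn.congr_fun ((integrableOn_exp_mul_Iic (a := 1 / 2) (by norm_num) 0).const_mul
      (Real.exp (1 / 2))) (fun z hz => ?_) measurableSet_Iic
    rw [← Real.exp_add, abs_of_nonpos hz]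
    congr 1
    ring
  · refine IntegrableOn.congr_fun ((integrableOn_exp_mul_Ioi (a := -1 / 2) (by norm_num) 0).const_mul
      (Real.exp (1 / 2))) (fun z hz => ?_) measurableSet_Ioi
    rw [← Real.exp_add, abs_of_pos hz]
    congr 1
    ring

/-- With $f=2s^2+2$ degrees of freedom the mode of the density is $f-2=2s^2$. Centring there removes
the linear term of the exponent, and the scale $2s$ makes its quadratic term $-z^2/2$. -/
theorem chiWeight_mode {s : ℝ} (hs : 0 < s) (z : ℝ) :
    chiWeight (2 * s ^ 2 + 2) (2 * s * z + 2 * s ^ 2) =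
      ((2 * s ^ 2) ^ (s ^ 2) * Real.exp (-s ^ 2)) * modeWeight s z := by
  have hx : 2 * s * z + 2 * s ^ 2 = 2 * s ^ 2 * (1 + z / s) := by field_simp; ring
  have he : (2 * s ^ 2 + 2) / 2 - 1 = s ^ 2 := by ring
  rw [chiWeight, modeWeight, he, hx]
  rcases lt_trichotomy 0 (1 + z / s) with h | h | h
  · rw [if_pos (by positivity), if_pos h, Real.mul_rpow (by positivity) h.le,
      Real.rpow_def_of_pos h, mul_assoc, ← Real.exp_add,
      mul_assoc _ (Real.exp (-s ^ 2)), ← Real.exp_add]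
    congr 2
    ring
  · rw [← h, mul_zero, if_pos le_rfl, Real.zero_rpow (by positivity)]
    simp
  · rw [if_neg (not_le.2 (mul_neg_of_pos_of_neg (by positivity) h)), if_neg h.not_gt, mul_zero]

theorem integral_chiWeight_mode {s : ℝ} (hs : 0 < s) (G : ℝ → ℝ) :
    ∫ x, chiWeight (2 * s ^ 2 + 2) x * G x =
      2 * s * ((2 * s ^ 2) ^ (s ^ 2) * Real.exp (-s ^ 2)) *
        ∫ z, modeWeight s z * G (2 * s * z + 2 * s ^ 2) := by
  have h1 := Measure.integral_comp_mul_left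
    (fun y => chiWeight (2 * s ^ 2 + 2) (y + 2 * s ^ 2) * G (y + 2 * s ^ 2)) (2 * s)
  rw [integral_add_right_eq_self (fun y => chiWeight (2 * s ^ 2 + 2) y * G y),
    abs_of_pos (by positivity), smul_eq_mul, eq_inv_mul_iff_mul_eq₀ (by positivity)] at h1
  rw [← h1, mul_assoc (2 * s), ← integral_const_mul (_ * Real.exp _)]
  refine congrArg (2 * s * ·) ?_
  refine integral_congr_ae (ae_of_all volume fun z => ?_)
  dsimp only
  rw [chiWeight_mode hs]
  ring

theorem integral_KLaw_mode {s : ℝ} (hs : 0 < s) (g : ℝ →ᵇ ℝ) :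
    ∫ x, g x ∂(KLaw (2 * s ^ 2 + 2)) =
      (∫ z, modeWeight s z * g ((s * z - 1) / √(s ^ 2 + 1))) / ∫ z, modeWeight s z := by
  have h1 := integral_chiWeight_mode hs fun _ => 1
  simp only [mul_one] at h1
  rw [integral_KLaw (by positivity), integral_chiWeight_mode hs, h1,
    mul_div_mul_left _ _ (by positivity)]
  congr 2
  funext z
  congr 2
  rw [show 2 * (2 * s ^ 2 + 2) = 2 ^ 2 * (s ^ 2 + 1) by ring, Real.sqrt_mul (by positivity),
    Real.sqrt_sq (by norm_num)]
  rw [show 2 * s * z + 2 * s ^ 2 - (2 * s ^ 2 + 2) = 2 * (s * z - 1) by ring,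
    mul_div_mul_left _ _ (by norm_num)]

theorem tendsto_mode_rescale (z : ℝ) :
    Tendsto (fun s => (s * z - 1) / √(s ^ 2 + 1)) atTop (𝓝 z) := by
  have hinv : Tendsto (fun s : ℝ => 1 / s) atTop (𝓝 0) := tendsto_const_nhds.div_atTop tendsto_id
  have h : Tendsto (fun s : ℝ => (z - 1 / s) / √(1 + (1 / s) ^ 2)) atTop
      (𝓝 ((z - 0) / √(1 + 0 ^ 2))) :=
    (tendsto_const_nhds.sub hinv).div
      ((Real.continuous_sqrt.tendsto _).comp (tendsto_const_nhds.add (hinv.pow 2))) (by simp)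
  simp only [sub_zero, ne_eq, OfNat.ofNat_ne_zero, not_false_eq_true, zero_pow, add_zero,
    Real.sqrt_one, div_one] at h
  refine h.congr' ?_
  filter_upwards [eventually_gt_atTop 0] with s hs
  rw [show s ^ 2 + 1 = s ^ 2 * (1 + (1 / s) ^ 2) by field_simp, Real.sqrt_mul (sq_nonneg s),
    Real.sqrt_sq hs.le, show s * z - 1 = s * (z - 1 / s) by field_simp,
    mul_div_mul_left _ _ hs.ne']

theorem tendsto_integral_modeWeight (g : ℝ →ᵇ ℝ) :
    Tendsto (fun s => ∫ z, modeWeight s z * g ((s * z - 1) / √(s ^ 2 + 1))) atTop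
      (𝓝 (∫ z, Real.exp (-z ^ 2 / 2) * g z)) := by
  refine tendsto_integral_filter_of_dominated_convergence
    (fun z => Real.exp ((1 - |z|) / 2) * ‖g‖) ?_ ?_
    (integrable_exp_neg_abs_div_two.mul_const _) ?_
  · refine Eventually.of_forall fun s => ?_
    refine (measurable_modeWeight s).aestronglyMeasurable.mul ?_
    exact (g.continuous.comp (by fun_prop)).aestronglyMeasurable
  · filter_upwards [eventually_ge_atTop 1] with s hs
    refine ae_of_all _ fun z => ?_
    rw [norm_mul, Real.norm_of_nonneg (modeWeight_nonneg s z)]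
    exact mul_le_mul (modeWeight_le hs z) (g.norm_coe_le_norm _) (norm_nonneg _)
      (Real.exp_pos _).le
  · exact ae_of_all _ fun z => (tendsto_modeWeight z).mul
      ((g.continuous.tendsto _).comp (tendsto_mode_rescale z))

theorem integral_stdGaussian (G : ℝ → ℝ) :
    ∫ x, G x ∂(gaussianReal 0 1) = (√(2 * Real.pi))⁻¹ * ∫ z, Real.exp (-z ^ 2 / 2) * G z := by
  rw [integral_gaussianReal_eq_integral_smul one_ne_zero, ← integral_const_mul]
  congr 1
  funext z
  simp [gaussianPDFReal, mul_assoc]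

theorem tendsto_integral_KLaw_atTop (g : ℝ →ᵇ ℝ) :
    Tendsto (fun f => ∫ x, g x ∂(KLaw f)) atTop (𝓝 (∫ x, g x ∂(gaussianReal 0 1))) := by
  have h1 := tendsto_integral_modeWeight (BoundedContinuousFunction.const ℝ 1)
  have hn := integral_stdGaussian fun _ => 1
  simp only [BoundedContinuousFunction.const_apply, mul_one, integral_const, probReal_univ,
    smul_eq_mul] at h1 hn
  have h0 : ∫ z : ℝ, Real.exp (-z ^ 2 / 2) ≠ 0 := by
    intro h
    rw [h, mul_zero] at hn
    exact one_ne_zero hn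
  have h2 := (tendsto_integral_modeWeight g).div h1 h0
  have heq : (∫ z, Real.exp (-z ^ 2 / 2) * g z) / ∫ z : ℝ, Real.exp (-z ^ 2 / 2) =
      ∫ x, g x ∂(gaussianReal 0 1) := by
    rw [integral_stdGaussian, div_eq_iff h0]
    linear_combination (∫ z, Real.exp (-z ^ 2 / 2) * g z) * hn
  rw [heq] at h2
  have h3 : Tendsto (fun f : ℝ => √(f / 2 - 1)) atTop atTop := by
    refine Real.tendsto_sqrt_atTop.comp (tendsto_atTop_add_const_right _ _ ?_)
    exact tendsto_id.atTop_div_const (by norm_num)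
  refine (h2.comp h3).congr' ?_
  filter_upwards [eventually_gt_atTop 2] with f hf
  have hs : 0 < √(f / 2 - 1) := Real.sqrt_pos.2 (by linarith)
  have := integral_KLaw_mode hs g
  rw [Real.sq_sqrt (by linarith), show 2 * (f / 2 - 1) + 2 = f by ring] at this
  simp only [Function.comp, Pi.div_apply]
  rw [this, Real.sq_sqrt (by linarith)]

/-! ### The limit laws -/

/-- The law of `K_f` as a function of `1 / f`, extended by the standard normal distribution. -/
def kLimit (c : ℝ) : Measure ℝ := if 0 < c then KLaw (1 / c) else gaussianReal 0 1

theorem kLimit_of_pos {c : ℝ} (hc : 0 < c) : kLimit c = KLaw (1 / c) := if_pos hc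

theorem kLimit_of_nonpos {c : ℝ} (hc : c ≤ 0) : kLimit c = gaussianReal 0 1 := if_neg hc.not_gt

theorem kLimit_one : kLimit 1 = stdChiSquaredOne := by
  rw [kLimit_of_pos one_pos, stdChiSquaredOne_eq, div_one]

instance isProbabilityMeasure_kLimit (c : ℝ) : IsProbabilityMeasure (kLimit c) := by
  unfold kLimit
  split_ifs with h
  · exact isProbabilityMeasure_KLaw (by positivity)
  · infer_instance

/-- The only delicate point is 0 from the right, where $1/c\to\infty$ and the normal approximation
of the chi-squared law applies. -/
theorem continuous_integral_kLimit (g : ℝ →ᵇ ℝ) : Continuous fun c => ∫ x, g x ∂(kLimit c) := by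
  refine continuous_iff_continuousAt.2 fun c => ?_
  rcases lt_trichotomy c 0 with hc | rfl | hc
  · refine continuousAt_const.congr (f := fun _ => ∫ x, g x ∂(gaussianReal 0 1)) ?_
    filter_upwards [gt_mem_nhds hc] with y hy
    rw [kLimit_of_nonpos (le_of_lt hy)]
  · refine continuousAt_iff_continuous_left_right.2 ⟨?_, ?_⟩
    · refine (continuousWithinAt_const (b := ∫ x, g x ∂(gaussianReal 0 1))).congr
        (fun y hy => ?_) ?_
      · rw [kLimit_of_nonpos hy]
      · rw [kLimit_of_nonpos le_rfl]
    · refine continuousWithinAt_Ioi_iff_Ici.1 ?_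
      have h := (tendsto_integral_KLaw_atTop g).comp tendsto_inv_nhdsGT_zero
      rw [← kLimit_of_nonpos (le_refl 0)] at h
      refine h.congr' ?_
      filter_upwards [self_mem_nhdsWithin] with y hy
      rw [kLimit_of_pos hy, one_div]
      rfl
  · have h : ContinuousAt (fun c => ∫ x, g x ∂(KLaw (1 / c))) c :=
      ContinuousAt.comp (g := fun f => ∫ x, g x ∂(KLaw f))
        (continuousAt_integral_KLaw g (by positivity))
        (continuousAt_const.div continuousAt_id hc.ne')
    refine h.congr ?_
    filter_upwards [lt_mem_nhds hc] with y hy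
    rw [kLimit_of_pos hy]

theorem chiSquaredLaw_Iio_eq_zero_iff {f : ℝ} (hf : 0 < f) (y : ℝ) :
    chiSquaredLaw f (Set.Iio y) = 0 ↔ y ≤ 0 := by
  have hm : Measurable (gammaPDF (f / 2) (1 / 2)) := (measurable_gammaPDFReal _ _).ennreal_ofReal
  rw [chiSquaredLaw, gammaMeasure, withDensity_apply_eq_zero hm]
  constructor
  · intro h
    by_contra! hy
    have hsub : Set.Ioo 0 y ⊆ {x | gammaPDF (f / 2) (1 / 2) x ≠ 0} ∩ Set.Iio y := fun x hx =>
      ⟨(ENNReal.ofReal_pos.2 (gammaPDFReal_pos (by positivity) (by norm_num) hx.1)).ne', hx.2⟩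
    have := measure_mono_null hsub h
    rw [Real.volume_Ioo, ENNReal.ofReal_eq_zero] at this
    linarith
  · intro hy
    refine measure_mono_null (t := ∅) (fun x hx => hx.1 ?_) measure_empty
    exact gammaPDF_of_neg (lt_of_lt_of_le hx.2 hy)

/-- Standardization moves the left end 0 of the chi-squared support to $-f/\sqrt{2f}=-\sqrt{f/2}$,
from which $f$ can be recovered. -/
theorem KLaw_Iio_eq_zero_iff {f : ℝ} (hf : 0 < f) (t : ℝ) :
    KLaw f (Set.Iio t) = 0 ↔ t ≤ -√(f / 2) := by
  have hs : 0 < √(f / 2) := Real.sqrt_pos.2 (by positivity)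
  have hsq : √(f / 2) ^ 2 = f / 2 := Real.sq_sqrt (by positivity)
  have h2 : √(2 * f) = 2 * √(f / 2) := by
    rw [show 2 * f = 2 ^ 2 * (f / 2) by ring, Real.sqrt_mul (by positivity),
      Real.sqrt_sq (by norm_num)]
  have hpre : (fun x => (x - f) / √(2 * f)) ⁻¹' Set.Iio t = Set.Iio (t * √(2 * f) + f) := by
    ext x
    rw [Set.mem_preimage, Set.mem_Iio, Set.mem_Iio, div_lt_iff₀ (by rw [h2]; positivity),
      sub_lt_iff_lt_add]
  rw [KLaw, Measure.map_apply (by fun_prop) measurableSet_Iio, hpre,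
    chiSquaredLaw_Iio_eq_zero_iff hf, h2]
  constructor
  · intro h
    by_contra! hc
    nlinarith
  · intro h
    nlinarith

theorem gaussianReal_Iio_ne_zero (t : ℝ) : gaussianReal 0 1 (Set.Iio t) ≠ 0 := fun h => by
  have := gaussianReal_absolutelyContinuous' 0 one_ne_zero h
  simp at this

/-- Different $c>0$ give different left ends of the support, whereas the normal law at $c=0$ charges
every left half-line. -/
theorem kLimit_injOn : Set.InjOn kLimit (Set.Ici 0) := by
  have key : ∀ {c c' : ℝ}, 0 < c → 0 ≤ c' → kLimit c = kLimit c' → c = c' := by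
    intro c c' hc hc' h
    have h0 : ∀ t, kLimit c (Set.Iio t) = 0 ↔ kLimit c' (Set.Iio t) = 0 := fun t => by rw [h]
    rw [kLimit_of_pos hc] at h0
    rcases hc'.eq_or_lt with rfl | hc'
    · rw [kLimit_of_nonpos le_rfl] at h0
      exact absurd ((h0 _).1 ((KLaw_Iio_eq_zero_iff (by positivity) _).2 le_rfl))
        (gaussianReal_Iio_ne_zero _)
    · simp only [kLimit_of_pos hc', KLaw_Iio_eq_zero_iff (one_div_pos.2 hc),
        KLaw_Iio_eq_zero_iff (one_div_pos.2 hc')] at h0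
      have h1 := le_antisymm ((h0 _).1 le_rfl) ((h0 _).2 le_rfl)
      rw [neg_inj, Real.sqrt_inj (by positivity) (by positivity)] at h1
      field_simp at h1
      linarith
  intro c hc c' hc' h
  rcases (Set.mem_Ici.1 hc).eq_or_lt with rfl | hpos
  · rcases (Set.mem_Ici.1 hc').eq_or_lt with rfl | hpos'
    · rfl
    · exact (key hpos' hc h.symm).symm
  · exact key hpos hc' h

/-- For the converse, compactness reduces the claim to uniqueness of cluster points. By continuity a
cluster point has the same limit law as `c₀`, and injectivity identifies the two. -/
theorem tendsto_iff_forall_integral_kLimit {c : ℕ → ℝ} (hc : ∀ k, c k ∈ Set.Icc (0 : ℝ) 1)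
    {c₀ : ℝ} (h₀ : 0 ≤ c₀) :
    Tendsto c atTop (𝓝 c₀) ↔ ∀ g : ℝ →ᵇ ℝ,
      Tendsto (fun k => ∫ x, g x ∂(kLimit (c k))) atTop (𝓝 (∫ x, g x ∂(kLimit c₀))) := by
  refine ⟨fun h g => ((continuous_integral_kLimit g).tendsto c₀).comp h, fun h => ?_⟩
  refine isCompact_Icc.tendsto_nhds_of_unique_mapClusterPt (Eventually.of_forall hc)
    fun y hy hcl => ?_
  refine kLimit_injOn hy.1 h₀ (ext_of_forall_integral_eq_of_IsFiniteMeasure fun g => ?_)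
  obtain ⟨u, hu, hlim⟩ := mapClusterPt_iff_ultrafilter.1 hcl
  exact tendsto_nhds_unique (((continuous_integral_kLimit g).tendsto y).comp hlim)
    ((h g).mono_left hu)

end

noncomputable section

open BoundedContinuousFunction

/-! ### Convergence in probability on varying spaces -/

section Varying

variable {Ω : ℕ → Type*} [∀ k, MeasurableSpace (Ω k)] {P : ∀ k, Measure (Ω k)}

theorem TendstoZeroInProbability.of_eventually {Y : ∀ k, Ω k → ℝ} {B : ℝ → ∀ k, Set (Ω k)}
    (hB : ∀ ε, 0 < ε → Tendsto (fun k => P k (B ε k)) atTop (𝓝 0))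
    (h : ∀ ε, 0 < ε → ∀ᶠ k in atTop, ∀ᵐ ω ∂(P k), ω ∉ B ε k → |Y k ω| < ε) :
    TendstoZeroInProbability P Y := fun ε hε => by
  refine tendsto_of_tendsto_of_tendsto_of_le_of_le' tendsto_const_nhds (hB ε hε)
    (Eventually.of_forall fun _ => zero_le) ?_
  filter_upwards [h ε hε] with k hk
  refine measure_mono_ae ?_
  filter_upwards [hk] with ω hω (hε' : ε ≤ |Y k ω|)
  by_contra hc
  exact absurd (hω hc) (not_lt.2 hε')

theorem TendstoZeroInProbability.add {Y Z : ∀ k, Ω k → ℝ} (hY : TendstoZeroInProbability P Y)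
    (hZ : TendstoZeroInProbability P Z) :
    TendstoZeroInProbability P fun k ω => Y k ω + Z k ω := by
  refine .of_eventually
    (B := fun ε k => {ω | ε / 2 ≤ |Y k ω|} ∪ {ω | ε / 2 ≤ |Z k ω|}) (fun ε hε => ?_) fun ε _ =>
      Eventually.of_forall fun k => ae_of_all _ fun ω hω => ?_
  · have h := (hY (ε / 2) (by positivity)).add (hZ (ε / 2) (by positivity))
    rw [add_zero] at h
    exact tendsto_of_tendsto_of_tendsto_of_le_of_le tendsto_const_nhds h
      (fun _ => zero_le) fun k => measure_union_le _ _
  · simp only [Set.mem_union, Set.mem_ofPred_eq, not_or, not_le] at hω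
    have := abs_add_le (Y k ω) (Z k ω)
    linarith

theorem tendstoZeroInProbability_const_iff [∀ k, IsProbabilityMeasure (P k)] {y : ℕ → ℝ} :
    TendstoZeroInProbability P (fun k _ => y k) ↔ Tendsto y atTop (𝓝 0) := by
  constructor
  · intro h
    refine Metric.tendsto_atTop'.2 fun ε hε => ?_
    obtain ⟨n, hn⟩ := eventually_atTop.1 ((h ε hε).eventually (gt_mem_nhds zero_lt_one))
    refine ⟨n, fun k hk => ?_⟩
    rw [Real.dist_eq, sub_zero]
    by_contra! hc
    have := hn k hk.le
    simp [hc] at this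
  · intro h
    refine .of_eventually (B := fun _ _ => ∅) (fun ε _ => by simp) fun ε hε => ?_
    have := h.abs
    rw [abs_zero] at this
    filter_upwards [this.eventually (gt_mem_nhds hε)] with k hk
    exact ae_of_all _ fun _ _ => hk

theorem TendstoZeroInProbability.iff_of_sub [∀ k, IsProbabilityMeasure (P k)]
    {Y : ∀ k, Ω k → ℝ} {y : ℕ → ℝ} (h : TendstoZeroInProbability P fun k ω => Y k ω - y k)
    (b : ℝ) :
    (TendstoZeroInProbability P fun k ω => Y k ω - b) ↔ Tendsto y atTop (𝓝 b) := by
  have hneg : TendstoZeroInProbability P fun k ω => -(Y k ω - y k) := by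
    intro ε hε
    simpa only [abs_neg] using h ε hε
  rw [← tendsto_sub_nhds_zero_iff, ← tendstoZeroInProbability_const_iff (P := P)]
  constructor
  · intro hY
    have := hY.add hneg
    refine fun ε hε => (this ε hε).congr fun k => ?_
    congr! 5
    ring
  · intro hy
    have := h.add hy
    refine fun ε hε => (this ε hε).congr fun k => ?_
    congr! 5
    ring

/-- Bounded convergence on varying spaces: $|Y|$ is at most $\varepsilon/2$ plus $C$ times the
indicator of $|Y|\ge\varepsilon/2$. -/
theorem TendstoZeroInProbability.tendsto_integral [∀ k, IsProbabilityMeasure (P k)]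
    {Y : ∀ k, Ω k → ℝ} (h : TendstoZeroInProbability P Y)
    (hm : ∀ k, AEMeasurable (Y k) (P k)) {C : ℝ} (hC : ∀ k ω, |Y k ω| ≤ C) :
    Tendsto (fun k => ∫ ω, Y k ω ∂(P k)) atTop (𝓝 0) := by
  have hint : ∀ k, Integrable (Y k) (P k) := fun k =>
    Integrable.of_bound (hm k).aestronglyMeasurable C (ae_of_all _ (hC k))
  refine Metric.tendsto_atTop.2 fun ε hε => ?_
  have h1 := (ENNReal.tendsto_toReal ENNReal.zero_ne_top).comp (h (ε / 2) (by positivity))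
  have h2 := h1.const_mul C
  simp only [ENNReal.toReal_zero, mul_zero] at h2
  obtain ⟨n, hn⟩ := eventually_atTop.1 (h2.eventually (gt_mem_nhds (half_pos hε)))
  refine ⟨n, fun k hk => ?_⟩
  rw [Real.dist_eq, sub_zero]
  have hns : NullMeasurableSet {ω | ε / 2 ≤ |Y k ω|} (P k) :=
    nullMeasurableSet_le aemeasurable_const (hm k).abs
  have h3 : ∫ ω, |Y k ω| ∂(P k) ≤
      ∫ ω, (ε / 2 + {ω | ε / 2 ≤ |Y k ω|}.indicator (fun _ => C) ω) ∂(P k) := by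
    refine integral_mono (hint k).abs
      ((integrable_const _).add ((integrable_const C).indicator₀ hns)) fun ω => ?_
    by_cases hω : ε / 2 ≤ |Y k ω|
    · simp only [Set.indicator, Set.mem_ofPred_eq, hω, if_true]
      have := hC k ω
      linarith
    · simp only [Set.indicator, Set.mem_ofPred_eq, hω, if_false]
      linarith
  rw [integral_add (integrable_const _) ((integrable_const C).indicator₀ hns),
    integral_indicator₀ hns] at h3
  simp only [integral_const, probReal_univ, smul_eq_mul, one_mul, measureReal_restrict_apply_univ]
    at h3
  have h4 := hn k hk
  simp only [Function.comp] at h4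
  rw [measureReal_def, mul_comm] at h3
  have h5 := abs_integral_le_integral_abs (f := Y k) (μ := P k)
  linarith

end Varying

/-! ### Consistency of the estimated degrees of freedom -/

/-- The density contains the factor $1/\Gamma(0)$, which is 0 by convention. Thus `KLaw 0` is not a
probability measure, and an estimate equal to 0, such as the one produced by a vanishing
denominator, has to be excluded almost surely. -/
theorem KLaw_zero : KLaw 0 = 0 := by
  have : gammaPDF (0 / 2) (1 / 2) = 0 := by
    funext x
    simp [gammaPDF, gammaPDFReal]
  rw [KLaw, chiSquaredLaw, gammaMeasure, this]
  simp

theorem integral_KLaw_of_nonneg (g : ℝ →ᵇ ℝ) {f : ℝ} (hf : 0 ≤ f) :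
    ∫ x, g x ∂(KLaw f) = if 0 < f then ∫ x, g x ∂(kLimit (1 / f)) else 0 := by
  split_ifs with h
  · rw [kLimit_of_pos (by positivity), one_div_one_div]
  · rw [le_antisymm (not_lt.1 h) hf, KLaw_zero, integral_zero_measure]

theorem abs_integral_kLimit_le (g : ℝ →ᵇ ℝ) (c : ℝ) : |∫ x, g x ∂(kLimit c)| ≤ ‖g‖ := by
  simpa using g.norm_integral_le_norm (kLimit c)

theorem abs_integral_KLaw_le (g : ℝ →ᵇ ℝ) {f : ℝ} (hf : 0 ≤ f) :
    |∫ x, g x ∂(KLaw f)| ≤ ‖g‖ := by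
  rw [integral_KLaw_of_nonneg g hf]
  split_ifs
  · exact abs_integral_kLimit_le g _
  · simp

theorem abs_sq_div_cube_sub_le {x y τ δ : ℝ} (hτ : 0 ≤ τ) (hτ1 : τ ≤ 1) (hδ : 0 < δ)
    (hδ2 : δ ≤ 1 / 2) (hx : |x - 1| < δ) (hy : |y - τ| < δ) :
    0 < x ∧ |y ^ 2 / x ^ 3 - τ ^ 2| ≤ 64 * δ := by
  have hx' := abs_lt.1 hx
  have hy' := abs_lt.1 hy
  have hx0 : 1 / 2 ≤ x := by linarith
  have hx3 : 1 / 8 ≤ x ^ 3 := by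
    have := pow_le_pow_left₀ (by norm_num) hx0 3
    norm_num at this ⊢
    exact this
  refine ⟨by linarith, ?_⟩
  have e : y ^ 2 / x ^ 3 - τ ^ 2 = ((y - τ) * (y + τ) - τ ^ 2 * ((x - 1) * (x ^ 2 + x + 1))) / x ^ 3 := by
    have : x ^ 3 ≠ 0 := by positivity
    field_simp
    ring
  have h1 : |(y - τ) * (y + τ)| ≤ δ * (5 / 2) := by
    rw [abs_mul]
    refine mul_le_mul hy.le ?_ (abs_nonneg _) hδ.le
    rw [abs_le]
    constructor <;> linarith
  have h2 : |τ ^ 2 * ((x - 1) * (x ^ 2 + x + 1))| ≤ 1 * (δ * 5) := by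
    rw [abs_mul, abs_mul]
    refine mul_le_mul ?_ ?_ (by positivity) zero_le_one
    · rw [abs_of_nonneg (sq_nonneg _)]
      exact pow_le_one₀ hτ hτ1
    · refine mul_le_mul hx.le ?_ (abs_nonneg _) hδ.le
      rw [abs_of_nonneg (by positivity)]
      nlinarith
  rw [e, abs_div, abs_of_pos (by positivity : 0 < x ^ 3), div_le_iff₀ (by positivity)]
  -- The numerator is at most $(5/2+5)\delta$ and the denominator at least $1/8$, which gives
  -- $60\delta\le64\delta$.
  have h3 := abs_sub ((y - τ) * (y + τ)) (τ ^ 2 * ((x - 1) * (x ^ 2 + x + 1)))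
  nlinarith

namespace SplitPlot

/-- The error of $a_3$ is measured against $t_2^{3/2}$, not against the possibly much smaller $t_3$.
This suffices because reciprocals of the degrees of freedom are compared, which are continuous in
$a_3/t_2^{3/2}$ down to 0. -/
theorem abs_sq_div_cube_sub_tau_le (M : SplitPlot) {a₂ a₃ δ : ℝ} (hδ : 0 < δ) (hδ2 : δ ≤ 1 / 2)
    (h2 : (a₂ - M.t2) ^ 2 < δ ^ 2 * M.t2 ^ 2) (h3 : (a₃ - M.t3) ^ 2 < δ ^ 2 * M.t2 ^ 3) :
    0 < a₂ ∧ |1 / (a₂ ^ 3 / a₃ ^ 2) - M.tau ^ 2| ≤ 64 * δ := by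
  have hp := M.t2_pos
  have hr : 0 < √M.t2 := Real.sqrt_pos.2 hp
  have hsq : √M.t2 ^ 2 = M.t2 := Real.sq_sqrt hp.le
  have hx : |a₂ / M.t2 - 1| < δ := by
    refine abs_lt_of_sq_lt_sq ?_ hδ.le
    rw [show a₂ / M.t2 - 1 = (a₂ - M.t2) / M.t2 by field_simp, div_pow, div_lt_iff₀ (by positivity)]
    exact h2
  have hy : |a₃ / √M.t2 ^ 3 - M.tau| < δ := by
    refine abs_lt_of_sq_lt_sq ?_ hδ.le
    rw [tau, ← sub_div, div_pow, div_lt_iff₀ (by positivity), ← pow_mul, mul_comm 3 2, pow_mul, hsq]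
    exact h3
  obtain ⟨h4, h5⟩ := abs_sq_div_cube_sub_le M.tau_pos.le M.tau_le_one hδ hδ2 hx hy
  refine ⟨by simpa [hp] using (div_pos_iff_of_pos_right hp).1 h4, ?_⟩
  convert h5 using 3
  rw [one_div_div, div_pow, div_pow, ← pow_mul, mul_comm 3 2, pow_mul, hsq]
  field_simp

end SplitPlot

/-- `a₂` and `a₃` estimate `tr ((T V) ^ 2)` and `tr ((T V) ^ 3)` with relative errors that tend
to `0` in probability. -/
structure IsConsistentPair (M : ℕ → SplitPlot) {Ω : ℕ → Type*} [∀ k, MeasurableSpace (Ω k)]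
    (P : ∀ k, Measure (Ω k)) (a₂ a₃ : ∀ k, Ω k → ℝ) : Prop where
  aemeasurable_fst : ∀ k, AEMeasurable (a₂ k) (P k)
  aemeasurable_snd : ∀ k, AEMeasurable (a₃ k) (P k)
  nonneg : ∀ k ω, 0 ≤ a₂ k ω
  ae_ne_zero : ∀ᶠ k in atTop, ∀ᵐ ω ∂(P k), a₃ k ω ≠ 0
  close : ∀ δ : ℝ, 0 < δ → Tendsto (fun k => P k
    ({ω | δ ^ 2 * (M k).t2 ^ 2 ≤ (a₂ k ω - (M k).t2) ^ 2} ∪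
      {ω | δ ^ 2 * (M k).t2 ^ 3 ≤ (a₃ k ω - (M k).t3) ^ 2})) atTop (𝓝 0)

theorem measure_le_of_lintegral_sq_le {Ω : Type*} [MeasurableSpace Ω] {P : Measure Ω} {Y : Ω → ℝ}
    (hY : AEMeasurable Y P) {v r δ : ℝ} (hv : 0 < v) (hδ : 0 < δ)
    (h : ∫⁻ ω, ENNReal.ofReal (Y ω ^ 2) ∂P ≤ ENNReal.ofReal (v * r)) :
    P {ω | δ ^ 2 * v ≤ Y ω ^ 2} ≤ ENNReal.ofReal (r / δ ^ 2) := by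
  have h1 := meas_ge_le_lintegral_div (hY.pow_const 2).ennreal_ofReal
    (ε := ENNReal.ofReal (δ ^ 2 * v)) (ENNReal.ofReal_pos.2 (by positivity)).ne'
    ENNReal.ofReal_ne_top
  have h2 : {ω | ENNReal.ofReal (δ ^ 2 * v) ≤ ENNReal.ofReal (Y ω ^ 2)} =
      {ω | δ ^ 2 * v ≤ Y ω ^ 2} := by
    ext ω
    exact ENNReal.ofReal_le_ofReal_iff (sq_nonneg _)
  rw [h2] at h1
  refine h1.trans ((ENNReal.div_le_div_right h _).trans_eq ?_)
  rw [← ENNReal.ofReal_div_of_pos (by positivity)]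
  congr 1
  field_simp

namespace IsConsistentPair

variable {M : ℕ → SplitPlot} {Ω : ℕ → Type*} [∀ k, MeasurableSpace (Ω k)]
    {P : ∀ k, Measure (Ω k)} {a₂ a₃ : ∀ k, Ω k → ℝ}

theorem of_lintegral_le (hm₂ : ∀ k, AEMeasurable (a₂ k) (P k))
    (hm₃ : ∀ k, AEMeasurable (a₃ k) (P k)) (hnn : ∀ k ω, 0 ≤ a₂ k ω)
    (hne : ∀ᶠ k in atTop, ∀ᵐ ω ∂(P k), a₃ k ω ≠ 0) {r : ℕ → ℝ} (hr : Tendsto r atTop (𝓝 0))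
    (h₂ : ∀ᶠ k in atTop, ∫⁻ ω, ENNReal.ofReal ((a₂ k ω - (M k).t2) ^ 2) ∂(P k) ≤
      ENNReal.ofReal ((M k).t2 ^ 2 * r k))
    (h₃ : ∀ᶠ k in atTop, ∫⁻ ω, ENNReal.ofReal ((a₃ k ω - (M k).t3) ^ 2) ∂(P k) ≤
      ENNReal.ofReal ((M k).t2 ^ 3 * r k)) : IsConsistentPair M P a₂ a₃ := by
  refine ⟨hm₂, hm₃, hnn, hne, fun δ hδ => ?_⟩
  have h0 : Tendsto (fun k => ENNReal.ofReal (r k / δ ^ 2) + ENNReal.ofReal (r k / δ ^ 2)) atTop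
      (𝓝 0) := by
    have := ENNReal.tendsto_ofReal (hr.div_const (δ ^ 2))
    simpa using this.add this
  refine tendsto_of_tendsto_of_tendsto_of_le_of_le' tendsto_const_nhds h0
    (Eventually.of_forall fun _ => zero_le) ?_
  filter_upwards [h₂, h₃] with k hk₂ hk₃
  have hp := (M k).t2_pos
  exact (measure_union_le _ _).trans (add_le_add
    (measure_le_of_lintegral_sq_le ((hm₂ k).sub_const _) (by positivity) hδ hk₂)
    (measure_le_of_lintegral_sq_le ((hm₃ k).sub_const _) (by positivity) hδ hk₃))

theorem tendstoZero_of_close (h : IsConsistentPair M P a₂ a₃) {Y : ∀ k, Ω k → ℝ}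
    (hY : ∀ ε : ℝ, 0 < ε → ∃ η : ℝ, 0 < η ∧ ∀ k ω, 0 < a₂ k ω → a₃ k ω ≠ 0 →
      |1 / (a₂ k ω ^ 3 / a₃ k ω ^ 2) - (M k).tau ^ 2| < η → |Y k ω| < ε) :
    TendstoZeroInProbability P Y := by
  intro ε hε
  obtain ⟨η, hη, hYη⟩ := hY ε hε
  -- With this choice the bound $64\delta$ is at most $\eta/2<\eta$.
  have hδ : 0 < min (1 / 2) (η / 128) := by positivity
  refine tendsto_of_tendsto_of_tendsto_of_le_of_le' tendsto_const_nhds (h.close _ hδ)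
    (Eventually.of_forall fun _ => zero_le) ?_
  filter_upwards [h.ae_ne_zero] with k hk
  refine measure_mono_ae ?_
  filter_upwards [hk] with ω hω (hε' : ε ≤ |Y k ω|)
  by_contra hc
  obtain ⟨h1, h2⟩ := (M k).abs_sq_div_cube_sub_tau_le hδ (min_le_left _ _)
    (not_le.1 fun hle => hc (Or.inl hle)) (not_le.1 fun hle => hc (Or.inr hle))
  have h3 := min_le_right (1 / 2) (η / 128)
  exact absurd (hYη k ω h1 hω (by linarith)) (not_lt.2 hε')

theorem tendsto_one_div (h : IsConsistentPair M P a₂ a₃) :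
    TendstoZeroInProbability P fun k ω => 1 / (a₂ k ω ^ 3 / a₃ k ω ^ 2) - 1 / (M k).fP := by
  simp only [SplitPlot.one_div_fP]
  exact h.tendstoZero_of_close fun ε hε => ⟨ε, hε, fun _ _ _ _ hlt => hlt⟩

theorem ratio_nonneg (h : IsConsistentPair M P a₂ a₃) (k : ℕ) (ω : Ω k) :
    0 ≤ a₂ k ω ^ 3 / a₃ k ω ^ 2 :=
  div_nonneg (pow_nonneg (h.nonneg k ω) 3) (sq_nonneg _)

theorem tendsto_integral_KLaw (h : IsConsistentPair M P a₂ a₃) (g : ℝ →ᵇ ℝ) :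
    TendstoZeroInProbability P fun k ω => (∫ x, g x ∂(KLaw (a₂ k ω ^ 3 / a₃ k ω ^ 2))) -
      ∫ x, g x ∂(kLimit ((M k).tau ^ 2)) := by
  refine h.tendstoZero_of_close fun ε hε => ?_
  -- The sequence $\tau^2$ need not converge, so continuity must be uniform. The interval $[0,2]$
  -- contains $\tau^2\le1$ and every reciprocal estimate within distance 1 of it.
  have hu := (isCompact_Icc (a := (0 : ℝ)) (b := 2)).uniformContinuousOn_of_continuous
    (continuous_integral_kLimit g).continuousOn
  obtain ⟨η, hη, hg⟩ := Metric.uniformContinuousOn_iff.1 hu ε hε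
  refine ⟨min η 1, by positivity, fun k ω h2 h3 hlt => ?_⟩
  have hF : 0 < a₂ k ω ^ 3 / a₃ k ω ^ 2 := by positivity
  have ht : (M k).tau ^ 2 ≤ 1 := pow_le_one₀ (M k).tau_pos.le (M k).tau_le_one
  have h1 := abs_lt.1 (hlt.trans_le (min_le_right _ _))
  rw [integral_KLaw_of_nonneg g hF.le, if_pos hF]
  exact hg _ ⟨by positivity, by linarith⟩ _ ⟨sq_nonneg _, by linarith⟩
    (hlt.trans_le (min_le_left _ _))

theorem aemeasurable_integral_KLaw (h : IsConsistentPair M P a₂ a₃) (g : ℝ →ᵇ ℝ) (k : ℕ) :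
    AEMeasurable (fun ω => ∫ x, g x ∂(KLaw (a₂ k ω ^ 3 / a₃ k ω ^ 2))) (P k) := by
  simp only [integral_KLaw_of_nonneg g (h.ratio_nonneg k _)]
  have hm : Measurable fun f : ℝ => if 0 < f then ∫ x, g x ∂(kLimit (1 / f)) else 0 :=
    Measurable.ite measurableSet_Ioi
      ((continuous_integral_kLimit g).measurable.comp (by fun_prop)) measurable_const
  exact hm.comp_aemeasurable
    (((h.aemeasurable_fst k).pow_const 3).div ((h.aemeasurable_snd k).pow_const 2))

variable [∀ k, IsProbabilityMeasure (P k)]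

theorem tau_sq_mem_Icc (k : ℕ) : (M k).tau ^ 2 ∈ Set.Icc (0 : ℝ) 1 :=
  ⟨sq_nonneg _, pow_le_one₀ (M k).tau_pos.le (M k).tau_le_one⟩

theorem kTendstoConditionally_iff (h : IsConsistentPair M P a₂ a₃) {c : ℝ} (hc : 0 ≤ c) :
    KTendstoConditionally P (fun k ω => a₂ k ω ^ 3 / a₃ k ω ^ 2) (kLimit c) ↔
      Tendsto (fun k => (M k).tau ^ 2) atTop (𝓝 c) := by
  rw [tendsto_iff_forall_integral_kLimit tau_sq_mem_Icc hc]
  exact forall_congr' fun g => (h.tendsto_integral_KLaw g).iff_of_sub _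

theorem kTendstoInDistribution_iff (h : IsConsistentPair M P a₂ a₃) {c : ℝ} (hc : 0 ≤ c) :
    KTendstoInDistribution P (fun k ω => a₂ k ω ^ 3 / a₃ k ω ^ 2) (kLimit c) ↔
      Tendsto (fun k => (M k).tau ^ 2) atTop (𝓝 c) := by
  rw [tendsto_iff_forall_integral_kLimit tau_sq_mem_Icc hc]
  refine forall_congr' fun g => ?_
  have hb : ∀ k ω, |(∫ x, g x ∂(KLaw (a₂ k ω ^ 3 / a₃ k ω ^ 2))) -
      ∫ x, g x ∂(kLimit ((M k).tau ^ 2))| ≤ ‖g‖ + ‖g‖ := fun k ω =>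
    (abs_sub _ _).trans (add_le_add (abs_integral_KLaw_le g (h.ratio_nonneg k ω))
      (abs_integral_kLimit_le g _))
  have h1 := (h.tendsto_integral_KLaw g).tendsto_integral
    (fun k => (h.aemeasurable_integral_KLaw g k).sub_const _) hb
  have h2 : ∀ k, ∫ ω, ((∫ x, g x ∂(KLaw (a₂ k ω ^ 3 / a₃ k ω ^ 2))) -
      ∫ x, g x ∂(kLimit ((M k).tau ^ 2))) ∂(P k) =
      (∫ ω, (∫ x, g x ∂(KLaw (a₂ k ω ^ 3 / a₃ k ω ^ 2))) ∂(P k)) -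
        ∫ x, g x ∂(kLimit ((M k).tau ^ 2)) := fun k => by
    rw [integral_sub _ (integrable_const _), integral_const, probReal_univ, one_smul]
    exact Integrable.of_bound (h.aemeasurable_integral_KLaw g k).aestronglyMeasurable ‖g‖
      (ae_of_all _ fun ω => abs_integral_KLaw_le g (h.ratio_nonneg k ω))
  simp only [h2] at h1
  constructor
  · intro hd
    simpa using hd.sub h1
  · intro hd
    simpa using h1.add hd

theorem weak_limits_iff (h : IsConsistentPair M P a₂ a₃) :
    (KTendstoInDistribution P (fun k ω => a₂ k ω ^ 3 / a₃ k ω ^ 2) (gaussianReal 0 1) ↔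
        Tendsto (fun k => (M k).beta1) atTop (𝓝 0)) ∧
      (KTendstoInDistribution P (fun k ω => a₂ k ω ^ 3 / a₃ k ω ^ 2) stdChiSquaredOne ↔
        Tendsto (fun k => (M k).beta1) atTop (𝓝 1)) ∧
      (KTendstoConditionally P (fun k ω => a₂ k ω ^ 3 / a₃ k ω ^ 2) (gaussianReal 0 1) ↔
        Tendsto (fun k => (M k).beta1) atTop (𝓝 0)) ∧
      (KTendstoConditionally P (fun k ω => a₂ k ω ^ 3 / a₃ k ω ^ 2) stdChiSquaredOne ↔
        Tendsto (fun k => (M k).beta1) atTop (𝓝 1)) := by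
  rw [← kLimit_of_nonpos (le_refl 0), ← kLimit_one, tendsto_beta1_zero_iff, tendsto_beta1_one_iff]
  exact ⟨h.kTendstoInDistribution_iff le_rfl, h.kTendstoInDistribution_iff zero_le_one,
    h.kTendstoConditionally_iff le_rfl, h.kTendstoConditionally_iff zero_le_one⟩

end IsConsistentPair

/-! ### The trace estimators form consistent pairs -/

namespace SplitPlot

variable {M : SplitPlot}

theorem measurable_A2 : Measurable M.A2 :=
  (Finset.measurable_sum _ fun l _ => measurable_kernel2 l).div_const _

theorem measurable_A3 : Measurable M.A3 :=
  (Finset.measurable_sum _ fun l _ => measurable_kernel3 l).div_const _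

theorem A2_nonneg (x : M.Data) : 0 ≤ M.A2 x :=
  div_nonneg (Finset.sum_nonneg fun _ _ => sq_nonneg _) (by positivity)

theorem A2star_nonneg {U : ℕ} (x : M.Data) (s : M.Subsamples U 4) : 0 ≤ M.A2star x s :=
  div_nonneg (Finset.sum_nonneg fun _ _ => sq_nonneg _) (by positivity)

theorem IsSubsampling.aemeasurable_comp {Ω : Type*} [MeasurableSpace Ω] {P : Measure Ω}
    {X : Ω → M.Data} {U m : ℕ} {S : Ω → M.Subsamples U m} (hS : M.IsSubsampling P X S)
    (hX : AEMeasurable X P) {F : M.Data → M.Subsamples U m → ℝ}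
    (hF : ∀ s, Measurable fun x => F x s) : AEMeasurable (fun ω => F (X ω) (S ω)) P := by
  have : Measurable fun p : M.Data × M.Subsamples U m => F p.1 p.2 :=
    measurable_from_prod_countable_left hF
  exact this.comp_aemeasurable (hX.prodMk hS.aemeasurable)

end SplitPlot

theorem tendsto_nMin {M : ℕ → SplitPlot} (h : Framework1 M ∨ Framework2 M ∨ Framework3 M) :
    Tendsto (fun k => (M k).nMin) atTop atTop := by
  rcases h with h | h | h
  · exact tendsto_atTop_mono (fun k => min_le_right _ _) h.2
  · exact tendsto_atTop_mono (fun k => min_le_right _ _) h.2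
  · exact tendsto_atTop_mono (fun k => (min_le_right _ _).trans (min_le_right _ _)) h

theorem tendsto_rate {M : ℕ → SplitPlot} (h : Tendsto (fun k => (M k).nMin) atTop atTop)
    {U : ℕ → ℕ} (hU : Tendsto U atTop atTop) :
    Tendsto (fun k => (M k).rate (U k)) atTop (𝓝 0) := by
  have h1 := tendsto_one_div_atTop_nhds_zero_nat (𝕜 := ℝ)
  have h2 := ((h1.comp hU).add (h1.comp h)).const_mul (14112 * chaosConst)
  simpa [SplitPlot.rate, Function.comp_def] using h2

theorem mainTheorem5
    (M : ℕ → SplitPlot)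
    (hframe : Framework1 M ∨ Framework2 M ∨ Framework3 M)
    {Ω : ℕ → Type*} [∀ k, MeasurableSpace (Ω k)]
    (P : ∀ k, Measure (Ω k)) [∀ k, IsProbabilityMeasure (P k)]
    (X : ∀ k, Ω k → (M k).Data) (hX : ∀ k, (M k).IsSample (P k) (X k))
    (U : ℕ → ℕ) (hU : Tendsto U atTop atTop)
    (S4 : ∀ k, Ω k → (M k).Subsamples (U k) 4)
    (hS4 : ∀ k, (M k).IsSubsampling (P k) (X k) (S4 k))
    (S6 : ∀ k, Ω k → (M k).Subsamples (U k) 6)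
    (hS6 : ∀ k, (M k).IsSubsampling (P k) (X k) (S6 k)) :
    -- a)
    TendstoZeroInProbability P
      (fun k ω => 1 / (M k).fPhat (X k ω) - 1 / (M k).fP) ∧
    -- b)
    TendstoZeroInProbability P
      (fun k ω => 1 / (M k).fPhatStar (X k ω) (S4 k ω) (S6 k ω) - 1 / (M k).fP) ∧
    -- c)
    ∀ F : ∀ k, Ω k → ℝ,
      (F = (fun k ω => (M k).fPhat (X k ω)) ∨
        F = (fun k ω => (M k).fPhatStar (X k ω) (S4 k ω) (S6 k ω))) →
      (KTendstoInDistribution P F (gaussianReal 0 1) ↔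
        Tendsto (fun k => (M k).beta1) atTop (𝓝 0)) ∧
      (KTendstoInDistribution P F stdChiSquaredOne ↔
        Tendsto (fun k => (M k).beta1) atTop (𝓝 1)) ∧
      (KTendstoConditionally P F (gaussianReal 0 1) ↔
        Tendsto (fun k => (M k).beta1) atTop (𝓝 0)) ∧
      (KTendstoConditionally P F stdChiSquaredOne ↔
        Tendsto (fun k => (M k).beta1) atTop (𝓝 1)) := by
  have hn := tendsto_nMin hframe
  have hn0 : ∀ᶠ k in atTop, 0 < (M k).nMin := hn.eventually_gt_atTop 0
  have hU0 : ∀ᶠ k in atTop, 0 < U k := hU.eventually_gt_atTop 0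
  have hr := tendsto_rate hn hU
  have hA : IsConsistentPair M P (fun k ω => (M k).A2 (X k ω)) (fun k ω => (M k).A3 (X k ω)) := by
    refine .of_lintegral_le
      (fun k => SplitPlot.measurable_A2.comp_aemeasurable (hX k).aemeasurable)
      (fun k => SplitPlot.measurable_A3.comp_aemeasurable (hX k).aemeasurable)
      (fun k ω => SplitPlot.A2_nonneg _)
      (Eventually.of_forall fun k => (hX k).ae_A3_ne_zero (M k).t3_pos.ne') hr ?_ ?_
    · filter_upwards [hn0] with k hk using (hX k).lintegral_A2_le hk _
    · filter_upwards [hn0] with k hk using (hX k).lintegral_A3_le hk _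
  -- Closeness of the pair follows from the two separate error bounds by a union bound, whatever the
  -- joint law of `S4` and `S6`.
  have hS : IsConsistentPair M P (fun k ω => (M k).A2star (X k ω) (S4 k ω))
      (fun k ω => (M k).A3star (X k ω) (S6 k ω)) := by
    refine .of_lintegral_le
      (fun k => (hS4 k).aemeasurable_comp (hX k).aemeasurable SplitPlot.measurable_A2star)
      (fun k => (hS6 k).aemeasurable_comp (hX k).aemeasurable SplitPlot.measurable_A3star)
      (fun k ω => SplitPlot.A2star_nonneg _ _) ?_ hr ?_ ?_
    · filter_upwards [hU0] with k hk using (hX k).ae_A3star_ne_zero (M k).t3_pos.ne' (hS6 k) hk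
    · filter_upwards [hU0, hn0] with k hk hk' using (hX k).lintegral_A2star_le (hS4 k) hk hk'
    · filter_upwards [hU0, hn0] with k hk hk' using (hX k).lintegral_A3star_le (hS6 k) hk hk'
  refine ⟨hA.tendsto_one_div, hS.tendsto_one_div, ?_⟩
  rintro F (rfl | rfl)
  · exact hA.weak_limits_iff
  · exact hS.weak_limits_iff

end
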